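/- **Wavelets.** Let $h$ be a finitely supported real quadrature mirror filter ($\sum_n h_n=\sqrt2$, $\sum_n h_nh_{n+2m}=\delta_{0m}$; e.g. any Daubechies filter, Haar included), $g_n=(-1)^nh_{1-n}$, and let $\psi_1=g$, $\psi_{j+1}(n)=\sum_k h_{n-2k}\psi_j(k)$, $\psi_{j,k}(t)=\psi_j(k-t)$ be the discrete nondecimated wavelets. Put $\hat\psi_j(\omega)=\sum_s\psi_{j,0}(s)e^{i\omega s}$, $\Psi_j(\tau)=\sum_k\psi_{j,k}(0)\psi_{j,k}(\tau)$, and $A_n=\big(\sum_\tau\Psi_j(\tau)\Psi_l(\tau)\big)_{j,l=1}^n$. **Process.** Let $\{X_{t,T}\}_{t=0}^{T-1}$, $T=2^J$, be a zero-mean locally stationary wavelet process, $$X_{t,T}=\sum_{j=1}^{J}\sum_k w_{j,k;T}\,\psi_{j,k}(t)\,\xi_{j,k},$$ with $\xi_{j,k}$ independent and identically distributed with mean $0$ and variance $1$, and with functions $W_j$ such that $\sum_jW_j(z)^2<\infty$ uniformly in $z\in(0,1)$, $W_j$ is Lipschitz with constant $L_j$, the $L_j$ are bounded and $\sum_j2^jL_j<\infty$,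 and $\sup_k|w_{j,k;T}-W_j(k/T)|\le C_j/T$ with $\sum_jC_j<\infty$. (Each $W_j$ is extended from $(0,1)$ to $\mathbb R$ with the same Lipschitz constant; locations $k\notin\{0,\dots,T-1\}$ may be left out of the sum.) Let $S_j(z)=W_j(z)^2$ and $c(z,\tau)=\sum_{j\ge1}S_j(z)\Psi_j(\tau)$, and assume $$\sum_{\tau=0}^\infty\sup_{z\in(0,1)}|c(z,\tau)|<\infty,\qquad \operatorname*{ess\,inf}_{z\in(0,1),\,\omega}\ \sum_{j\ge1}S_j(z)|\hat\psi_j(\omega)|^2>0 .$$ **Local autocovariance estimator.** For a smoothing half-width $s=s_T$ and a number of scales $n=n_T$, let $I_{l,m}=\big(\sum_{t=0}^{T-1}X_{t,T}\psi_{l,m}(t)\big)^2$, $\tilde I_l(u)=\frac1{2s+1}\sum_{|m-[uT]|\le s}I_{l,m}$, $\hat S_j(u)=\sum_{l=1}^n(A_n^{-1})_{jl}\tilde I_l(u)$ and $\hat c(u,\tau)=\sum_{j=1}^n\hat S_j(u)\Psi_j(\tau)$. Assume $s_T\to\infty$, $s_T/T\to0$, $n_T\to\infty$ and $2^{n_T}\|A_{n_T}^{-1}\|/s_T\to0$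 (spectral norm). **Local partial autocorrelation.** Fix $z\in(0,1)$ and a lag $\tau\ge1$, and write $N=[zT]$. In the matrices and vectors below, the covariance of $X_{a,T}$ and $X_{b,T}$ ($N\le a,b\le N+\tau$) is replaced by its local approximation $c(\zeta_T(a,b),a-b)$, where $|\zeta_T(a,b)-z|\le K/T$ for some constant $K$ (e.g. $\zeta_T(a,b)=\frac{a+b}{2T}$ or $\zeta_T(a,b)=z$; a different such rule may be used for $r$). Let $\mathrm B$, $\mathrm B^{(b)}$ and $\mathrm B^{(f)}$ be the resulting $\tau\times\tau$ matrices for $(X_{N+\tau-1},\dots,X_N)$, for $(X_N,\dots,X_{N+\tau-1})$ and for $(X_{N+1},\dots,X_{N+\tau})$, and $r$ the resulting vector for $X_{N+\tau}$ with $(X_{N+\tau-1},\dots,X_N)$. Let $\varphi_{\tau}$ be the last entry of the solution of $\mathrm B\varphi=r$. Let $b^{(b)}=(-1,\beta_1,\dots,\beta_{\tau-1})^\top$ and $b^{(f)}=(\beta'_1,\dots,\beta'_{\tau-1},-1)^\top$, where $\beta$ and $\beta'$ solve the prediction equations for $X_N$ and $X_{N+\tau}$, respectively, from $X_{N+1},\dots,X_{N+\tau-1}$.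 Put $$q(z,\tau)=\varphi_\tau\left\{\frac{(b^{(b)})^\top\mathrm B^{(b)}b^{(b)}}{(b^{(f)})^\top\mathrm B^{(f)}b^{(f)}}\right\}^{1/2},$$ and let $\tilde q(z,\tau)$ be the same expression with $c$ replaced by $\hat c$ throughout. **Claim.** $\tilde q(z,\tau)$ is consistent: $\tilde q(z,\tau)-q(z,\tau)=o_p(1)$ as $T\to\infty$. -/

import Mathlib

open MeasureTheory ProbabilityTheory Filter Topology

noncomputable section

namespace LSW

/-- A finite real quadrature mirror (low-pass) filter `h`: the filter of a compactly supported
orthonormal-type wavelet.  Daubechies' compactly supported wavelets (Haar included) are the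
main examples. -/
structure QMFilter where
  /-- the low-pass filter coefficients -/
  h : ℤ → ℝ
  finite_support : (Function.support h).Finite
  sum_eq : ∑ᶠ n, h n = Real.sqrt 2
  orthonormal : ∀ m : ℤ, ∑ᶠ n, h n * h (n + 2 * m) = if m = 0 then 1 else 0

namespace QMFilter

variable (F : QMFilter)

/-- The associated high-pass filter `g n = (-1)^n h (1 - n)`. -/
def g (n : ℤ) : ℝ := (-1 : ℝ) ^ n * F.h (1 - n)

/-- The discrete wavelet vector at scale `j = 1, 2, …` (scale `1` is the finest; index `0` is not
a scale): `ψ_1 = g` and `ψ_{j+1}(n) = ∑_k h(n - 2k) ψ_j(k)`. -/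
def psi : ℕ → ℤ → ℝ
  | 0 => fun _ => 0
  | 1 => F.g
  | j + 2 => fun n => ∑ᶠ k : ℤ, F.h (n - 2 * k) * psi (j + 1) k

/-- The nondecimated discrete wavelets `ψ_{j,k}(t)`: at scale `j`, all integer translates of the
vector `ψ_j`, with the usual convention `ψ_{j,k}(t) = ψ_j(k - t)`. -/
def wav (j : ℕ) (k t : ℤ) : ℝ := F.psi j (k - t)

/-- Discrete Fourier transform `∑_s ψ_{j,0}(s) exp(i ω s)`. -/
def psiHat (j : ℕ) (ω : ℝ) : ℂ :=
  ∑ᶠ s : ℤ, (F.wav j 0 s : ℂ) * Complex.exp (Complex.I * ω * s)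

/-- The autocorrelation wavelet `Ψ_j(τ) = ∑_k ψ_{j,k}(0) ψ_{j,k}(τ)`. -/
def Psi (j : ℕ) (τ : ℤ) : ℝ := ∑ᶠ k : ℤ, F.wav j k 0 * F.wav j k τ

/-- The `n × n` matrix `A`, the Gram matrix of the autocorrelation wavelets at the scales
`1, …, n`. -/
def A (n : ℕ) : Matrix (Fin n) (Fin n) ℝ :=
  Matrix.of fun j l => ∑ᶠ τ : ℤ, F.Psi (j + 1) τ * F.Psi (l + 1) τ

/-- The spectral (`ℓ²` operator) norm of `A⁻¹`. -/
def normInvA (n : ℕ) : ℝ := ‖Matrix.toEuclideanCLM (n := Fin n) (𝕜 := ℝ) (F.A n)⁻¹‖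

end QMFilter

/-- The evolutionary wavelet spectrum `S_j(z) = W_j(z)²`. -/
def spec (W : ℕ → ℝ → ℝ) (j : ℕ) (z : ℝ) : ℝ := W j z ^ 2

/-- The local autocovariance `c(z, τ) = ∑_{j ≥ 1} S_j(z) Ψ_j(τ)`. -/
def autocov (F : QMFilter) (W : ℕ → ℝ → ℝ) (z : ℝ) (τ : ℤ) : ℝ :=
  ∑' j : ℕ, spec W (j + 1) z * F.Psi (j + 1) τ

/-- `X` is a zero-mean locally stationary wavelet process, observed for the sample sizes
`T = 2^J`; `X J t` is `X_{t,T}`.  The data are the amplitudes `w J j k = w_{j,k;T}`, the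
innovations `ξ j k`, the limiting amplitudes `W_j` and the constants `L_j`, `C_j`
(scales `j ≥ 1`, locations `k ∈ ℤ`). -/
structure IsLSW {Ω : Type*} [MeasurableSpace Ω] (P : Measure Ω) (F : QMFilter)
    (X : ℕ → ℕ → Ω → ℝ) (w : ℕ → ℕ → ℤ → ℝ) (ξ : ℕ → ℤ → Ω → ℝ)
    (W : ℕ → ℝ → ℝ) (L C : ℕ → ℝ) : Prop where
  /-- `X_{t,T} = ∑_{j=1}^J ∑_k w_{j,k;T} ψ_{j,k}(t) ξ_{j,k}`; the sum over `k` is finite. -/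
  repr : ∀ J t : ℕ, t < 2 ^ J → ∀ᵐ ω ∂P,
    X J t ω = ∑ j ∈ Finset.Icc 1 J, ∑ᶠ k : ℤ, w J j k * F.wav j k t * ξ j k ω
  /-- The innovations are independent and identically distributed with mean `0`, variance `1`. -/
  memLp : ∀ j, 1 ≤ j → ∀ k, MemLp (ξ j k) 2 P
  mean : ∀ j, 1 ≤ j → ∀ k, ∫ ω, ξ j k ω ∂P = 0
  var : ∀ j, 1 ≤ j → ∀ k, ∫ ω, ξ j k ω ^ 2 ∂P = 1
  indep : iIndepFun (fun p : {j : ℕ // 1 ≤ j} × ℤ => ξ p.1 p.2) P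
  ident : ∀ j, 1 ≤ j → ∀ k, IdentDistrib (ξ j k) (ξ 1 0) P P
  /-- `∑_j W_j(z)² < ∞`, uniformly in `z ∈ (0,1)`. -/
  sq_summable : ∃ M : ℝ, ∀ z ∈ Set.Ioo (0 : ℝ) 1,
    Summable (fun j : ℕ => W (j + 1) z ^ 2) ∧ ∑' j : ℕ, W (j + 1) z ^ 2 ≤ M
  /-- `W_j` is Lipschitz with constant `L_j` (a Lipschitz function on `(0,1)` always extends to the
  line with the same constant, so that `W_j(k/T)` makes sense for every `k`). -/
  lipschitz : ∀ j, 1 ≤ j → ∀ x y : ℝ, |W j x - W j y| ≤ L j * |x - y|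
  lipschitz_bdd : ∃ M : ℝ, ∀ j, 1 ≤ j → L j ≤ M
  lipschitz_summable : Summable fun j : ℕ => (2 : ℝ) ^ j * L j
  /-- `|w_{j,k;T} - W_j(k/T)| ≤ C_j / T`; a location `k` outside `{0, …, T-1}` may alternatively
  be absent from the representation. -/
  close : ∀ J j : ℕ, 1 ≤ j → j ≤ J → ∀ k : ℤ,
    |w J j k - W j (k / 2 ^ J)| ≤ C j / 2 ^ J ∨
      (k ∉ Set.Ico (0 : ℤ) (2 ^ J) ∧ w J j k = 0)
  close_summable : Summable C

/-- Raw wavelet periodogram `I_{l,m} = (∑_{t=0}^{T-1} x_t ψ_{l,m}(t))²` of `x_0, …, x_{T-1}`. -/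
def periodogram (F : QMFilter) (T : ℕ) (x : ℕ → ℝ) (l : ℕ) (m : ℤ) : ℝ :=
  (∑ t ∈ Finset.range T, x t * F.wav l m t) ^ 2

/-- Running mean of the periodogram at scale `l` over the `2s + 1` locations around `[uT]`. -/
def smoothPeriodogram (F : QMFilter) (T s : ℕ) (x : ℕ → ℝ) (l : ℕ) (u : ℝ) : ℝ :=
  (2 * (s : ℝ) + 1)⁻¹ *
    ∑ m ∈ Finset.Icc (⌊u * T⌋ - (s : ℤ)) (⌊u * T⌋ + (s : ℤ)), periodogram F T x l m

/-- Spectrum estimator: the smoothed periodogram at the scales `1, …, n`, corrected by `A⁻¹`.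
The index `j : Fin n` stands for the scale `j + 1`. -/
def specHat (F : QMFilter) (T s n : ℕ) (x : ℕ → ℝ) (u : ℝ) (j : Fin n) : ℝ :=
  ∑ l : Fin n, (F.A n)⁻¹ j l * smoothPeriodogram F T s x (l + 1) u

/-- Wavelet-based local autocovariance estimator `ĉ(u, τ) = ∑_{j=1}^n Ŝ_j(u) Ψ_j(τ)`. -/
def autocovHat (F : QMFilter) (T s n : ℕ) (x : ℕ → ℝ) (u : ℝ) (τ : ℤ) : ℝ :=
  ∑ j : Fin n, specHat F T s n x u j * F.Psi (j + 1) τ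

/-- Coefficients `β_1, …, β_p` of the linear predictor, from the variables at times
`n + 1, …, n + p`, of the variable at time `a`, i.e. the solution of the prediction equations when
covariances are given by `B`. -/
def predCoef (B : ℤ → ℤ → ℝ) (n : ℤ) (p : ℕ) (a : ℤ) : Fin p → ℝ :=
  Matrix.mulVec (Matrix.of fun i j : Fin p => B (n + 1 + i) (n + 1 + j))⁻¹
    (fun i => B (n + 1 + i) a)

/-- The back-casting vector `b^{(b)} = (-1, β_1, …, β_p)`. -/
def bBack (B : ℤ → ℤ → ℝ) (n : ℤ) (p : ℕ) : Fin (p + 1) → ℝ :=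
  Fin.cons (-1) (predCoef B n p n)

/-- The forecasting vector `b^{(f)} = (β_1, …, β_p, -1)`. -/
def bFor (B : ℤ → ℤ → ℝ) (n : ℤ) (p : ℕ) : Fin (p + 1) → ℝ :=
  Fin.snoc (predCoef B n p (n + p + 1)) (-1)

/-- The matrix `(B(a + i, a + j))_{0 ≤ i, j < τ}`. -/
def covMat (B : ℤ → ℤ → ℝ) (a : ℤ) (τ : ℕ) : Matrix (Fin τ) (Fin τ) ℝ :=
  Matrix.of fun i j => B (a + i) (a + j)

/-- Solution `φ` of the Yule–Walker equations `B φ = r`, for predicting the variable at time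
`n + τ` from those at times `n + τ - 1, …, n` (in this order); `B` gives the matrix and `R` the
right-hand side. -/
def yuleWalker (B R : ℤ → ℤ → ℝ) (n : ℤ) (τ : ℕ) : Fin τ → ℝ :=
  Matrix.mulVec (Matrix.of fun i j : Fin τ => B (n + τ - 1 - i) (n + τ - 1 - j))⁻¹
    (fun i => R (n + τ) (n + τ - 1 - i))

/-- The local partial autocorrelation at base time `n` and lag `τ ≥ 1`,
`φ_{n,τ,τ} { (b^{(b)})ᵀ B^{(b)} b^{(b)} / (b^{(f)})ᵀ B^{(f)} b^{(f)} }^{1/2}`,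
when covariances are given by `B` (matrices) and `R` (Yule–Walker right-hand side).
The value at lag `0` is a convention. -/
def lpacf (B R : ℤ → ℤ → ℝ) (n : ℤ) : ℕ → ℝ
  | 0 => 0
  | p + 1 =>
    yuleWalker B R n (p + 1) (Fin.last p) *
      Real.sqrt
        ((bBack B n p ⬝ᵥ Matrix.mulVec (covMat B n (p + 1)) (bBack B n p)) /
          (bFor B n p ⬝ᵥ Matrix.mulVec (covMat B (n + 1) (p + 1)) (bFor B n p)))

/-- A rule `ζ` choosing the rescaled time `ζ J a b` at which the covariance of `X_{a,T}` and
`X_{b,T}`, `T = 2^J`, is localised: for `a, b ∈ {[zT], …, [zT]+τ}` it lies within `O(1/T)` of `z`.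
Both `ζ J a b = (a + b) / (2T)` and `ζ J a b = z` are such rules. -/
def IsLocalisation (z : ℝ) (τ : ℕ) (ζ : ℕ → ℤ → ℤ → ℝ) : Prop :=
  ∃ K : ℝ, ∀ J : ℕ, ∀ a ∈ Set.Icc ⌊z * 2 ^ J⌋ (⌊z * 2 ^ J⌋ + τ),
    ∀ b ∈ Set.Icc ⌊z * 2 ^ J⌋ (⌊z * 2 ^ J⌋ + τ), |ζ J a b - z| ≤ K / 2 ^ J

/-- The local partial autocorrelation `q(z, τ)` built from the local autocovariance `c`, localised
by `ζ` in the matrices and by `ρ` in the Yule–Walker right-hand side. -/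
def q (F : QMFilter) (W : ℕ → ℝ → ℝ) (ζ ρ : ℕ → ℤ → ℤ → ℝ) (J : ℕ) (z : ℝ) (τ : ℕ) : ℝ :=
  lpacf (fun a b => autocov F W (ζ J a b) (a - b)) (fun a b => autocov F W (ρ J a b) (a - b))
    ⌊z * 2 ^ J⌋ τ

/-- The wavelet-based plug-in estimator `q̃(z, τ)`: every `c` in `q` is replaced by `ĉ`,
computed from `x_0, …, x_{T-1}`, `T = 2^J`, with smoothing half-width `s` and scales `1, …, n`. -/
def qTilde (F : QMFilter) (s n : ℕ) (x : ℕ → ℝ) (ζ ρ : ℕ → ℤ → ℤ → ℝ) (J : ℕ) (z : ℝ)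
    (τ : ℕ) : ℝ :=
  lpacf (fun a b => autocovHat F (2 ^ J) s n x (ζ J a b) (a - b))
    (fun a b => autocovHat F (2 ^ J) s n x (ρ J a b) (a - b)) ⌊z * 2 ^ J⌋ τ

end LSW

end

/-! ### Supports and normalisation of the discrete wavelets and their autocorrelations -/

namespace LSW

/-! The estimator at lag τ is linear in the smoothed periodograms, with weights x = A⁻¹(Ψ_1(τ), …,
Ψ_n(τ)). A squared wavelet transform summed over all locations is the quadratic form of Ψ_l. So,
apart from wavelets that meet the boundary of the smoothing window V, ĉ(u, τ) is the Toeplitz form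
N⁻¹ ∑_{t,t'∈V} π(t - t') X_t X_{t'}, where N = 2s + 1 and π = ∑ x_l Ψ_l. The decisive fact is that π
is the ℓ² projection of the unit mass at τ onto the span of Ψ_1, …, Ψ_n. It therefore has norm at
most 1 however large A⁻¹ is (`sum_comb_weights_sq_le`), and it reproduces Ψ_j(τ) for j ≤ n
(`sum_Psi_mul_comb_weights`). The size of A⁻¹ is felt only in the boundary terms, whose mean is
O(2^n ‖A⁻¹‖^{1/2} / N) (`integral_abs_autocovHat_sub_le`).

The rest of the analysis of ĉ hangs on a bound K for the covariance operators of the samples,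
uniform in T (`exists_covariance_bound`): the amplitudes are compared with those frozen at z, whose
covariance c(z, ·) is summable. Together with ‖π‖ ≤ 1 it bounds the squared Frobenius norm of the
form, written in the innovations, by K²N. Since the innovations have two moments only, the law of
large numbers is proved in L¹ (`quadraticForm`): the off-diagonal part is controlled in L² by the
Frobenius norm, the diagonal part by truncation. The expectation of the form is a trace. Per
observation, each fixed scale contributes S_j(z)Ψ_j(τ) in the limit, by reproduction, while the
scales beyond m are uniformly negligible by Cauchy–Schwarz and a tail bound on the energy
(`tendsto_expectation`). Hence ĉ(u_T, τ) → c(z, τ) in mean whenever u_T - z = O(1/T).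

The local partial autocorrelation is a function of finitely many covariances. If every W_j(z)
vanished, the Lipschitz conditions would make the spectral density O((x - z)²) near z, against the
positive essential infimum (`exists_amplitude_ne_zero`). So some scale is present at z, the Toeplitz
matrices of c(z, ·) are positive definite, and the function is continuous at these covariances
(`continuousAt_lpacf_extendArray`). Both q̃ and q then converge to its value there. -/

/-- `f` has its first nonzero value at `a` and its last one at `b`. -/
def HasExtremes (f : ℤ → ℝ) (a b : ℤ) : Prop :=
  f a ≠ 0 ∧ f b ≠ 0 ∧ ∀ n, f n ≠ 0 → a ≤ n ∧ n ≤ b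

theorem HasExtremes.le {f : ℤ → ℝ} {a b : ℤ} (h : HasExtremes f a b) : a ≤ b :=
  (h.2.2 a h.1).2

theorem exists_hasExtremes {f : ℤ → ℝ} (hf : (Function.support f).Finite) {m : ℤ}
    (hm : f m ≠ 0) : ∃ a b, HasExtremes f a b := by
  have hne : hf.toFinset.Nonempty := ⟨m, by simpa using hm⟩
  refine ⟨hf.toFinset.min' hne, hf.toFinset.max' hne, ?_, ?_, fun n hn => ?_⟩
  · simpa using hf.toFinset.min'_mem hne
  · simpa using hf.toFinset.max'_mem hne
  · have : n ∈ hf.toFinset := by simpa using hn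
    exact ⟨hf.toFinset.min'_le _ this, hf.toFinset.le_max' _ this⟩

theorem finsum_int_sub_right (f : ℤ → ℝ) (c : ℤ) : ∑ᶠ n, f (n - c) = ∑ᶠ n, f n :=
  finsum_comp_equiv (Equiv.subRight c)

theorem finsum_int_sub_left (f : ℤ → ℝ) (c : ℤ) : ∑ᶠ n, f (c - n) = ∑ᶠ n, f n :=
  finsum_comp_equiv (Equiv.subLeft c)

namespace QMFilter

variable (F : QMFilter)

theorem exists_h_hasExtremes : ∃ a b, a < b ∧ HasExtremes F.h a b := by
  have hne : ∃ m, F.h m ≠ 0 := by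
    by_contra! h
    have := F.sum_eq
    simp only [h, finsum_zero] at this
    have h2 : (0 : ℝ) < Real.sqrt 2 := by positivity
    linarith
  obtain ⟨m, hm⟩ := hne
  obtain ⟨a, b, hab⟩ := exists_hasExtremes F.finite_support hm
  refine ⟨a, b, lt_of_le_of_ne hab.le ?_, hab⟩
  -- A one-point support would give h_a = √2 by the sum rule and h_a² = 1 by orthonormality.
  rintro rfl
  have h0 : ∀ n, n ≠ a → F.h n = 0 := fun n hn => by
    by_contra h
    have := hab.2.2 n h
    omega
  have h1 : ∑ᶠ n, F.h n = F.h a := finsum_eq_single _ a h0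
  have h2 : ∑ᶠ n, F.h n * F.h (n + 2 * 0) = F.h a * F.h (a + 2 * 0) :=
    finsum_eq_single _ a fun n hn => by simp [h0 n hn]
  rw [F.orthonormal 0] at h2
  have h3 : F.h a = Real.sqrt 2 := h1.symm.trans F.sum_eq
  have h4 := Real.mul_self_sqrt (show (0 : ℝ) ≤ 2 by norm_num)
  simp [h3] at h2

theorem psi_add_two (j : ℕ) (n : ℤ) :
    F.psi (j + 2) n = ∑ᶠ k : ℤ, F.h (n - 2 * k) * F.psi (j + 1) k := rfl

theorem finsum_h_mul_h (k k' : ℤ) :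
    ∑ᶠ n, F.h (n - 2 * k) * F.h (n - 2 * k') = if k = k' then 1 else 0 := by
  have := finsum_int_sub_right (fun n => F.h n * F.h (n + 2 * (k - k'))) (2 * k)
  rw [F.orthonormal] at this
  convert this using 1
  · congr 1; ext n; congr 2; ring
  · simp [sub_eq_zero]

/-- The extreme coefficients of an upsampled convolution are single products, so they cannot cancel
and the endpoints obey lo ↦ a + 2 lo, hi ↦ b + 2 hi. The bound (H + 1)2^j - H is reproduced exactly
by x ↦ H + 2x. The exact length matters for linear independence, the bounds for the support radius.
-/
theorem exists_psi_hasExtremes : ∃ H : ℕ, ∃ d : ℤ, 1 ≤ d ∧ ∀ j : ℕ, ∃ lo hi : ℤ,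
    HasExtremes (F.psi (j + 1)) lo hi ∧ hi - lo = d * (2 ^ (j + 1) - 1) ∧
      |lo| ≤ (H + 1) * 2 ^ (j + 1) - H ∧ |hi| ≤ (H + 1) * 2 ^ (j + 1) - H := by
  obtain ⟨a, b, hab, hE⟩ := F.exists_h_hasExtremes
  refine ⟨(max |a| |b|).toNat, b - a, by omega, fun j => ?_⟩
  have hH : (((max |a| |b|).toNat : ℕ) : ℤ) = max |a| |b| :=
    Int.toNat_of_nonneg (le_max_of_le_left (abs_nonneg a))
  set H : ℤ := max |a| |b| with hHdef
  rw [hH]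
  have ha : |a| ≤ H := le_max_left _ _
  have hb : |b| ≤ H := le_max_right _ _
  induction j with
  | zero =>
    refine ⟨1 - b, 1 - a, ⟨?_, ?_, fun n hn => ?_⟩, by ring, ?_, ?_⟩
    · show (-1 : ℝ) ^ (1 - b) * F.h (1 - (1 - b)) ≠ 0
      rw [sub_sub_cancel]
      exact mul_ne_zero (zpow_ne_zero _ (by norm_num)) hE.2.1
    · show (-1 : ℝ) ^ (1 - a) * F.h (1 - (1 - a)) ≠ 0
      rw [sub_sub_cancel]
      exact mul_ne_zero (zpow_ne_zero _ (by norm_num)) hE.1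
    · have : F.h (1 - n) ≠ 0 := right_ne_zero_of_mul hn
      have := hE.2.2 _ this
      omega
    · rw [abs_le] at *; constructor <;> norm_num <;> omega
    · rw [abs_le] at *; constructor <;> norm_num <;> omega
  | succ j ih =>
    obtain ⟨lo, hi, hψ, hd, hlo, hhi⟩ := ih
    refine ⟨a + 2 * lo, b + 2 * hi, ⟨?_, ?_, fun n hn => ?_⟩, ?_, ?_, ?_⟩
    · rw [psi_add_two, finsum_eq_single _ lo fun k hk => ?_]
      · rw [add_sub_cancel_right]; exact mul_ne_zero hE.1 hψ.1
      · by_contra h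
        have h1 := hE.2.2 _ (left_ne_zero_of_mul h)
        have h2 := hψ.2.2 _ (right_ne_zero_of_mul h)
        omega
    · rw [psi_add_two, finsum_eq_single _ hi fun k hk => ?_]
      · rw [add_sub_cancel_right]; exact mul_ne_zero hE.2.1 hψ.2.1
      · by_contra h
        have h1 := hE.2.2 _ (left_ne_zero_of_mul h)
        have h2 := hψ.2.2 _ (right_ne_zero_of_mul h)
        omega
    · have : ∃ k, F.h (n - 2 * k) * F.psi (j + 1) k ≠ 0 := by
        by_contra! h
        exact hn (by rw [psi_add_two]; simp [h])
      obtain ⟨k, hk⟩ := this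
      have h1 := hE.2.2 _ (left_ne_zero_of_mul hk)
      have h2 := hψ.2.2 _ (right_ne_zero_of_mul hk)
      omega
    · rw [pow_succ (2 : ℤ) (j + 1)]; linear_combination 2 * hd
    · rw [pow_succ (2 : ℤ) (j + 1)]
      calc |a + 2 * lo| ≤ |a| + |2 * lo| := abs_add_le _ _
        _ = |a| + 2 * |lo| := by rw [abs_mul]; norm_num
        _ ≤ _ := by linarith
    · rw [pow_succ (2 : ℤ) (j + 1)]
      calc |b + 2 * hi| ≤ |b| + |2 * hi| := abs_add_le _ _
        _ = |b| + 2 * |hi| := by rw [abs_mul]; norm_num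
        _ ≤ _ := by linarith

theorem exists_psi_support : ∃ D : ℕ, 1 ≤ D ∧ ∀ j n, F.psi j n ≠ 0 → |n| ≤ D * 2 ^ j := by
  obtain ⟨H, d, -, h⟩ := F.exists_psi_hasExtremes
  refine ⟨H + 1, by omega, fun j n hn => ?_⟩
  cases j with
  | zero => exact absurd rfl hn
  | succ j =>
    obtain ⟨lo, hi, hψ, -, hlo, hhi⟩ := h j
    have := hψ.2.2 n hn
    push_cast
    rw [abs_le] at *
    constructor <;> nlinarith

/-- A radius constant of the wavelets: `ψ_j` lives on `[-D 2^j, D 2^j]`. -/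
noncomputable def radius : ℕ := F.exists_psi_support.choose

theorem one_le_radius : 1 ≤ F.radius := F.exists_psi_support.choose_spec.1

theorem abs_le_of_psi_ne_zero {j : ℕ} {n : ℤ} (h : F.psi j n ≠ 0) : |n| ≤ F.radius * 2 ^ j :=
  F.exists_psi_support.choose_spec.2 j n h

theorem psi_support_finite (j : ℕ) : (Function.support (F.psi j)).Finite :=
  (Set.finite_Icc (-(F.radius * 2 ^ j : ℤ)) (F.radius * 2 ^ j)).subset fun _ hn =>
    abs_le.1 (F.abs_le_of_psi_ne_zero hn)

/-- Even translates of the filter are orthonormal, so passing to the next scale is an isometry of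
ℓ². -/
theorem finsum_psi_sq (j : ℕ) : ∑ᶠ n, F.psi (j + 1) n ^ 2 = 1 := by
  induction j with
  | zero =>
    have h : ∀ n, F.psi (0 + 1) n ^ 2 = (fun m => F.h m * F.h (m + 2 * 0)) (1 - n) := fun n => by
      show ((-1 : ℝ) ^ n * F.h (1 - n)) ^ 2 = _
      rw [mul_pow, ← zpow_natCast, ← zpow_mul, mul_comm n, zpow_mul]
      simp; ring
    simp only [h]
    rw [finsum_int_sub_left (fun m => F.h m * F.h (m + 2 * 0)) 1, F.orthonormal]
    simp
  | succ j ih =>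
    set S := (F.psi_support_finite (j + 1)).toFinset with hS
    have hmem : ∀ k, F.psi (j + 1) k ≠ 0 → k ∈ S := fun k hk => by simpa [hS] using hk
    set B := (F.psi_support_finite (j + 2)).toFinset ∪
      S.biUnion (fun k => (F.finite_support.image (· + 2 * k)).toFinset) with hB
    have hpsi : ∀ n, F.psi (j + 2) n = ∑ k ∈ S, F.h (n - 2 * k) * F.psi (j + 1) k := fun n =>
      finsum_eq_sum_of_support_subset _ fun k hk => hmem k (right_ne_zero_of_mul hk)
    have hhB : ∀ k ∈ S, ∀ n, F.h (n - 2 * k) ≠ 0 → n ∈ B := fun k hk n hn => by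
      rw [hB, Finset.mem_union, Finset.mem_biUnion]
      exact Or.inr ⟨k, hk, by simpa [← sub_eq_add_neg] using hn⟩
    have h1 : ∑ᶠ n, F.psi (j + 2) n ^ 2 = ∑ n ∈ B, F.psi (j + 2) n ^ 2 :=
      finsum_eq_sum_of_support_subset _ fun n hn => by
        rw [hB]
        simp only [Finset.coe_union, Set.mem_union]
        left
        have : F.psi (j + 2) n ≠ 0 := fun h => hn (by simp [h])
        simpa using this
    have h2 : ∑ᶠ n, F.psi (j + 1) n ^ 2 = ∑ n ∈ S, F.psi (j + 1) n ^ 2 :=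
      finsum_eq_sum_of_support_subset _ fun n hn => hmem n fun h => hn (by simp [h])
    rw [show j + 1 + 1 = j + 2 from rfl, h1, ← ih, h2]
    calc ∑ n ∈ B, F.psi (j + 2) n ^ 2
        = ∑ n ∈ B, ∑ k ∈ S, ∑ k' ∈ S, F.psi (j + 1) k * F.psi (j + 1) k' *
            (F.h (n - 2 * k) * F.h (n - 2 * k')) := by
          refine Finset.sum_congr rfl fun n _ => ?_
          rw [hpsi, sq, Finset.sum_mul_sum]
          exact Finset.sum_congr rfl fun k _ => Finset.sum_congr rfl fun k' _ => by ring
      _ = ∑ k ∈ S, ∑ k' ∈ S, F.psi (j + 1) k * F.psi (j + 1) k' *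
            (if k = k' then 1 else 0) := by
          rw [Finset.sum_comm]
          refine Finset.sum_congr rfl fun k hk => ?_
          rw [Finset.sum_comm]
          refine Finset.sum_congr rfl fun k' _ => ?_
          rw [← Finset.mul_sum, ← F.finsum_h_mul_h,
            finsum_eq_sum_of_support_subset _ fun n hn => hhB k hk n (left_ne_zero_of_mul hn)]
      _ = _ := by
          refine Finset.sum_congr rfl fun k hk => ?_
          simp [hk, sq]

theorem sum_psi_sq_le (j : ℕ) (S : Finset ℤ) : ∑ n ∈ S, F.psi j n ^ 2 ≤ 1 := by
  cases j with
  | zero => simp [psi]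
  | succ j =>
    have h : ∑ᶠ n, F.psi (j + 1) n ^ 2
        = ∑ n ∈ S ∪ (F.psi_support_finite (j + 1)).toFinset, F.psi (j + 1) n ^ 2 :=
      finsum_eq_sum_of_support_subset _ fun n hn => by
        have : F.psi (j + 1) n ≠ 0 := fun h => hn (by simp [h])
        simp [this]
    rw [← F.finsum_psi_sq j, h]
    exact Finset.sum_le_sum_of_subset_of_nonneg Finset.subset_union_left
      fun _ _ _ => sq_nonneg _

theorem abs_psi_le_one (j : ℕ) (n : ℤ) : |F.psi j n| ≤ 1 := by
  have := F.sum_psi_sq_le j {n}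
  rw [Finset.sum_singleton] at this
  exact abs_le_one_iff_mul_self_le_one.2 (by nlinarith)

theorem sum_psi_shift_sq_le (j : ℕ) (c : ℤ) (S : Finset ℤ) :
    ∑ k ∈ S, F.psi j (k - c) ^ 2 ≤ 1 := by
  have := F.sum_psi_sq_le j (S.map (Equiv.subRight c).toEmbedding)
  simpa using this

theorem sum_psi_reflect_sq_le (j : ℕ) (c : ℤ) (S : Finset ℤ) :
    ∑ t ∈ S, F.psi j (c - t) ^ 2 ≤ 1 := by
  have := F.sum_psi_sq_le j (S.map (Equiv.subLeft c).toEmbedding)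
  simpa using this

theorem Psi_sub_eq_sum {j : ℕ} {t t' : ℤ} {S : Finset ℤ}
    (hS : ∀ k, F.psi j (k - t) ≠ 0 → k ∈ S) :
    F.Psi j (t - t') = ∑ k ∈ S, F.psi j (k - t) * F.psi j (k - t') := by
  have h1 : F.Psi j (t - t') =
      ∑ᶠ k : ℤ, (fun k => F.psi j (k - t) * F.psi j (k - t')) (k - (-t')) := by
    rw [Psi]
    congr 1; ext k
    simp only [wav]
    rw [mul_comm]
    congr 2 <;> ring
  rw [h1, finsum_int_sub_right (fun k => F.psi j (k - t) * F.psi j (k - t'))]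
  exact finsum_eq_sum_of_support_subset _ fun k hk => hS k (left_ne_zero_of_mul hk)

theorem Psi_sub_eq_sum' {j : ℕ} {t t' : ℤ} {S : Finset ℤ}
    (hS : ∀ k, F.psi j (k - t') ≠ 0 → k ∈ S) :
    F.Psi j (t - t') = ∑ k ∈ S, F.psi j (k - t) * F.psi j (k - t') := by
  rw [F.Psi_sub_eq_sum (S := S ∪ (((F.psi_support_finite j).image (· + t)).toFinset))]
  · refine (Finset.sum_subset Finset.subset_union_left fun k _ hk => ?_).symm
    have : F.psi j (k - t') = 0 := by
      by_contra h; exact hk (hS k h)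
    simp [this]
  · intro k hk
    simp [← sub_eq_add_neg, hk]

theorem Psi_neg (j : ℕ) (τ : ℤ) : F.Psi j (-τ) = F.Psi j τ := by
  set S := (((F.psi_support_finite j).image (· + τ)).toFinset)
  have hS : ∀ k, F.psi j (k - τ) ≠ 0 → k ∈ S := fun k hk => by simp [S, ← sub_eq_add_neg, hk]
  have h1 := F.Psi_sub_eq_sum (t' := 0) hS
  have h2 := F.Psi_sub_eq_sum' (t := 0) hS
  rw [sub_zero] at h1
  rw [zero_sub] at h2
  rw [h1, h2]
  exact Finset.sum_congr rfl fun _ _ => mul_comm _ _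

theorem abs_Psi_le_one (j : ℕ) (τ : ℤ) : |F.Psi j τ| ≤ 1 := by
  set S := (((F.psi_support_finite j).image (· + τ)).toFinset)
  have hS : ∀ k, F.psi j (k - τ) ≠ 0 → k ∈ S := fun k hk => by simp [S, ← sub_eq_add_neg, hk]
  have h1 := F.Psi_sub_eq_sum (t' := 0) hS
  rw [sub_zero] at h1
  rw [h1]
  have h2 := F.sum_psi_shift_sq_le j τ S
  have h3 := F.sum_psi_shift_sq_le j 0 S
  have h4 := Finset.sum_mul_sq_le_sq_mul_sq S (fun k => F.psi j (k - τ)) fun k => F.psi j (k - 0)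
  have h5 : (0 : ℝ) ≤ ∑ k ∈ S, F.psi j (k - τ) ^ 2 := Finset.sum_nonneg fun _ _ => sq_nonneg _
  rw [← sq_le_one_iff_abs_le_one]
  nlinarith

theorem abs_le_of_Psi_ne_zero {j : ℕ} {τ : ℤ} (h : F.Psi j τ ≠ 0) :
    |τ| ≤ 2 * (F.radius * 2 ^ j) := by
  have : ∃ k, F.psi j (k - 0) * F.psi j (k - τ) ≠ 0 := by
    by_contra! h'
    exact h (by simp only [Psi, wav, h', finsum_zero])
  obtain ⟨k, hk⟩ := this
  have h1 := F.abs_le_of_psi_ne_zero (left_ne_zero_of_mul hk)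
  have h2 := F.abs_le_of_psi_ne_zero (right_ne_zero_of_mul hk)
  rw [abs_le] at *
  constructor <;> linarith

/-- The quadratic form of an autocorrelation wavelet is a sum of squares. -/
theorem sum_sq_eq_sum_Psi {j : ℕ} {V S : Finset ℤ} (y : ℤ → ℝ)
    (hS : ∀ t ∈ V, ∀ k, F.psi j (k - t) ≠ 0 → k ∈ S) :
    ∑ k ∈ S, (∑ t ∈ V, F.psi j (k - t) * y t) ^ 2 =
      ∑ t ∈ V, ∑ t' ∈ V, F.Psi j (t - t') * (y t * y t') := by
  calc ∑ k ∈ S, (∑ t ∈ V, F.psi j (k - t) * y t) ^ 2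
      = ∑ k ∈ S, ∑ t ∈ V, ∑ t' ∈ V, F.psi j (k - t) * F.psi j (k - t') * (y t * y t') := by
        refine Finset.sum_congr rfl fun n _ => ?_
        rw [sq, Finset.sum_mul_sum]
        exact Finset.sum_congr rfl fun k _ => Finset.sum_congr rfl fun k' _ => by ring
    _ = _ := by
        rw [Finset.sum_comm]
        refine Finset.sum_congr rfl fun t ht => ?_
        rw [Finset.sum_comm]
        refine Finset.sum_congr rfl fun t' _ => ?_
        rw [F.Psi_sub_eq_sum (hS t ht), Finset.sum_mul]

/-- The quadratic form of a difference kernel is bounded by its row sums. -/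
theorem _root_.LSW.sum_abs_mul_le_of_row_sum_le {κ : ℤ → ℝ} (hκ : ∀ a, κ (-a) = κ a)
    {V : Finset ℤ} {B : ℝ} (hB : ∀ t ∈ V, ∑ t' ∈ V, |κ (t - t')| ≤ B) (y : ℤ → ℝ) :
    ∑ t ∈ V, ∑ t' ∈ V, |κ (t - t') * (y t * y t')| ≤ B * ∑ t ∈ V, y t ^ 2 := by
  have h1 : ∀ t t', |κ (t - t') * (y t * y t')| ≤
      |κ (t - t')| * y t ^ 2 / 2 + |κ (t' - t)| * y t' ^ 2 / 2 := fun t t' => by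
    rw [abs_mul, ← hκ (t' - t), neg_sub, abs_mul, ← sq_abs (y t), ← sq_abs (y t')]
    nlinarith [mul_nonneg (abs_nonneg (κ (t - t'))) (sq_nonneg (|y t| - |y t'|))]
  have h2 : ∑ t ∈ V, ∑ t' ∈ V, |κ (t - t')| * y t ^ 2 / 2 ≤ (B * ∑ t ∈ V, y t ^ 2) / 2 := by
    rw [Finset.mul_sum, Finset.sum_div]
    refine Finset.sum_le_sum fun t ht => ?_
    rw [← Finset.sum_div, ← Finset.sum_mul]
    have := mul_le_mul_of_nonneg_right (hB t ht) (sq_nonneg (y t))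
    linarith
  calc _ ≤ ∑ t ∈ V, ∑ t' ∈ V,
        (|κ (t - t')| * y t ^ 2 / 2 + |κ (t' - t)| * y t' ^ 2 / 2) :=
        Finset.sum_le_sum fun t _ => Finset.sum_le_sum fun t' _ => h1 t t'
    _ = ∑ t ∈ V, ∑ t' ∈ V, |κ (t - t')| * y t ^ 2 / 2 +
        ∑ t ∈ V, ∑ t' ∈ V, |κ (t' - t)| * y t' ^ 2 / 2 := by
        simp only [Finset.sum_add_distrib]
    _ ≤ _ := by
        rw [Finset.sum_comm (f := fun t t' => |κ (t' - t)| * y t' ^ 2 / 2)]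
        linarith

theorem card_filter_abs_sub_le (V : Finset ℤ) (c : ℤ) (r : ℕ) :
    ((V.filter fun t => |t - c| ≤ r).card : ℝ) ≤ 2 * r + 1 := by
  have h : (V.filter fun t => |t - c| ≤ r) ⊆ Finset.Icc (c - r) (c + r) := fun t ht => by
    have := (Finset.mem_filter.1 ht).2
    rw [abs_le] at this
    rw [Finset.mem_Icc]; omega
  have h1 := Finset.card_le_card h
  rw [Int.card_Icc] at h1
  have : ((V.filter fun t => |t - c| ≤ r).card) ≤ 2 * r + 1 := by omega
  exact_mod_cast this

theorem sum_le_of_abs_le_one {f : ℤ → ℝ} (hf : ∀ t, |f t| ≤ 1) {c : ℤ} {r : ℕ}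
    (hr : ∀ t, f t ≠ 0 → |t - c| ≤ r) (V : Finset ℤ) : ∑ t ∈ V, |f t| ≤ 2 * r + 1 := by
  calc ∑ t ∈ V, |f t| = ∑ t ∈ V.filter (fun t => |t - c| ≤ r), |f t| := by
        refine (Finset.sum_subset (Finset.filter_subset _ _) fun t ht h => ?_).symm
        by_contra h'
        exact h (Finset.mem_filter.2 ⟨ht, hr t fun h0 => h' (by simp [h0])⟩)
    _ ≤ ∑ t ∈ V.filter (fun t => |t - c| ≤ r), (1 : ℝ) := Finset.sum_le_sum fun t _ => hf t
    _ = ((V.filter fun t => |t - c| ≤ r).card : ℝ) := by simp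
    _ ≤ _ := card_filter_abs_sub_le V c r

theorem sum_abs_psi_reflect_le (j : ℕ) (k : ℤ) (V : Finset ℤ) :
    ∑ t ∈ V, |F.psi j (k - t)| ≤ 2 * (F.radius * 2 ^ j) + 1 := by
  have := sum_le_of_abs_le_one (f := fun t => F.psi j (k - t)) (fun t => F.abs_psi_le_one j _)
    (c := k) (r := F.radius * 2 ^ j) (fun t ht => by
      rw [abs_sub_comm]; exact_mod_cast F.abs_le_of_psi_ne_zero ht) V
  exact_mod_cast this

theorem sum_abs_psi_shift_le (j : ℕ) (t : ℤ) (S : Finset ℤ) :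
    ∑ k ∈ S, |F.psi j (k - t)| ≤ 2 * (F.radius * 2 ^ j) + 1 := by
  have := sum_le_of_abs_le_one (f := fun k => F.psi j (k - t)) (fun t => F.abs_psi_le_one j _)
    (c := t) (r := F.radius * 2 ^ j) (fun k hk => by
      exact_mod_cast F.abs_le_of_psi_ne_zero hk) S
  exact_mod_cast this

theorem sum_abs_Psi_le (j : ℕ) (t : ℤ) (V : Finset ℤ) :
    ∑ t' ∈ V, |F.Psi j (t - t')| ≤ 4 * (F.radius * 2 ^ j) + 1 := by
  have := sum_le_of_abs_le_one (f := fun t' => F.Psi j (t - t')) (fun t => F.abs_Psi_le_one j _)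
    (c := t) (r := 2 * (F.radius * 2 ^ j)) (fun t' ht => by
      rw [abs_sub_comm]; exact_mod_cast F.abs_le_of_Psi_ne_zero ht) V
  push_cast at this
  linarith

/-- At a lag equal to the length of the support only the product of the last and first coefficients
of ψ_j survives. These lags increase with the scale, which makes the family triangular. -/
theorem exists_Psi_top : ∃ δ : ℕ → ℤ, StrictMono δ ∧ ∀ j, F.Psi (j + 1) (δ j) ≠ 0 ∧
    ∀ τ, δ j < τ → F.Psi (j + 1) τ = 0 := by
  obtain ⟨H, d, hd, h⟩ := F.exists_psi_hasExtremes
  refine ⟨fun j => d * (2 ^ (j + 1) - 1), strictMono_nat_of_lt_succ fun j => ?_, fun j => ?_⟩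
  · have : (0 : ℤ) < 2 ^ (j + 1) := by positivity
    rw [pow_succ (2 : ℤ) (j + 1)]
    nlinarith
  · obtain ⟨lo, hi, hψ, hδ, -, -⟩ := h j
    simp only [← hδ]
    refine ⟨?_, fun τ hτ => ?_⟩
    · rw [Psi, finsum_eq_single _ hi fun k hk => ?_]
      · simp only [wav, sub_zero, sub_sub_cancel]
        exact mul_ne_zero hψ.2.1 hψ.1
      · by_contra h0
        have h1 := hψ.2.2 _ (left_ne_zero_of_mul h0)
        have h2 := hψ.2.2 _ (right_ne_zero_of_mul h0)
        omega
    · rw [Psi]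
      convert finsum_zero with k
      by_contra h0
      have h1 := hψ.2.2 _ (left_ne_zero_of_mul h0)
      have h2 := hψ.2.2 _ (right_ne_zero_of_mul h0)
      omega

/-- The autocorrelation wavelets are linearly independent. -/
theorem eq_zero_of_sum_Psi_eq_zero {n : ℕ} {x : Fin n → ℝ}
    (hx : ∀ τ, ∑ l : Fin n, x l * F.Psi (l + 1) τ = 0) : x = 0 := by
  obtain ⟨δ, hδ, h⟩ := F.exists_Psi_top
  by_contra hne
  obtain ⟨l₀, hl₀⟩ := Function.ne_iff.1 hne
  have hs : (Finset.univ.filter fun l => x l ≠ 0).Nonempty := ⟨l₀, by simpa using hl₀⟩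
  -- At the top lag of the coarsest scale present, all finer autocorrelation wavelets vanish.
  set m := (Finset.univ.filter fun l => x l ≠ 0).max' hs with hm
  have hxm : x m ≠ 0 := (Finset.mem_filter.1 (Finset.max'_mem _ hs)).2
  have hsum := hx (δ m)
  rw [Finset.sum_eq_single m] at hsum
  · exact mul_ne_zero hxm (h m).1 hsum
  · intro l _ hl
    by_cases hxl : x l = 0
    · simp [hxl]
    · have hle : l ≤ m := Finset.le_max' _ _ (by simpa using hxl)
      rw [(h l).2 _ (hδ (by exact_mod_cast lt_of_le_of_ne hle hl)), mul_zero]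
  · simp

/-- Filtering a nonzero finite sequence by a wavelet does not give zero. -/
theorem exists_sum_psi_ne_zero (j : ℕ) {p : ℕ} {y : Fin p → ℝ} (hy : y ≠ 0) :
    ∃ k : ℤ, ∑ i : Fin p, F.psi (j + 1) (k - i) * y i ≠ 0 := by
  obtain ⟨H, d, hd, h⟩ := F.exists_psi_hasExtremes
  obtain ⟨lo, hi, hψ, -, -, -⟩ := h j
  obtain ⟨l₀, hl₀⟩ := Function.ne_iff.1 hy
  have hs : (Finset.univ.filter fun l => y l ≠ 0).Nonempty := ⟨l₀, by simpa using hl₀⟩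
  set m := (Finset.univ.filter fun l => y l ≠ 0).max' hs with hm
  have hym : y m ≠ 0 := (Finset.mem_filter.1 (Finset.max'_mem _ hs)).2
  -- The last coefficient of the convolution is the product of the two last coefficients.
  refine ⟨hi + m, ?_⟩
  rw [Finset.sum_eq_single m]
  · rw [add_sub_cancel_right]; exact mul_ne_zero hψ.2.1 hym
  · intro l _ hl
    by_cases hyl : y l = 0
    · simp [hyl]
    · have hle : l ≤ m := Finset.le_max' _ _ (by simpa using hyl)
      have hlt : (l : ℕ) < m := by exact_mod_cast lt_of_le_of_ne hle hl
      have : F.psi (j + 1) (hi + m - l) = 0 := by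
        by_contra h0
        have := hψ.2.2 _ h0
        omega
      rw [this, zero_mul]
  · simp

end QMFilter
-- The Gram matrix and the weights of the estimator
namespace QMFilter

variable (F : QMFilter)

/-- A finite combination of the autocorrelation wavelets at the scales `1, …, n`. -/
noncomputable def comb {n : ℕ} (x : Fin n → ℝ) (a : ℤ) : ℝ := ∑ l : Fin n, x l * F.Psi (l + 1) a

theorem A_apply {n : ℕ} (j l : Fin n) {S : Finset ℤ}
    (hS : ∀ τ, F.Psi (j + 1) τ ≠ 0 → τ ∈ S) :
    F.A n j l = ∑ τ ∈ S, F.Psi (j + 1) τ * F.Psi (l + 1) τ :=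
  finsum_eq_sum_of_support_subset _ fun τ hτ => hS τ (left_ne_zero_of_mul hτ)

theorem A_mulVec {n : ℕ} (x : Fin n → ℝ) (j : Fin n) {S : Finset ℤ}
    (hS : ∀ τ, F.Psi (j + 1) τ ≠ 0 → τ ∈ S) :
    (F.A n).mulVec x j = ∑ τ ∈ S, F.Psi (j + 1) τ * F.comb x τ := by
  simp only [Matrix.mulVec, dotProduct, comb, Finset.mul_sum]
  rw [Finset.sum_comm]
  refine Finset.sum_congr rfl fun l _ => ?_
  rw [F.A_apply j l hS, Finset.sum_mul]
  exact Finset.sum_congr rfl fun τ _ => by ring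

theorem exists_Psi_support (n : ℕ) :
    ∃ S : Finset ℤ, ∀ j : Fin n, ∀ τ, F.Psi (j + 1) τ ≠ 0 → τ ∈ S := by
  refine ⟨Finset.univ.biUnion fun j : Fin n =>
    Finset.Icc (-(2 * (F.radius * 2 ^ (j + 1 : ℕ)) : ℤ)) (2 * (F.radius * 2 ^ (j + 1 : ℕ))),
    fun j τ hτ => ?_⟩
  rw [Finset.mem_biUnion]
  exact ⟨j, Finset.mem_univ _, Finset.mem_Icc.2 (abs_le.1 (F.abs_le_of_Psi_ne_zero hτ))⟩

/-- Being a Gram matrix, A carries the ℓ² inner product of the combinations; this turns matrix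
questions into questions about functions of the lag. -/
theorem dotProduct_A_mulVec {n : ℕ} (x y : Fin n → ℝ) {S : Finset ℤ}
    (hS : ∀ j : Fin n, ∀ τ, F.Psi (j + 1) τ ≠ 0 → τ ∈ S) :
    x ⬝ᵥ (F.A n).mulVec y = ∑ τ ∈ S, F.comb x τ * F.comb y τ := by
  simp only [dotProduct]
  simp only [F.A_mulVec y _ (hS _), Finset.mul_sum]
  rw [Finset.sum_comm]
  refine Finset.sum_congr rfl fun τ _ => ?_
  rw [show F.comb x τ = ∑ l : Fin n, x l * F.Psi (l + 1) τ from rfl, Finset.sum_mul]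
  exact Finset.sum_congr rfl fun l _ => by ring

theorem comb_eq_zero {n : ℕ} (x : Fin n → ℝ) {S : Finset ℤ}
    (hS : ∀ j : Fin n, ∀ τ, F.Psi (j + 1) τ ≠ 0 → τ ∈ S) {τ : ℤ} (hτ : τ ∉ S) :
    F.comb x τ = 0 := by
  refine Finset.sum_eq_zero fun l _ => ?_
  have : F.Psi (l + 1) τ = 0 := by
    by_contra h; exact hτ (hS l τ h)
  rw [this, mul_zero]

theorem isUnit_det_A (n : ℕ) : IsUnit (F.A n).det := by
  rw [isUnit_iff_ne_zero]
  intro h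
  obtain ⟨x, hx, hAx⟩ := Matrix.exists_mulVec_eq_zero_iff.2 h
  obtain ⟨S, hS⟩ := F.exists_Psi_support n
  have h1 := F.dotProduct_A_mulVec x x hS
  rw [hAx, dotProduct_zero] at h1
  refine hx (F.eq_zero_of_sum_Psi_eq_zero fun τ => ?_)
  by_cases hτ : τ ∈ S
  · exact mul_self_eq_zero.1
      ((Finset.sum_eq_zero_iff_of_nonneg fun _ _ => mul_self_nonneg _).1 h1.symm τ hτ)
  · exact F.comb_eq_zero x hS hτ

theorem A_transpose (n : ℕ) : (F.A n).transpose = F.A n := by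
  ext j l
  simp only [A, Matrix.transpose_apply, Matrix.of_apply, mul_comm]

theorem dotProduct_inv_A_mulVec_le {n : ℕ} (x : Fin n → ℝ) :
    x ⬝ᵥ ((F.A n)⁻¹).mulVec x ≤ F.normInvA n * (x ⬝ᵥ x) := by
  have h1 : x ⬝ᵥ ((F.A n)⁻¹).mulVec x =
      inner ℝ (WithLp.toLp 2 x)
        (Matrix.toEuclideanCLM (n := Fin n) (𝕜 := ℝ) (F.A n)⁻¹ (WithLp.toLp 2 x)) := by
    simp [EuclideanSpace.inner_eq_star_dotProduct, dotProduct_comm]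
  have h2 : x ⬝ᵥ x = ‖(WithLp.toLp 2 x : EuclideanSpace ℝ (Fin n))‖ ^ 2 := by
    rw [EuclideanSpace.norm_sq_eq]
    simp [dotProduct, ← sq]
  rw [h1, h2, normInvA]
  refine (real_inner_le_norm _ _).trans ?_
  have := ContinuousLinearMap.le_opNorm
    (Matrix.toEuclideanCLM (n := Fin n) (𝕜 := ℝ) (F.A n)⁻¹) (WithLp.toLp 2 x)
  nlinarith [norm_nonneg (WithLp.toLp 2 x : EuclideanSpace ℝ (Fin n))]

theorem normInvA_nonneg (n : ℕ) : 0 ≤ F.normInvA n := norm_nonneg _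

/-- This bounds A below without diagonalising it. With x = Ay, Cauchy–Schwarz for the combinations
of x and y gives |x|⁴ ≤ (x·Ax)(x·A⁻¹x), and x·A⁻¹x ≤ ‖A⁻¹‖|x|². -/
theorem dotProduct_self_le {n : ℕ} (x : Fin n → ℝ) :
    x ⬝ᵥ x ≤ F.normInvA n * (x ⬝ᵥ (F.A n).mulVec x) := by
  obtain ⟨S, hS⟩ := F.exists_Psi_support n
  set y := ((F.A n)⁻¹).mulVec x with hy
  have hAy : (F.A n).mulVec y = x := by
    rw [hy, Matrix.mulVec_mulVec, Matrix.mul_nonsing_inv _ (F.isUnit_det_A n), Matrix.one_mulVec]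
  have h1 : x ⬝ᵥ x = ∑ τ ∈ S, F.comb x τ * F.comb y τ := by
    rw [← F.dotProduct_A_mulVec x y hS, hAy]
  have h2 : x ⬝ᵥ y = ∑ τ ∈ S, F.comb y τ ^ 2 := by
    simp only [sq]
    rw [← F.dotProduct_A_mulVec y y hS, hAy, dotProduct_comm]
  have h3 : x ⬝ᵥ (F.A n).mulVec x = ∑ τ ∈ S, F.comb x τ ^ 2 := by
    simp only [sq]
    rw [F.dotProduct_A_mulVec x x hS]
  have h4 := Finset.sum_mul_sq_le_sq_mul_sq S (F.comb x) (F.comb y)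
  rw [← h1, ← h2, ← h3] at h4
  have h5 := F.dotProduct_inv_A_mulVec_le x
  rw [← hy] at h5
  have h6 : 0 ≤ x ⬝ᵥ (F.A n).mulVec x := by
    rw [h3]; exact Finset.sum_nonneg fun _ _ => sq_nonneg _
  have h7 : 0 ≤ x ⬝ᵥ x := Finset.sum_nonneg fun _ _ => mul_self_nonneg _
  rcases h7.eq_or_lt with h | h
  · rw [← h]; exact mul_nonneg (F.normInvA_nonneg n) h6
  · refine le_of_mul_le_mul_right ?_ h
    nlinarith

/-- The corner entry of A does not depend on n, so testing the lower bound on the first basis vector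
suffices. It later allows ‖A⁻¹‖^{1/2} to be replaced by a multiple of ‖A⁻¹‖. -/
theorem exists_le_normInvA : ∃ c > 0, ∀ n, 1 ≤ n → c ≤ F.normInvA n := by
  have hA : ∀ n, (h : 1 ≤ n) → F.A n ⟨0, h⟩ ⟨0, h⟩ = F.A 1 0 0 := fun n h => rfl
  have key : ∀ n, 1 ≤ n → 1 ≤ F.normInvA n * F.A 1 0 0 := fun n h => by
    have := F.dotProduct_self_le (Pi.single (⟨0, h⟩ : Fin n) 1)
    simpa [hA n h] using this
  have h1 := key 1 le_rfl
  have hpos : 0 < F.A 1 0 0 := by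
    by_contra hneg
    nlinarith [F.normInvA_nonneg 1]
  exact ⟨(F.A 1 0 0)⁻¹, by positivity, fun n h => by
    rw [inv_le_iff_one_le_mul₀ hpos]; exact key n h⟩

/-- The weights `A⁻¹ (Ψ_1(τ), …, Ψ_n(τ))` of the smoothed periodograms in the local
autocovariance estimator at lag `τ`. -/
noncomputable def weights (n : ℕ) (τ : ℤ) : Fin n → ℝ :=
  ((F.A n)⁻¹).mulVec fun l : Fin n => F.Psi (l + 1) τ

theorem A_mulVec_weights (n : ℕ) (τ : ℤ) :
    (F.A n).mulVec (F.weights n τ) = fun l : Fin n => F.Psi (l + 1) τ := by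
  rw [weights, Matrix.mulVec_mulVec, Matrix.mul_nonsing_inv _ (F.isUnit_det_A n),
    Matrix.one_mulVec]

/-- Symmetry of A⁻¹ moves the correction from the periodograms to the vector of Ψ_l(τ). -/
theorem sum_inv_A_mul_eq (n : ℕ) (τ : ℤ) (I : Fin n → ℝ) :
    ∑ j : Fin n, (∑ l : Fin n, (F.A n)⁻¹ j l * I l) * F.Psi (j + 1) τ =
      ∑ l, F.weights n τ l * I l := by
  have hT : ∀ j l, (F.A n)⁻¹ j l = (F.A n)⁻¹ l j := fun j l => by
    conv_lhs => rw [← F.A_transpose n, ← Matrix.transpose_nonsing_inv, Matrix.transpose_apply]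
  simp only [weights, Matrix.mulVec, dotProduct, Finset.sum_mul]
  rw [Finset.sum_comm]
  exact Finset.sum_congr rfl fun l _ => Finset.sum_congr rfl fun j _ => by rw [hT]; ring

/-- The combination with the weights at lag `τ` reproduces the value at `τ`. -/
theorem sum_Psi_mul_comb_weights {n j : ℕ} (hj : j < n) (τ : ℤ) {S : Finset ℤ}
    (hS : ∀ a, F.Psi (j + 1) a ≠ 0 → a ∈ S) :
    ∑ a ∈ S, F.Psi (j + 1) a * F.comb (F.weights n τ) a = F.Psi (j + 1) τ := by
  rw [← F.A_mulVec (F.weights n τ) ⟨j, hj⟩ hS, A_mulVec_weights]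

/-- The squared norm of π is x·Ax = ∑ x_l Ψ_l(τ) = π(τ), and π(τ)² is one of its terms; so π(τ)² ≤
‖π‖² = π(τ) and both are at most 1. -/
theorem sum_comb_weights_sq_le (n : ℕ) (τ : ℤ) (S : Finset ℤ) :
    ∑ a ∈ S, F.comb (F.weights n τ) a ^ 2 ≤ 1 := by
  obtain ⟨S₀, hS₀⟩ := F.exists_Psi_support n
  set x := F.weights n τ with hx
  set S' := insert τ (S ∪ S₀)
  have hS' : ∀ j : Fin n, ∀ a, F.Psi (j + 1) a ≠ 0 → a ∈ S' := fun j a ha =>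
    Finset.mem_insert_of_mem (Finset.mem_union_right _ (hS₀ j a ha))
  have h1 : ∑ a ∈ S', F.comb x a ^ 2 = F.comb x τ := by
    simp only [sq]
    rw [← F.dotProduct_A_mulVec x x hS', hx, A_mulVec_weights]
    rfl
  have h2 : F.comb x τ ^ 2 ≤ ∑ a ∈ S', F.comb x a ^ 2 :=
    Finset.single_le_sum (f := fun a => F.comb x a ^ 2) (fun _ _ => sq_nonneg _)
      (Finset.mem_insert_self _ _)
  have h3 : ∑ a ∈ S, F.comb x a ^ 2 ≤ ∑ a ∈ S', F.comb x a ^ 2 :=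
    Finset.sum_le_sum_of_subset_of_nonneg
      (Finset.subset_union_left.trans (Finset.subset_insert _ _)) fun _ _ _ => sq_nonneg _
  have h4 : F.comb x τ ≤ 1 := by nlinarith
  linarith

theorem sum_weights_sq_le (n : ℕ) (τ : ℤ) : ∑ l, F.weights n τ l ^ 2 ≤ F.normInvA n := by
  obtain ⟨S, hS⟩ := F.exists_Psi_support n
  have h1 := F.dotProduct_self_le (F.weights n τ)
  rw [F.dotProduct_A_mulVec _ _ hS] at h1
  have h2 := F.sum_comb_weights_sq_le n τ S
  simp only [sq] at h2 ⊢
  have h3 := F.normInvA_nonneg n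
  simp only [dotProduct] at h1
  nlinarith

/-- Cauchy–Schwarz with |x|² ≤ ‖A⁻¹‖ and ∑ 4^l ≤ 4·4^n. The factor 2^l is the number of boundary
wavelets at scale l, up to a constant. -/
theorem sum_abs_weights_mul_two_pow_le (n : ℕ) (τ : ℤ) :
    ∑ l : Fin n, |F.weights n τ l| * 2 ^ (l + 1 : ℕ) ≤
      2 * 2 ^ n * Real.sqrt (F.normInvA n) := by
  have h1 := Finset.sum_mul_sq_le_sq_mul_sq Finset.univ (fun l => |F.weights n τ l|)
    fun l : Fin n => (2 : ℝ) ^ (l + 1 : ℕ)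
  have h2 : ∑ l : Fin n, ((2 : ℝ) ^ (l + 1 : ℕ)) ^ 2 ≤ (2 * 2 ^ n) ^ 2 := by
    rw [Fin.sum_univ_eq_sum_range (fun l => ((2 : ℝ) ^ (l + 1)) ^ 2)]
    clear h1
    induction n with
    | zero => simp
    | succ n ih =>
      rw [Finset.sum_range_succ]
      have : (0 : ℝ) ≤ (2 ^ n) ^ 2 := by positivity
      rw [pow_succ (2 : ℝ) n]
      nlinarith
  simp only [sq_abs] at h1
  refine le_of_sq_le_sq ?_ (by positivity)
  rw [mul_pow _ (Real.sqrt _), Real.sq_sqrt (F.normInvA_nonneg n)]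
  refine h1.trans ?_
  rw [mul_comm]
  exact mul_le_mul h2 (F.sum_weights_sq_le n τ) (Finset.sum_nonneg fun _ _ => sq_nonneg _)
    (by positivity)

theorem abs_comb_weights_le (n : ℕ) (τ a : ℤ) : |F.comb (F.weights n τ) a| ≤ 1 := by
  have := F.sum_comb_weights_sq_le n τ {a}
  rwa [Finset.sum_singleton, sq_le_one_iff_abs_le_one] at this

theorem autocovHat_eq (T s n : ℕ) (x : ℕ → ℝ) (u : ℝ) (τ : ℤ) :
    autocovHat F T s n x u τ =
      ∑ l : Fin n, F.weights n τ l * smoothPeriodogram F T s x (l + 1) u :=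
  F.sum_inv_A_mul_eq n τ fun l => smoothPeriodogram F T s x (l + 1) u

end QMFilter

/-! ### Quadratic forms in independent innovations with two moments -/

variable {Ω ι : Type*} [MeasurableSpace Ω] {P : Measure Ω}

/-- A family of independent, identically distributed, standardised square integrable variables. -/
structure IsStandardIID (P : Measure Ω) (ξ : ι → Ω → ℝ) (ξ₀ : Ω → ℝ) : Prop where
  memLp : ∀ p, MemLp (ξ p) 2 P
  mean : ∀ p, ∫ ω, ξ p ω ∂P = 0
  var : ∀ p, ∫ ω, ξ p ω ^ 2 ∂P = 1
  indep : iIndepFun ξ P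
  ident : ∀ p, IdentDistrib (ξ p) ξ₀ P P

theorem integral_abs_le_sqrt [IsProbabilityMeasure P] {f : Ω → ℝ} (hf : MemLp f 2 P) :
    ∫ ω, |f ω| ∂P ≤ Real.sqrt (∫ ω, f ω ^ 2 ∂P) := by
  have hi : Integrable f P := hf.integrable (by norm_num)
  set c := ∫ ω, |f ω| ∂P with hc
  have h1 : 0 ≤ ∫ ω, (|f ω| - c) ^ 2 ∂P := integral_nonneg fun _ => sq_nonneg _
  have h2 : ∫ ω, (|f ω| - c) ^ 2 ∂P = ∫ ω, f ω ^ 2 ∂P - 2 * c * ∫ ω, |f ω| ∂P + c ^ 2 := by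
    have : ∀ ω, (|f ω| - c) ^ 2 = f ω ^ 2 - 2 * c * |f ω| + c ^ 2 := fun ω => by
      rw [sub_sq, sq_abs]; ring
    simp only [this]
    have hd : Integrable (fun ω => f ω ^ 2 - 2 * c * |f ω|) P :=
      hf.integrable_sq.sub (hi.abs.const_mul _)
    rw [integral_add hd (integrable_const _), integral_sub hf.integrable_sq (hi.abs.const_mul _), integral_const_mul]
    simp
  refine Real.le_sqrt_of_sq_le ?_
  rw [h2, ← hc] at h1
  nlinarith

theorem integral_sum_mul_sq {η : ι → Ω → ℝ} {v : ℝ} (hmem : ∀ p, MemLp (η p) 2 P)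
    (hmean : ∀ p, ∫ ω, η p ω ∂P = 0) (hvar : ∀ p, ∫ ω, η p ω ^ 2 ∂P = v)
    (hind : iIndepFun η P) (S : Finset ι) (b : ι → ℝ) :
    ∫ ω, (∑ p ∈ S, b p * η p ω) ^ 2 ∂P = v * ∑ p ∈ S, b p ^ 2 := by
  classical
  have hint : ∀ p q, Integrable (fun ω => b p * η p ω * (b q * η q ω)) P := fun p q =>
    ((hmem p).const_mul (b p)).integrable_mul ((hmem q).const_mul (b q))
  have hpq : ∀ p q, ∫ ω, b p * η p ω * (b q * η q ω) ∂P = if p = q then b p ^ 2 * v else 0 := by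
    intro p q
    have h1 : ∀ ω, b p * η p ω * (b q * η q ω) = b p * b q * (η p ω * η q ω) := fun ω => by ring
    simp only [h1, integral_const_mul]
    split_ifs with h
    · subst h
      rw [← hvar p]
      simp only [sq]
    · rw [(hind.indepFun h).integral_fun_mul_eq_mul_integral (hmem p).1 (hmem q).1, hmean]
      simp
  simp only [sq (Finset.sum _ _), Finset.sum_mul_sum]
  rw [integral_finsetSum _ fun p _ => integrable_finsetSum _ fun q _ => hint p q, Finset.mul_sum]
  refine Finset.sum_congr rfl fun p hp => ?_
  rw [integral_finsetSum _ fun q _ => hint p q]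
  simp only [hpq]
  simp [hp, mul_comm]

/-- A function of the coordinates in `S` factors through extension by zero, which reduces the claim
to independence of disjoint finite blocks. -/
theorem iIndepFun.indepFun_of_dependsOn {ξ : ι → Ω → ℝ} (h : iIndepFun ξ P)
    (hm : ∀ p, AEMeasurable (ξ p) P) {S : Finset ι} [DecidablePred (· ∈ S)] {r : ι} (hr : r ∉ S)
    (g : (ι → ℝ) → ℝ)
    (hg : Measurable fun v : S → ℝ => g fun p => if h : p ∈ S then v ⟨p, h⟩ else 0)
    (hdep : ∀ v v', (∀ p ∈ S, v p = v' p) → g v = g v') :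
    IndepFun (ξ r) (fun ω => g fun p => ξ p ω) P := by
  have h1 := h.indepFun_finset₀ {r} S (Finset.disjoint_singleton_left.2 hr) hm
  have hφ : Measurable fun v : ({r} : Finset ι) → ℝ => v ⟨r, Finset.mem_singleton_self r⟩ := by
    fun_prop
  have h2 := h1.comp hφ hg
  have e : (fun ω => g fun p => ξ p ω) =
      (fun v : S → ℝ => g fun p => if h : p ∈ S then v ⟨p, h⟩ else 0) ∘ fun ω i => ξ i ω := by
    ext ω
    exact hdep _ _ fun p hp => by simp [hp]
  rw [e]
  exact h2

namespace IsStandardIID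

variable {ξ : ι → Ω → ℝ} {ξ₀ : Ω → ℝ}

theorem integral_sum_sq (h : IsStandardIID P ξ ξ₀) (S : Finset ι) (b : ι → ℝ) :
    ∫ ω, (∑ p ∈ S, b p * ξ p ω) ^ 2 ∂P = ∑ p ∈ S, b p ^ 2 := by
  rw [integral_sum_mul_sq h.memLp h.mean h.var h.indep, one_mul]

theorem memLp_sum (h : IsStandardIID P ξ ξ₀) (S : Finset ι) (b : ι → ℝ) :
    MemLp (fun ω => ∑ p ∈ S, b p * ξ p ω) 2 P :=
  memLp_finsetSum _ fun p _ => (h.memLp p).const_mul (b p)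

/-- Adding an index r adds ξ_r Y, with Y linear in the earlier innovations. Independence makes ξ_r Y
square integrable without fourth moments and kills the cross term; the increment is E Y² = ∑ (a_pr +
a_rp)², whence the factor 2. -/
theorem offDiag [DecidableEq ι] [IsProbabilityMeasure P] (h : IsStandardIID P ξ ξ₀) (a : ι → ι → ℝ) (S : Finset ι) :
    MemLp (fun ω => ∑ p ∈ S, ∑ q ∈ S, if p = q then 0 else a p q * (ξ p ω * ξ q ω)) 2 P ∧
    ∫ ω, (∑ p ∈ S, ∑ q ∈ S, if p = q then 0 else a p q * (ξ p ω * ξ q ω)) ^ 2 ∂P ≤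
      2 * ∑ p ∈ S, ∑ q ∈ S, a p q ^ 2 := by
  have hm : ∀ p, AEMeasurable (ξ p) P := fun p => (h.memLp p).1.aemeasurable
  induction S using Finset.induction_on with
  | empty => simp
  | insert r S hr ih =>
    obtain ⟨ih1, ih2⟩ := ih
    set Z : Ω → ℝ := fun ω =>
      ∑ p ∈ S, ∑ q ∈ S, if p = q then 0 else a p q * (ξ p ω * ξ q ω) with hZ
    set Y : Ω → ℝ := fun ω => ∑ p ∈ S, (a p r + a r p) * ξ p ω with hY
    have hYm : MemLp Y 2 P := h.memLp_sum S _
    have hsplit : ∀ ω, (∑ p ∈ insert r S, ∑ q ∈ insert r S,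
        if p = q then 0 else a p q * (ξ p ω * ξ q ω)) = Z ω + ξ r ω * Y ω := fun ω => by
      rw [Finset.sum_insert hr]
      simp only [Finset.sum_insert hr, if_true, zero_add, Finset.sum_add_distrib]
      have e1 : (∑ q ∈ S, if r = q then 0 else a r q * (ξ r ω * ξ q ω)) =
          ∑ q ∈ S, a r q * (ξ r ω * ξ q ω) := Finset.sum_congr rfl fun q hq => by
        rw [if_neg]; rintro rfl; exact hr hq
      have e2 : (∑ q ∈ S, if q = r then 0 else a q r * (ξ q ω * ξ r ω)) =
          ∑ q ∈ S, a q r * (ξ q ω * ξ r ω) := Finset.sum_congr rfl fun q hq => by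
        rw [if_neg]; rintro rfl; exact hr hq
      rw [e1, e2]
      simp only [hZ, hY, add_mul, Finset.sum_add_distrib, mul_add, Finset.mul_sum]
      have e3 : ∀ q, a r q * (ξ r ω * ξ q ω) = ξ r ω * (a r q * ξ q ω) := fun q => by ring
      have e4 : ∀ q, a q r * (ξ q ω * ξ r ω) = ξ r ω * (a q r * ξ q ω) := fun q => by ring
      simp only [e3, e4]
      ring
    have hext : ∀ p, Measurable fun v : S → ℝ => if h : p ∈ S then v ⟨p, h⟩ else 0 := fun p => by
      by_cases hp : p ∈ S
      · simp only [hp, dite_true]; exact measurable_pi_apply _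
      · simp only [hp, dite_false]; exact measurable_const
    have hindY : IndepFun (ξ r) Y P :=
      iIndepFun.indepFun_of_dependsOn h.indep hm hr (fun v => ∑ p ∈ S, (a p r + a r p) * v p)
        (Finset.measurable_fun_sum _ fun p _ => (hext p).const_mul _)
        fun v v' hv => Finset.sum_congr rfl fun p hp => by rw [hv p hp]
    have hindZY : IndepFun (ξ r) (fun ω => Z ω * Y ω) P := by
      refine iIndepFun.indepFun_of_dependsOn h.indep hm hr
        (fun v => (∑ p ∈ S, ∑ q ∈ S, if p = q then 0 else a p q * (v p * v q)) *
          ∑ p ∈ S, (a p r + a r p) * v p) ?_ fun v v' hv => ?_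
      · refine Measurable.mul (Finset.measurable_fun_sum _ fun p _ =>
          Finset.measurable_fun_sum _ fun q _ => ?_)
          (Finset.measurable_fun_sum _ fun p _ => (hext p).const_mul _)
        by_cases hpq : p = q
        · simp [hpq]
        · simp only [hpq, if_false]
          exact ((hext p).mul (hext q)).const_mul _
      · congr 1
        · exact Finset.sum_congr rfl fun p hp => Finset.sum_congr rfl fun q hq => by
            rw [hv p hp, hv q hq]
        · exact Finset.sum_congr rfl fun p hp => by rw [hv p hp]
    have hind2 : IndepFun (fun ω => ξ r ω ^ 2) (fun ω => Y ω ^ 2) P :=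
      hindY.comp (φ := fun x => x ^ 2) (ψ := fun x => x ^ 2) (by fun_prop) (by fun_prop)
    have hprod_meas : AEStronglyMeasurable (fun ω => ξ r ω * Y ω) P := (h.memLp r).1.mul hYm.1
    have hprod : MemLp (fun ω => ξ r ω * Y ω) 2 P := by
      rw [memLp_two_iff_integrable_sq hprod_meas]
      simp only [mul_pow]
      exact hind2.integrable_mul (h.memLp r).integrable_sq hYm.integrable_sq
    have hZYi : Integrable (fun ω => Z ω * Y ω) P := ih1.integrable_mul hYm
    simp only [hsplit]
    refine ⟨ih1.add hprod, ?_⟩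
    have hexp : ∀ ω, (Z ω + ξ r ω * Y ω) ^ 2 =
        Z ω ^ 2 + 2 * (ξ r ω * (Z ω * Y ω)) + ξ r ω ^ 2 * Y ω ^ 2 := fun ω => by ring
    have hI1 : Integrable (fun ω => ξ r ω * (Z ω * Y ω)) P :=
      hindZY.integrable_mul ((h.memLp r).integrable (by norm_num)) hZYi
    have hI2 : Integrable (fun ω => ξ r ω ^ 2 * Y ω ^ 2) P :=
      hind2.integrable_mul (h.memLp r).integrable_sq hYm.integrable_sq
    have hI3 : Integrable (fun ω => Z ω ^ 2 + 2 * (ξ r ω * (Z ω * Y ω))) P :=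
      ih1.integrable_sq.add (hI1.const_mul 2)
    simp only [hexp]
    rw [integral_add hI3 hI2,
      integral_add ih1.integrable_sq (hI1.const_mul 2), integral_const_mul,
      hindZY.integral_fun_mul_eq_mul_integral (h.memLp r).1 hZYi.1, h.mean,
      hind2.integral_fun_mul_eq_mul_integral (h.memLp r).integrable_sq.1 hYm.integrable_sq.1,
      h.var, h.integral_sum_sq]
    have hbound : ∑ p ∈ S, (a p r + a r p) ^ 2 ≤
        2 * ∑ p ∈ S, a p r ^ 2 + 2 * ∑ p ∈ S, a r p ^ 2 := by
      rw [Finset.mul_sum, Finset.mul_sum, ← Finset.sum_add_distrib]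
      exact Finset.sum_le_sum fun p _ => by nlinarith [sq_nonneg (a p r - a r p)]
    have hrhs : ∑ p ∈ insert r S, ∑ q ∈ insert r S, a p q ^ 2 = a r r ^ 2 +
        ∑ q ∈ S, a r q ^ 2 + (∑ p ∈ S, a p r ^ 2 + ∑ p ∈ S, ∑ q ∈ S, a p q ^ 2) := by
      simp only [Finset.sum_insert hr, Finset.sum_add_distrib]
    rw [hrhs]
    nlinarith [sq_nonneg (a r r)]

theorem exists_truncation (h : IsStandardIID P ξ ξ₀) (hne : Nonempty ι) {ε : ℝ} (hε : 0 < ε) :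
    ∃ M : ℝ, 0 ≤ M ∧ ∫ ω, (ξ₀ ω ^ 2 - min (ξ₀ ω ^ 2) M) ∂P ≤ ε := by
  obtain ⟨p⟩ := hne
  have hm : MemLp ξ₀ 2 P := (h.ident p).memLp_snd (h.memLp p)
  have hlim : Tendsto (fun M : ℕ => ∫ ω, (ξ₀ ω ^ 2 - min (ξ₀ ω ^ 2) M) ∂P) atTop
      (𝓝 (∫ _, (0 : ℝ) ∂P)) := by
    refine tendsto_integral_of_dominated_convergence (fun ω => ξ₀ ω ^ 2) (fun M => ?_)
      hm.integrable_sq (fun M => ae_of_all _ fun ω => ?_) (ae_of_all _ fun ω => ?_)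
    · exact hm.integrable_sq.1.sub (hm.integrable_sq.1.inf aestronglyMeasurable_const)
    · have h1 : (0 : ℝ) ≤ min (ξ₀ ω ^ 2) M := le_min (sq_nonneg _) (Nat.cast_nonneg _)
      have h2 : min (ξ₀ ω ^ 2) (M : ℝ) ≤ ξ₀ ω ^ 2 := min_le_left _ _
      rw [Real.norm_eq_abs, abs_le]
      constructor <;> linarith [sq_nonneg (ξ₀ ω)]
    · obtain ⟨M₀, hM₀⟩ := exists_nat_ge (ξ₀ ω ^ 2)
      refine tendsto_const_nhds.congr' ?_
      filter_upwards [eventually_ge_atTop M₀] with M hM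
      have : ξ₀ ω ^ 2 ≤ (M : ℝ) := hM₀.trans (by exact_mod_cast hM)
      rw [min_eq_left this, sub_self]
  rw [integral_zero] at hlim
  obtain ⟨M, hM⟩ := (hlim.eventually (eventually_le_nhds hε)).exists
  exact ⟨M, Nat.cast_nonneg _, hM⟩

/-- Truncate ξ² at a level depending on ε only. The centred truncation has a finite variance v and
is handled in L², with C = √v. The nonnegative remainder has mean 1 - μ ≤ ε/2; it and its centring
together cost at most ε per unit weight. -/
theorem diag [IsProbabilityMeasure P] (h : IsStandardIID P ξ ξ₀) {ε : ℝ} (hε : 0 < ε) :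
    ∃ C : ℝ, 0 ≤ C ∧ ∀ (S : Finset ι) (a : ι → ℝ),
      ∫ ω, |∑ p ∈ S, a p * (ξ p ω ^ 2 - 1)| ∂P ≤
        ε * ∑ p ∈ S, |a p| + C * Real.sqrt (∑ p ∈ S, a p ^ 2) := by
  -- Without an index nothing is known about ξ₀, but every sum is then empty.
  rcases isEmpty_or_nonempty ι with he | hne
  · refine ⟨0, le_rfl, fun S a => ?_⟩
    rw [Finset.eq_empty_of_isEmpty S]; simp
  obtain ⟨M, hM, hMε⟩ := h.exists_truncation hne (half_pos hε)
  set f : ℝ → ℝ := fun x => min (x ^ 2) M with hf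
  have hfm : Measurable f := by fun_prop
  have hf0 : ∀ x, 0 ≤ f x := fun x => le_min (sq_nonneg _) hM
  have hfM : ∀ x, f x ≤ M := fun x => min_le_right _ _
  have hfsq : ∀ x, f x ≤ x ^ 2 := fun x => min_le_left _ _
  have hm : ∀ p, AEMeasurable (ξ p) P := fun p => (h.memLp p).1.aemeasurable
  set μ := ∫ ω, f (ξ₀ ω) ∂P with hμ
  have hμp : ∀ p, ∫ ω, f (ξ p ω) ∂P = μ := fun p => ((h.ident p).comp hfm).integral_eq
  have hfi : ∀ p, Integrable (fun ω => f (ξ p ω)) P := fun p =>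
    (integrable_const M).mono' (hfm.comp_aemeasurable (hm p)).aestronglyMeasurable
      (ae_of_all _ fun ω => by rw [Real.norm_eq_abs, abs_of_nonneg (hf0 _)]; exact hfM _)
  have hμ0 : 0 ≤ μ := integral_nonneg fun _ => hf0 _
  have hμM : μ ≤ M := by
    obtain ⟨p⟩ := hne
    rw [← hμp p]
    calc ∫ ω, f (ξ p ω) ∂P ≤ ∫ _, M ∂P :=
          integral_mono (hfi p) (integrable_const _) fun ω => hfM _
      _ = M := by simp
  have hrem : ∀ p, ∫ ω, (ξ p ω ^ 2 - f (ξ p ω)) ∂P ≤ ε / 2 := fun p => by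
    have : Measurable fun x : ℝ => x ^ 2 - f x := by fun_prop
    exact ((h.ident p).comp this).integral_eq.trans_le hMε
  have hμ1 : ∀ p, ∫ ω, (ξ p ω ^ 2 - f (ξ p ω)) ∂P = 1 - μ := fun p => by
    rw [integral_sub (h.memLp p).integrable_sq (hfi p), h.var, hμp]
  set η : ι → Ω → ℝ := fun p ω => f (ξ p ω) - μ with hη
  have hηM : ∀ p ω, |η p ω| ≤ M := fun p ω => by
    rw [abs_le]; constructor <;> simp only [hη] <;> linarith [hf0 (ξ p ω), hfM (ξ p ω)]
  have hηm : ∀ p, MemLp (η p) 2 P := fun p =>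
    MemLp.of_bound ((hfi p).1.sub aestronglyMeasurable_const) M (ae_of_all _ (hηM p))
  have hηmean : ∀ p, ∫ ω, η p ω ∂P = 0 := fun p => by
    rw [integral_sub (hfi p) (integrable_const _), hμp]; simp
  have hηind : iIndepFun η P := h.indep.comp (fun _ x => f x - μ) fun _ => by fun_prop
  set v := ∫ ω, (f (ξ₀ ω) - μ) ^ 2 ∂P with hv
  have hηvar : ∀ p, ∫ ω, η p ω ^ 2 ∂P = v := fun p => by
    have : Measurable fun x : ℝ => (f x - μ) ^ 2 := by fun_prop
    exact ((h.ident p).comp this).integral_eq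
  refine ⟨Real.sqrt v, Real.sqrt_nonneg _, fun S a => ?_⟩
  have hsum : MemLp (fun ω => ∑ p ∈ S, a p * η p ω) 2 P :=
    memLp_finsetSum _ fun p _ => (hηm p).const_mul (a p)
  have h1 : ∫ ω, |∑ p ∈ S, a p * η p ω| ∂P ≤ Real.sqrt v * Real.sqrt (∑ p ∈ S, a p ^ 2) := by
    refine (integral_abs_le_sqrt hsum).trans ?_
    rw [integral_sum_mul_sq hηm hηmean hηvar hηind,
      Real.sqrt_mul (hv ▸ integral_nonneg fun _ => sq_nonneg _)]
  have hgi : ∀ p, Integrable (fun ω => ξ p ω ^ 2 - f (ξ p ω)) P := fun p =>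
    (h.memLp p).integrable_sq.sub (hfi p)
  have hpt : ∀ ω, |∑ p ∈ S, a p * (ξ p ω ^ 2 - 1)| ≤ |∑ p ∈ S, a p * η p ω| +
      ∑ p ∈ S, |a p| * ((ξ p ω ^ 2 - f (ξ p ω)) + (1 - μ)) := fun ω => by
    have e : ∑ p ∈ S, a p * (ξ p ω ^ 2 - 1) = ∑ p ∈ S, a p * η p ω +
        ∑ p ∈ S, a p * ((ξ p ω ^ 2 - f (ξ p ω)) - (1 - μ)) := by
      rw [← Finset.sum_add_distrib]
      exact Finset.sum_congr rfl fun p _ => by simp only [hη]; ring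
    rw [e]
    refine (abs_add_le _ _).trans (add_le_add le_rfl ?_)
    refine (Finset.abs_sum_le_sum_abs _ _).trans (Finset.sum_le_sum fun p _ => ?_)
    rw [abs_mul]
    refine mul_le_mul_of_nonneg_left ?_ (abs_nonneg _)
    have h2 : 0 ≤ 1 - μ := by
      rw [← hμ1 p]; exact integral_nonneg fun ω => sub_nonneg.2 (hfsq _)
    have h3 := hfsq (ξ p ω)
    rw [abs_le]; constructor <;> linarith
  have hint2 : Integrable
      (fun ω => ∑ p ∈ S, |a p| * ((ξ p ω ^ 2 - f (ξ p ω)) + (1 - μ))) P :=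
    integrable_finsetSum _ fun p _ => ((hgi p).add (integrable_const _)).const_mul _
  have hint1 : Integrable (fun ω => |∑ p ∈ S, a p * η p ω|) P :=
    (hsum.integrable (by norm_num)).abs
  have hint0 : Integrable (fun ω => |∑ p ∈ S, a p * (ξ p ω ^ 2 - 1)|) P :=
    (integrable_finsetSum _ fun p _ =>
      ((h.memLp p).integrable_sq.sub (integrable_const _)).const_mul _).abs
  calc ∫ ω, |∑ p ∈ S, a p * (ξ p ω ^ 2 - 1)| ∂P
      ≤ ∫ ω, (|∑ p ∈ S, a p * η p ω| +
          ∑ p ∈ S, |a p| * ((ξ p ω ^ 2 - f (ξ p ω)) + (1 - μ))) ∂P :=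
        integral_mono hint0 (hint1.add hint2) hpt
    _ = ∫ ω, |∑ p ∈ S, a p * η p ω| ∂P +
          ∑ p ∈ S, |a p| * ((1 - μ) + (1 - μ)) := by
        have hint3 : ∀ p ∈ S,
            Integrable (fun ω => |a p| * ((ξ p ω ^ 2 - f (ξ p ω)) + (1 - μ))) P :=
          fun p _ => ((hgi p).add (integrable_const _)).const_mul _
        rw [integral_add hint1 hint2, integral_finsetSum _ hint3]
        congr 1
        refine Finset.sum_congr rfl fun p _ => ?_
        rw [integral_const_mul, integral_add (hgi p) (integrable_const _), hμ1]
        simp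
    _ ≤ Real.sqrt v * Real.sqrt (∑ p ∈ S, a p ^ 2) + ε * ∑ p ∈ S, |a p| := by
        refine add_le_add h1 ?_
        rw [← Finset.sum_mul, mul_comm]
        refine mul_le_mul_of_nonneg_right ?_ (Finset.sum_nonneg fun _ _ => abs_nonneg _)
        obtain ⟨p⟩ := hne
        have := hrem p
        rw [hμ1] at this
        linarith
    _ = _ := add_comm _ _

/-- A weak law of large numbers in `L¹` for quadratic forms in the innovations, with second
moments only. -/
theorem quadraticForm [IsProbabilityMeasure P] (h : IsStandardIID P ξ ξ₀) {ε : ℝ} (hε : 0 < ε) :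
    ∃ C : ℝ, 0 ≤ C ∧ ∀ (S : Finset ι) (a : ι → ι → ℝ),
      Integrable (fun ω => ∑ p ∈ S, ∑ q ∈ S, a p q * (ξ p ω * ξ q ω)) P ∧
      ∫ ω, |∑ p ∈ S, ∑ q ∈ S, a p q * (ξ p ω * ξ q ω) - ∑ p ∈ S, a p p| ∂P ≤
        ε * ∑ p ∈ S, |a p p| + C * Real.sqrt (∑ p ∈ S, ∑ q ∈ S, a p q ^ 2) := by
  classical
  obtain ⟨C, hC, hdiag⟩ := h.diag hε
  refine ⟨C + Real.sqrt 2, by positivity, fun S a => ?_⟩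
  obtain ⟨hoff1, hoff2⟩ := h.offDiag a S
  have hi : Integrable (fun ω => ∑ p ∈ S, ∑ q ∈ S, a p q * (ξ p ω * ξ q ω)) P :=
    integrable_finsetSum _ fun p _ => integrable_finsetSum _ fun q _ =>
      ((h.memLp p).integrable_mul (h.memLp q)).const_mul _
  refine ⟨hi, ?_⟩
  have hsplit : ∀ ω, ∑ p ∈ S, ∑ q ∈ S, a p q * (ξ p ω * ξ q ω) - ∑ p ∈ S, a p p =
      (∑ p ∈ S, ∑ q ∈ S, if p = q then 0 else a p q * (ξ p ω * ξ q ω)) +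
        ∑ p ∈ S, a p p * (ξ p ω ^ 2 - 1) := fun ω => by
    rw [← Finset.sum_sub_distrib, ← Finset.sum_add_distrib]
    refine Finset.sum_congr rfl fun p hp => ?_
    rw [← Finset.add_sum_erase S _ hp, ← Finset.add_sum_erase S (fun q => if p = q then 0 else _) hp,
      if_pos rfl]
    have : ∑ q ∈ S.erase p, (if p = q then 0 else a p q * (ξ p ω * ξ q ω)) =
        ∑ q ∈ S.erase p, a p q * (ξ p ω * ξ q ω) := Finset.sum_congr rfl fun q hq => by
      rw [if_neg (Finset.ne_of_mem_erase hq).symm]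
    rw [this]; ring
  have hd : Integrable (fun ω => ∑ p ∈ S, a p p * (ξ p ω ^ 2 - 1)) P :=
    integrable_finsetSum _ fun p _ =>
      ((h.memLp p).integrable_sq.sub (integrable_const _)).const_mul _
  simp only [hsplit]
  have ho := hoff1.integrable (by norm_num)
  calc _ ≤ ∫ ω, (|∑ p ∈ S, ∑ q ∈ S, if p = q then 0 else a p q * (ξ p ω * ξ q ω)| +
        |∑ p ∈ S, a p p * (ξ p ω ^ 2 - 1)|) ∂P :=
        integral_mono (ho.add hd).abs (ho.abs.add hd.abs) fun ω => abs_add_le _ _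
    _ ≤ Real.sqrt (2 * ∑ p ∈ S, ∑ q ∈ S, a p q ^ 2) +
        (ε * ∑ p ∈ S, |a p p| + C * Real.sqrt (∑ p ∈ S, a p p ^ 2)) := by
        rw [integral_add ho.abs hd.abs]
        exact add_le_add ((integral_abs_le_sqrt hoff1).trans (Real.sqrt_le_sqrt hoff2))
          (hdiag S fun p => a p p)
    _ ≤ _ := by
        have hle : ∑ p ∈ S, a p p ^ 2 ≤ ∑ p ∈ S, ∑ q ∈ S, a p q ^ 2 :=
          Finset.sum_le_sum fun p hp =>
            Finset.single_le_sum (f := fun q => a p q ^ 2) (fun _ _ => sq_nonneg _) hp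
        have := mul_le_mul_of_nonneg_left (Real.sqrt_le_sqrt hle) hC
        rw [Real.sqrt_mul (by norm_num)]
        linarith

end IsStandardIID

theorem summable_sq_of_summable {f : ℕ → ℝ} (hf : Summable f) (h0 : ∀ j, 0 ≤ f j) :
    Summable fun j => f j ^ 2 := by
  refine Summable.of_nonneg_of_le (fun _ => sq_nonneg _) (fun j => ?_) (hf.mul_left (∑' i, f i))
  rw [sq]
  exact mul_le_mul_of_nonneg_right (hf.le_tsum j fun i _ => h0 i) (h0 j)

/-! ### Quadratic forms of autocorrelation wavelets and of the local autocovariance -/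

namespace QMFilter

variable (F : QMFilter)

/-- The quadratic form of the autocorrelation wavelet `Ψ_j` on the sequences indexed by `V`. -/
noncomputable def form (j : ℕ) (V : Finset ℤ) (y : ℤ → ℝ) : ℝ :=
  ∑ t ∈ V, ∑ t' ∈ V, F.Psi j (t - t') * (y t * y t')

theorem exists_cover (j : ℕ) (V : Finset ℤ) :
    ∃ S : Finset ℤ, ∀ t ∈ V, ∀ k, F.psi j (k - t) ≠ 0 → k ∈ S := by
  refine ⟨V.biUnion fun t => Finset.Icc (t - F.radius * 2 ^ j) (t + F.radius * 2 ^ j),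
    fun t ht k hk => Finset.mem_biUnion.2 ⟨t, ht, Finset.mem_Icc.2 ?_⟩⟩
  have := abs_le.1 (F.abs_le_of_psi_ne_zero hk)
  omega

theorem sum_sq_le_form (j : ℕ) (V S : Finset ℤ) (y : ℤ → ℝ) :
    ∑ k ∈ S, (∑ t ∈ V, F.psi j (k - t) * y t) ^ 2 ≤ F.form j V y := by
  obtain ⟨S₀, hS₀⟩ := F.exists_cover j V
  rw [form, ← F.sum_sq_eq_sum_Psi (S := S ∪ S₀) y fun t ht k hk =>
    Finset.mem_union_right _ (hS₀ t ht k hk)]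
  exact Finset.sum_le_sum_of_subset_of_nonneg Finset.subset_union_left fun _ _ _ => sq_nonneg _

theorem form_nonneg (j : ℕ) (V : Finset ℤ) (y : ℤ → ℝ) : 0 ≤ F.form j V y := by
  simpa using F.sum_sq_le_form j V ∅ y

theorem form_le_of_row_sum_le {j : ℕ} {V : Finset ℤ} {B : ℝ}
    (hB : ∀ t ∈ V, ∑ t' ∈ V, |F.Psi j (t - t')| ≤ B) (y : ℤ → ℝ) :
    F.form j V y ≤ B * ∑ t ∈ V, y t ^ 2 :=
  (Finset.sum_le_sum fun _ _ => Finset.sum_le_sum fun _ _ => le_abs_self _).trans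
    (sum_abs_mul_le_of_row_sum_le (F.Psi_neg j) hB y)

/-- The row sums are bounded in two ways: here by the support length, which grows like 2^j and is
absorbed by the Lipschitz constants; in `form_le_card` by the number of times, which is absorbed by
the errors C_j/T. -/
theorem form_le_radius (j : ℕ) (V : Finset ℤ) (y : ℤ → ℝ) :
    F.form j V y ≤ 5 * F.radius * 2 ^ j * ∑ t ∈ V, y t ^ 2 := by
  refine F.form_le_of_row_sum_le (fun t _ => (F.sum_abs_Psi_le j t V).trans ?_) y
  have h1 : (1 : ℝ) ≤ F.radius := by exact_mod_cast F.one_le_radius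
  have h2 : (1 : ℝ) ≤ 2 ^ j := one_le_pow₀ (by norm_num)
  nlinarith

theorem form_le_card (j : ℕ) (V : Finset ℤ) (y : ℤ → ℝ) :
    F.form j V y ≤ V.card * ∑ t ∈ V, y t ^ 2 := by
  refine F.form_le_of_row_sum_le (fun t _ => ?_) y
  refine (Finset.sum_le_sum fun t' _ => F.abs_Psi_le_one j (t - t')).trans ?_
  simp

end QMFilter

section Autocov

variable {F : QMFilter} {W : ℕ → ℝ → ℝ} {z : ℝ}

theorem spec_nonneg (j : ℕ) (z : ℝ) : 0 ≤ spec W j z := sq_nonneg _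

theorem summable_spec_mul_Psi (hW : Summable fun j : ℕ => W (j + 1) z ^ 2) (τ : ℤ) :
    Summable fun j : ℕ => spec W (j + 1) z * F.Psi (j + 1) τ := by
  refine hW.of_norm_bounded fun j => ?_
  rw [Real.norm_eq_abs, abs_mul, abs_of_nonneg (spec_nonneg _ _)]
  exact mul_le_of_le_one_right (sq_nonneg _) (F.abs_Psi_le_one _ _)

theorem autocov_neg (z : ℝ) (τ : ℤ) : autocov F W z (-τ) = autocov F W z τ := by
  simp only [autocov, F.Psi_neg]

theorem hasSum_spec_mul_form (hW : Summable fun j : ℕ => W (j + 1) z ^ 2) (V : Finset ℤ)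
    (y : ℤ → ℝ) :
    HasSum (fun j : ℕ => spec W (j + 1) z * F.form (j + 1) V y)
      (∑ t ∈ V, ∑ t' ∈ V, autocov F W z (t - t') * (y t * y t')) := by
  have h : HasSum (fun j : ℕ => ∑ t ∈ V, ∑ t' ∈ V,
      spec W (j + 1) z * F.Psi (j + 1) (t - t') * (y t * y t'))
      (∑ t ∈ V, ∑ t' ∈ V, autocov F W z (t - t') * (y t * y t')) :=
    hasSum_sum fun t _ => hasSum_sum fun t' _ =>
      (summable_spec_mul_Psi hW (t - t')).hasSum.mul_right _
  convert h using 2 with j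
  simp only [QMFilter.form, Finset.mul_sum, mul_assoc]

/-- Evenness in the lag extends the one-sided summability to all lags. Bounded row sums then bound
the covariance operator of the process frozen at z. -/
theorem exists_autocov_row_sum_le
    (hc : ∑' τ : ℕ, ⨆ z ∈ Set.Ioo (0 : ℝ) 1, ‖autocov F W z τ‖ₑ < ⊤)
    (hz : z ∈ Set.Ioo (0 : ℝ) 1) :
    ∃ K : ℝ, 0 ≤ K ∧ ∀ (t : ℤ) (V : Finset ℤ), ∑ t' ∈ V, |autocov F W z (t - t')| ≤ K := by
  have h1 : ∑' τ : ℕ, ‖autocov F W z τ‖ₑ < ⊤ :=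
    lt_of_le_of_lt (ENNReal.tsum_le_tsum fun τ =>
      le_iSup₂ (f := fun z (_ : z ∈ Set.Ioo (0 : ℝ) 1) => ‖autocov F W z τ‖ₑ) z hz) hc
  have h2 : Summable fun τ : ℕ => |autocov F W z τ| := by
    have := ENNReal.summable_toReal h1.ne
    simpa using this
  have h3 : Summable fun τ : ℤ => |autocov F W z τ| :=
    Summable.of_nat_of_neg h2 (by simpa [autocov_neg] using h2)
  refine ⟨∑' τ : ℤ, |autocov F W z τ|, tsum_nonneg fun _ => abs_nonneg _, fun t V => ?_⟩
  have := h3.sum_le_tsum (V.map (Equiv.subLeft t).toEmbedding) fun _ _ => abs_nonneg _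
  simpa using this

/-- Every scale contributes a nonnegative form, so a partial sum is dominated by the form of c(z,
·). -/
theorem sum_spec_mul_form_le {K : ℝ} (hW : Summable fun j : ℕ => W (j + 1) z ^ 2)
    (hK : ∀ (t : ℤ) (V : Finset ℤ), ∑ t' ∈ V, |autocov F W z (t - t')| ≤ K)
    (m : ℕ) (V : Finset ℤ) (y : ℤ → ℝ) :
    ∑ j ∈ Finset.range m, spec W (j + 1) z * F.form (j + 1) V y ≤ K * ∑ t ∈ V, y t ^ 2 := by
  have h1 := hasSum_spec_mul_form (F := F) hW V y
  have h2 := sum_le_hasSum (Finset.range m)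
    (fun j _ => mul_nonneg (spec_nonneg _ _) (F.form_nonneg (j + 1) V y)) h1
  refine h2.trans ?_
  exact (Finset.sum_le_sum fun _ _ => Finset.sum_le_sum fun _ _ => le_abs_self _).trans
    (sum_abs_mul_le_of_row_sum_le (autocov_neg z) (fun t _ => hK t V) y)

end Autocov

/-! ### The process in terms of its innovations: covariance bound and energy tail -/

namespace IsLSW

variable {Ω : Type*} [MeasurableSpace Ω] {P : Measure Ω} {F : QMFilter} {X : ℕ → ℕ → Ω → ℝ}
  {w : ℕ → ℕ → ℤ → ℝ} {ξ : ℕ → ℤ → Ω → ℝ} {W : ℕ → ℝ → ℝ} {L C : ℕ → ℝ} {z : ℝ}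

theorem summable_sq (hX : IsLSW P F X w ξ W L C) (hz : z ∈ Set.Ioo (0 : ℝ) 1) :
    Summable fun j : ℕ => W (j + 1) z ^ 2 :=
  let ⟨_, h⟩ := hX.sq_summable; (h z hz).1

theorem L_nonneg (hX : IsLSW P F X w ξ W L C) (j : ℕ) : 0 ≤ L (j + 1) := by
  have := hX.lipschitz (j + 1) (by omega) 0 1
  have h := abs_nonneg (W (j + 1) 0 - W (j + 1) 1)
  simp at this
  linarith

theorem C_nonneg (hX : IsLSW P F X w ξ W L C) (j : ℕ) : 0 ≤ C (j + 1) := by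
  have hpos : (0 : ℝ) < 2 ^ (j + 1) := by positivity
  -- Location 0 always belongs to the sample range, so it cannot be an omitted one.
  rcases hX.close (j + 1) (j + 1) (by omega) le_rfl 0 with h | h
  · have := (abs_nonneg _).trans h
    rcases div_nonneg_iff.1 this with h | h <;> linarith
  · exact absurd (by simp) h.1

theorem isStandardIID (hX : IsLSW P F X w ξ W L C) :
    IsStandardIID P (fun p : ℕ × ℤ => ξ (p.1 + 1) p.2) (ξ 1 0) where
  memLp p := hX.memLp _ (by omega) _
  mean p := hX.mean _ (by omega) _
  var p := hX.var _ (by omega) _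
  ident p := hX.ident _ (by omega) _
  indep := hX.indep.precomp (g := fun p : ℕ × ℤ => ((⟨p.1 + 1, by omega⟩ : {j : ℕ // 1 ≤ j}), p.2))
    fun p q h => by
      simp only [Prod.mk.injEq, Subtype.mk.injEq, Nat.add_right_cancel_iff] at h
      exact Prod.ext h.1 h.2

end IsLSW

section Representation

variable (F : QMFilter) (w : ℕ → ℕ → ℤ → ℝ)

/-- The coefficient of the innovation `ξ_{j+1,k}`, `p = (j, k)`, in `X_{t,T}`, `T = 2^J`. -/
noncomputable def coef (J : ℕ) (p : ℕ × ℤ) (t : ℤ) : ℝ := w J (p.1 + 1) p.2 * F.psi (p.1 + 1) (p.2 - t)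

/-- The locations that can contribute to the sample `X_{0,T}, …, X_{T-1,T}`, `T = 2^J`. -/
noncomputable def locs (J : ℕ) : Finset ℤ :=
  Finset.Icc (-(F.radius * 2 ^ J : ℤ)) (2 ^ J + F.radius * 2 ^ J)

/-- The innovations that can contribute to the sample. -/
noncomputable def innov (J : ℕ) : Finset (ℕ × ℤ) := Finset.range J ×ˢ locs F J

/-- The observation times. -/
noncomputable def times (J : ℕ) : Finset ℤ := Finset.Ico (0 : ℤ) (2 ^ J)

variable {F w}

theorem mem_times {J : ℕ} {t : ℤ} : t ∈ times J ↔ 0 ≤ t ∧ t < 2 ^ J := Finset.mem_Ico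

theorem card_times (J : ℕ) : ((times J).card : ℝ) = 2 ^ J := by
  have : (times J).card = 2 ^ J := by
    rw [times, Int.card_Ico, sub_zero]
    exact_mod_cast Int.toNat_natCast (2 ^ J)
  rw [this]; push_cast; rfl

theorem mem_locs_of_psi_ne_zero {J j : ℕ} (hj : j ≤ J) {t k : ℤ} (ht : t ∈ times J)
    (hk : F.psi j (k - t) ≠ 0) : k ∈ locs F J := by
  have h1 := abs_le.1 (F.abs_le_of_psi_ne_zero hk)
  have h2 : (2 : ℤ) ^ j ≤ 2 ^ J := pow_le_pow_right₀ (by norm_num) hj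
  have h3 : (F.radius : ℤ) * 2 ^ j ≤ F.radius * 2 ^ J :=
    mul_le_mul_of_nonneg_left h2 (Nat.cast_nonneg _)
  rw [mem_times] at ht
  rw [locs, Finset.mem_Icc]
  constructor <;> linarith

theorem IsLSW.ae_eq_sum {Ω : Type*} [MeasurableSpace Ω] {P : Measure Ω} {X : ℕ → ℕ → Ω → ℝ}
    {ξ : ℕ → ℤ → Ω → ℝ} {W : ℕ → ℝ → ℝ} {L C : ℕ → ℝ} (hX : IsLSW P F X w ξ W L C)
    {J : ℕ} {t : ℤ} (ht : t ∈ times J) :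
    ∀ᵐ ω ∂P, X J t.toNat ω = ∑ p ∈ innov F J, coef F w J p t * ξ (p.1 + 1) p.2 ω := by
  have ht' := mem_times.1 ht
  have hcast : ((t.toNat : ℕ) : ℤ) = t := Int.toNat_of_nonneg ht'.1
  have hlt : t.toNat < 2 ^ J := by
    have := ht'.2
    rw [← hcast] at this
    exact_mod_cast this
  filter_upwards [hX.repr J t.toNat hlt] with ω hω
  have hI : Finset.Icc 1 J = Finset.Ico (0 + 1) (J + 1) := by ext; simp
  rw [hω, hI, ← Finset.sum_Ico_add', ← Finset.range_eq_Ico, innov, Finset.sum_product]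
  refine Finset.sum_congr rfl fun j hj => ?_
  rw [finsum_eq_sum_of_support_subset (s := locs F J)]
  · simp only [coef, QMFilter.wav, hcast]
  · intro k hk
    have h1 := right_ne_zero_of_mul (left_ne_zero_of_mul hk)
    rw [QMFilter.wav, hcast] at h1
    exact mem_locs_of_psi_ne_zero (Finset.mem_range.1 hj) ht h1

end Representation

namespace IsLSW

variable {Ω : Type*} [MeasurableSpace Ω] {P : Measure Ω} {F : QMFilter} {X : ℕ → ℕ → Ω → ℝ}
  {w : ℕ → ℕ → ℤ → ℝ} {ξ : ℕ → ℤ → Ω → ℝ} {W : ℕ → ℝ → ℝ} {L C : ℕ → ℝ} {z : ℝ}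

theorem abs_amplitude_le (hX : IsLSW P F X w ξ W L C) {J j : ℕ} (hj : j < J) (k : ℤ) :
    |w J (j + 1) k| ≤
      |W (j + 1) z| + (L (j + 1) * |(k : ℝ) / 2 ^ J - z| + C (j + 1) / 2 ^ J) := by
  have h2 : 0 ≤ C (j + 1) / 2 ^ J := div_nonneg (hX.C_nonneg j) (by positivity)
  have h3 : 0 ≤ L (j + 1) * |(k : ℝ) / 2 ^ J - z| := mul_nonneg (hX.L_nonneg j) (abs_nonneg _)
  rcases hX.close J (j + 1) (by omega) hj k with h | h
  · have h1 := hX.lipschitz (j + 1) (by omega) (k / 2 ^ J) z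
    have e : w J (j + 1) k = W (j + 1) z + (W (j + 1) (k / 2 ^ J) - W (j + 1) z) +
      (w J (j + 1) k - W (j + 1) (k / 2 ^ J)) := by ring
    rw [e]
    refine (abs_add_three _ _ _).trans ?_
    linarith
  · rw [h.2, abs_zero]
    positivity

/-- No scale in the representation is coarser than 2^J = T, so a location felt in the sample is at
bounded rescaled distance from z. -/
theorem abs_location_sub_le {J j : ℕ} (hj : j < J) (hz : z ∈ Set.Ioo (0 : ℝ) 1) {t k : ℤ}
    (ht : t ∈ times J) (hk : F.psi (j + 1) (k - t) ≠ 0) :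
    |(k : ℝ) / 2 ^ J - z| ≤ F.radius + 1 := by
  have h1 : |(k - t : ℝ)| ≤ F.radius * 2 ^ (j + 1) := by
    exact_mod_cast F.abs_le_of_psi_ne_zero hk
  have h2 : (2 : ℝ) ^ (j + 1) ≤ 2 ^ J := pow_le_pow_right₀ (by norm_num) hj
  have hT : (0 : ℝ) < 2 ^ J := by positivity
  have hD : (0 : ℝ) ≤ F.radius := Nat.cast_nonneg _
  have ht' := mem_times.1 ht
  have ht0 : (0 : ℝ) ≤ t / 2 ^ J := div_nonneg (by exact_mod_cast ht'.1) hT.le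
  have ht1 : (t : ℝ) / 2 ^ J ≤ 1 := by
    rw [div_le_one hT]; exact_mod_cast ht'.2.le
  have e : (k : ℝ) / 2 ^ J - z = (k - t) / 2 ^ J + (t / 2 ^ J - z) := by ring
  rw [e]
  refine (abs_add_le _ _).trans (add_le_add ?_ ?_)
  · rw [abs_div, abs_of_pos hT, div_le_iff₀ hT]
    exact h1.trans (mul_le_mul_of_nonneg_left h2 hD)
  · have := hz.1
    have := hz.2
    rw [abs_le]; constructor <;> linarith

/-- A summable majorant of the deviations of the squared amplitudes from twice the spectrum. -/
noncomputable def dev (F : QMFilter) (L C : ℕ → ℝ) (j : ℕ) : ℝ :=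
  10 * F.radius * (F.radius + 1) ^ 2 * (2 ^ (j + 1) * L (j + 1)) ^ 2 + 2 * C (j + 1) ^ 2

theorem dev_nonneg (j : ℕ) : 0 ≤ dev F L C j := by
  unfold dev; positivity

theorem summable_dev (hX : IsLSW P F X w ξ W L C) : Summable (dev F L C) := by
  have h1 : Summable fun j : ℕ => (2 : ℝ) ^ (j + 1) * L (j + 1) :=
    (summable_nat_add_iff 1).2 hX.lipschitz_summable
  have h2 : Summable fun j : ℕ => C (j + 1) := (summable_nat_add_iff 1).2 hX.close_summable
  refine ((summable_sq_of_summable h1 fun j => ?_).mul_left _).add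
    ((summable_sq_of_summable h2 hX.C_nonneg).mul_left 2)
  exact mul_nonneg (by positivity) (hX.L_nonneg j)

/-- Squared amplitudes are at most twice the spectrum, up to a deviation `e` that stays small
after multiplication by the wavelet's support length or the sample size. -/
theorem exists_amplitude_sq_le (hX : IsLSW P F X w ξ W L C) (hz : z ∈ Set.Ioo (0 : ℝ) 1)
    {J j : ℕ} (hj : j < J) : ∃ e : ℝ, 0 ≤ e ∧ e ≤ 2 * dev F L C j ∧
      (∀ k, ∀ t ∈ times J, F.psi (j + 1) (k - t) ≠ 0 →
        w J (j + 1) k ^ 2 ≤ 2 * spec W (j + 1) z + e) ∧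
      ∀ y, e * F.form (j + 1) (times J) y ≤ 2 * dev F L C j * ∑ t ∈ times J, y t ^ 2 := by
  have hT : (0 : ℝ) < 2 ^ J := by positivity
  have hT1 : (1 : ℝ) ≤ 2 ^ J := one_le_pow₀ (by norm_num)
  have hD : (1 : ℝ) ≤ F.radius := by exact_mod_cast F.one_le_radius
  have hL := hX.L_nonneg j
  have hC := hX.C_nonneg j
  have hp : (1 : ℝ) ≤ 2 ^ (j + 1) := one_le_pow₀ (by norm_num)
  set D : ℝ := (F.radius : ℝ)
  set l := L (j + 1)
  set c := C (j + 1)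
  -- Squaring |W_j(z)| + Lipschitz error + C_j/T with (x + y + v)² ≤ 2x² + 4y² + 4v² gives e = 2(a +
  -- b). The part a is paired with the support-length bound of the form, b with the cardinality
  -- bound.
  set a : ℝ := 2 * ((D + 1) * l) ^ 2 with ha
  set b : ℝ := 2 * (c / 2 ^ J) ^ 2 with hb
  have ha0 : 0 ≤ a := by positivity
  have hb0 : 0 ≤ b := by positivity
  have hac : a * (5 * D * 2 ^ (j + 1)) ≤ 10 * D * (D + 1) ^ 2 * (2 ^ (j + 1) * l) ^ 2 := by
    have : a * (5 * D * 2 ^ (j + 1)) = 10 * D * (D + 1) ^ 2 * (2 ^ (j + 1) * l ^ 2) := by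
      rw [ha]; ring
    rw [this]
    refine mul_le_mul_of_nonneg_left ?_ (by positivity)
    rw [mul_pow]
    refine mul_le_mul_of_nonneg_right ?_ (sq_nonneg _)
    nlinarith
  have hbc : b * 2 ^ J ≤ 2 * c ^ 2 := by
    have : b * 2 ^ J = 2 * c ^ 2 / 2 ^ J := by rw [hb]; field_simp
    rw [this]
    exact div_le_self (by positivity) hT1
  have hdev : dev F L C j = 10 * D * (D + 1) ^ 2 * (2 ^ (j + 1) * l) ^ 2 + 2 * c ^ 2 := rfl
  have ha1 : a ≤ a * (5 * D * 2 ^ (j + 1)) := le_mul_of_one_le_right ha0 (by nlinarith)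
  have hb1 : b ≤ b * 2 ^ J := le_mul_of_one_le_right hb0 hT1
  refine ⟨2 * (a + b), by positivity, by linarith, fun k t ht hk => ?_, fun y => ?_⟩
  · have h1 := hX.abs_amplitude_le (z := z) hj k
    have h2 := mul_le_mul_of_nonneg_left (abs_location_sub_le hj hz ht hk) hL
    have h3 : |w J (j + 1) k| ≤ |W (j + 1) z| + ((D + 1) * l + c / 2 ^ J) := by
      linarith
    have h4 : w J (j + 1) k ^ 2 ≤ (|W (j + 1) z| + ((D + 1) * l + c / 2 ^ J)) ^ 2 := by
      rw [← sq_abs]; exact pow_le_pow_left₀ (abs_nonneg _) h3 2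
    have h5 : |W (j + 1) z| ^ 2 = spec W (j + 1) z := sq_abs _
    nlinarith [sq_nonneg (|W (j + 1) z| - ((D + 1) * l + c / 2 ^ J)),
      sq_nonneg ((D + 1) * l - c / 2 ^ J)]
  · have h1 := mul_le_mul_of_nonneg_left (F.form_le_radius (j + 1) (times J) y) ha0
    have h2 := mul_le_mul_of_nonneg_left (F.form_le_card (j + 1) (times J) y) hb0
    rw [card_times] at h2
    have h3 : 0 ≤ ∑ t ∈ times J, y t ^ 2 := Finset.sum_nonneg fun _ _ => sq_nonneg _
    have h4 := mul_le_mul_of_nonneg_right hac h3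
    have h5 := mul_le_mul_of_nonneg_right hbc h3
    rw [hdev]
    linarith

/-- The covariance operators of the samples are uniformly bounded. -/
theorem exists_covariance_bound (hX : IsLSW P F X w ξ W L C) (hz : z ∈ Set.Ioo (0 : ℝ) 1)
    (hc : ∑' τ : ℕ, ⨆ z ∈ Set.Ioo (0 : ℝ) 1, ‖autocov F W z τ‖ₑ < ⊤) :
    ∃ K : ℝ, 0 ≤ K ∧ ∀ (J : ℕ) (y : ℤ → ℝ),
      ∑ p ∈ innov F J, (∑ t ∈ times J, coef F w J p t * y t) ^ 2 ≤
        K * ∑ t ∈ times J, y t ^ 2 := by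
  obtain ⟨Kc, hKc0, hKc⟩ := exists_autocov_row_sum_le hc hz
  have hdev := hX.summable_dev
  refine ⟨2 * Kc + 2 * ∑' j, dev F L C j,
    add_nonneg (by positivity) (mul_nonneg (by norm_num) (tsum_nonneg dev_nonneg)),
    fun J y => ?_⟩
  set N := ∑ t ∈ times J, y t ^ 2 with hN
  have hN0 : 0 ≤ N := Finset.sum_nonneg fun _ _ => sq_nonneg _
  have hscale : ∀ j ∈ Finset.range J,
      ∑ k ∈ locs F J, (∑ t ∈ times J, coef F w J (j, k) t * y t) ^ 2 ≤
        2 * (spec W (j + 1) z * F.form (j + 1) (times J) y) + 2 * dev F L C j * N := by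
    intro j hj
    obtain ⟨e, he0, -, he1, he2⟩ := hX.exists_amplitude_sq_le hz (Finset.mem_range.1 hj)
    calc ∑ k ∈ locs F J, (∑ t ∈ times J, coef F w J (j, k) t * y t) ^ 2
        ≤ ∑ k ∈ locs F J, (2 * spec W (j + 1) z + e) *
            (∑ t ∈ times J, F.psi (j + 1) (k - t) * y t) ^ 2 := by
          refine Finset.sum_le_sum fun k _ => ?_
          simp only [coef, mul_assoc]
          rw [← Finset.mul_sum, mul_pow]
          -- The amplitude bound holds only at locations felt in the sample; elsewhere the transform
          -- is zero.
          by_cases h0 : ∃ t ∈ times J, F.psi (j + 1) (k - t) ≠ 0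
          · obtain ⟨t, ht, hk⟩ := h0
            exact mul_le_mul_of_nonneg_right (he1 k t ht hk) (sq_nonneg _)
          · push Not at h0
            rw [Finset.sum_eq_zero fun t ht => by rw [h0 t ht, zero_mul]]
            simp
      _ ≤ (2 * spec W (j + 1) z + e) * F.form (j + 1) (times J) y := by
          rw [← Finset.mul_sum]
          exact mul_le_mul_of_nonneg_left (F.sum_sq_le_form _ _ _ _)
            (add_nonneg (mul_nonneg (by norm_num) (spec_nonneg _ _)) he0)
      _ ≤ _ := by
          have := he2 y
          rw [add_mul]; linarith
  rw [innov, Finset.sum_product]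
  refine (Finset.sum_le_sum hscale).trans ?_
  rw [Finset.sum_add_distrib, ← Finset.mul_sum, ← Finset.sum_mul, ← Finset.mul_sum]
  have h1 := sum_spec_mul_form_le (hX.summable_sq hz) hKc J (times J) y
  have h2 := mul_le_mul_of_nonneg_right
    (hdev.sum_le_tsum (Finset.range J) fun j _ => dev_nonneg j) hN0
  rw [add_mul]
  linarith

/-- The variance contributed by the scales beyond `m` is uniformly small. -/
theorem exists_energy_tail (hX : IsLSW P F X w ξ W L C) (hz : z ∈ Set.Ioo (0 : ℝ) 1) :
    ∃ e : ℕ → ℝ, (∀ m, 0 ≤ e m) ∧ Tendsto e atTop (𝓝 0) ∧ ∀ (J m : ℕ) (V : Finset ℤ),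
      V ⊆ times J → ∑ p ∈ (innov F J).filter (fun p => m ≤ p.1), ∑ t ∈ V, coef F w J p t ^ 2 ≤
        V.card * e m := by
  set f : ℕ → ℝ := fun j => 2 * spec W (j + 1) z + 2 * dev F L C j with hf
  have hf0 : ∀ j, 0 ≤ f j := fun j =>
    add_nonneg (mul_nonneg (by norm_num) (spec_nonneg _ _))
      (mul_nonneg (by norm_num) (dev_nonneg j))
  have hfs : Summable f := ((hX.summable_sq hz).mul_left 2).add (hX.summable_dev.mul_left 2)
  refine ⟨fun m => ∑' i, f (i + m), fun m => tsum_nonneg fun i => hf0 _,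
    tendsto_sum_nat_add f, fun J m V hV => ?_⟩
  rw [Finset.sum_comm, ← nsmul_eq_mul]
  refine Finset.sum_le_card_nsmul _ _ _ fun t ht => ?_
  have hscale : ∀ j ∈ Finset.range J, ∑ k ∈ locs F J, coef F w J (j, k) t ^ 2 ≤ f j := by
    intro j hj
    obtain ⟨e, he0, he, he1, -⟩ := hX.exists_amplitude_sq_le hz (Finset.mem_range.1 hj)
    calc ∑ k ∈ locs F J, coef F w J (j, k) t ^ 2
        ≤ ∑ k ∈ locs F J, f j * F.psi (j + 1) (k - t) ^ 2 := by
          refine Finset.sum_le_sum fun k _ => ?_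
          simp only [coef, mul_pow]
          by_cases hk : F.psi (j + 1) (k - t) = 0
          · simp [hk]
          · refine mul_le_mul_of_nonneg_right ((he1 k t (hV ht) hk).trans ?_) (sq_nonneg _)
            simp only [hf]; linarith
      _ ≤ f j := by
          rw [← Finset.mul_sum]
          exact mul_le_of_le_one_right (hf0 j) (F.sum_psi_shift_sq_le _ _ _)
  have hfilter : (innov F J).filter (fun p => m ≤ p.1) =
      ((Finset.range J).filter (m ≤ ·)) ×ˢ locs F J := by
    ext p; simp [innov]; tauto
  rw [hfilter, Finset.sum_product]
  calc ∑ j ∈ (Finset.range J).filter (m ≤ ·), ∑ k ∈ locs F J, coef F w J (j, k) t ^ 2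
      ≤ ∑ j ∈ (Finset.range J).filter (m ≤ ·), f j :=
        Finset.sum_le_sum fun j hj => hscale j (Finset.mem_filter.1 hj).1
    -- Enlarging the range of scales makes the sum a partial sum of the shifted series, free of `J`.
    _ ≤ ∑ j ∈ (Finset.range J).image (· + m), f j := by
        refine Finset.sum_le_sum_of_subset_of_nonneg (fun j hj => ?_) fun _ _ _ => hf0 _
        rw [Finset.mem_filter, Finset.mem_range] at hj
        exact Finset.mem_image.2 ⟨j - m, by rw [Finset.mem_range]; omega, by omega⟩
    _ = ∑ j ∈ Finset.range J, f (j + m) :=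
        Finset.sum_image fun a _ b _ h => by simpa using h
    _ ≤ ∑' i, f (i + m) :=
        ((summable_nat_add_iff m).2 hfs).sum_le_tsum _ fun _ _ => hf0 _

end IsLSW

/-! ### Frobenius and trace bounds for Toeplitz forms of the sample -/

theorem sum_sub_right_sq_le {π : ℤ → ℝ} (hπ : ∀ S : Finset ℤ, ∑ a ∈ S, π a ^ 2 ≤ 1) (t' : ℤ)
    (V : Finset ℤ) : ∑ t ∈ V, π (t - t') ^ 2 ≤ 1 := by
  simpa using hπ (V.map (Equiv.subRight t').toEmbedding)

/-- The coefficients of the quadratic form `∑ π(t - t') X_t X_t'` in the innovations. -/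
noncomputable def quadCoef (F : QMFilter) (w : ℕ → ℕ → ℤ → ℝ) (π : ℤ → ℝ) (V : Finset ℤ) (J : ℕ)
    (p q : ℕ × ℤ) : ℝ :=
  ∑ t ∈ V, ∑ t' ∈ V, π (t - t') * (coef F w J p t * coef F w J q t')

section Bound

variable {F : QMFilter} {w : ℕ → ℕ → ℤ → ℝ} {K : ℝ} {J : ℕ} {V : Finset ℤ} {π : ℤ → ℝ}

theorem sum_coef_mul_sq_le
    (hK : ∀ y : ℤ → ℝ, ∑ p ∈ innov F J, (∑ t ∈ times J, coef F w J p t * y t) ^ 2 ≤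
      K * ∑ t ∈ times J, y t ^ 2) (hV : V ⊆ times J) (y : ℤ → ℝ) :
    ∑ p ∈ innov F J, (∑ t ∈ V, coef F w J p t * y t) ^ 2 ≤ K * ∑ t ∈ V, y t ^ 2 := by
  have := hK fun t => if t ∈ V then y t else 0
  have e1 : ∀ p, ∑ t ∈ times J, coef F w J p t * (if t ∈ V then y t else 0) =
      ∑ t ∈ V, coef F w J p t * y t := fun p => by
    rw [← Finset.sum_subset hV fun t _ ht => by rw [if_neg ht, mul_zero]]
    exact Finset.sum_congr rfl fun t ht => by rw [if_pos ht]
  have e2 : ∑ t ∈ times J, (if t ∈ V then y t else 0) ^ 2 = ∑ t ∈ V, y t ^ 2 := by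
    rw [← Finset.sum_subset hV fun t _ ht => by simp [ht]]
    exact Finset.sum_congr rfl fun t ht => by rw [if_pos ht]
  simpa only [e1, e2] using this

theorem sum_filtered_coef_sq_le
    (hK : ∀ y : ℤ → ℝ, ∑ p ∈ innov F J, (∑ t ∈ V, coef F w J p t * y t) ^ 2 ≤
      K * ∑ t ∈ V, y t ^ 2) (hK0 : 0 ≤ K) (hπ : ∀ S : Finset ℤ, ∑ a ∈ S, π a ^ 2 ≤ 1) :
    ∑ p ∈ innov F J, ∑ t' ∈ V, (∑ t ∈ V, coef F w J p t * π (t - t')) ^ 2 ≤ K * V.card := by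
  rw [Finset.sum_comm, mul_comm, ← nsmul_eq_mul]
  refine Finset.sum_le_card_nsmul _ _ _ fun t' _ => ?_
  exact (hK _).trans (mul_le_of_le_one_right hK0 (sum_sub_right_sq_le hπ t' V))

/-- With M the matrix of coefficients and Π the Toeplitz matrix, the form is MΠMᵀ. The operator
bound is used once for each factor M, and each column of Π has norm at most 1. -/
theorem sum_quadCoef_sq_le
    (hK : ∀ y : ℤ → ℝ, ∑ p ∈ innov F J, (∑ t ∈ V, coef F w J p t * y t) ^ 2 ≤
      K * ∑ t ∈ V, y t ^ 2) (hK0 : 0 ≤ K) (hπ : ∀ S : Finset ℤ, ∑ a ∈ S, π a ^ 2 ≤ 1) :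
    ∑ p ∈ innov F J, ∑ q ∈ innov F J, quadCoef F w π V J p q ^ 2 ≤ K ^ 2 * V.card := by
  have h1 : ∀ p ∈ innov F J, ∑ q ∈ innov F J, quadCoef F w π V J p q ^ 2 ≤
      K * ∑ t' ∈ V, (∑ t ∈ V, coef F w J p t * π (t - t')) ^ 2 := fun p _ => by
    refine le_trans (le_of_eq ?_) (hK fun t' => ∑ t ∈ V, coef F w J p t * π (t - t'))
    refine Finset.sum_congr rfl fun q _ => ?_
    congr 1
    rw [quadCoef, Finset.sum_comm]
    refine Finset.sum_congr rfl fun t' _ => ?_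
    rw [Finset.mul_sum]
    exact Finset.sum_congr rfl fun t _ => by ring
  refine (Finset.sum_le_sum h1).trans ?_
  rw [← Finset.mul_sum, sq, mul_assoc]
  exact mul_le_mul_of_nonneg_left (sum_filtered_coef_sq_le hK hK0 hπ) hK0

/-- A diagonal entry pairs the coefficients of one innovation with their filtered version. Under
Cauchy–Schwarz `S` enters through its energy, which is small when `S` consists of coarse scales. -/
theorem sum_abs_quadCoef_le
    (hK : ∀ y : ℤ → ℝ, ∑ p ∈ innov F J, (∑ t ∈ V, coef F w J p t * y t) ^ 2 ≤
      K * ∑ t ∈ V, y t ^ 2) (hK0 : 0 ≤ K) (hπ : ∀ S : Finset ℤ, ∑ a ∈ S, π a ^ 2 ≤ 1)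
    {S : Finset (ℕ × ℤ)} (hS : S ⊆ innov F J) :
    ∑ p ∈ S, |quadCoef F w π V J p p| ≤
      Real.sqrt (∑ p ∈ S, ∑ t ∈ V, coef F w J p t ^ 2) * Real.sqrt (K * V.card) := by
  have h1 : ∀ p ∈ S, |quadCoef F w π V J p p| ≤
      ∑ t' ∈ V, |coef F w J p t'| * |∑ t ∈ V, coef F w J p t * π (t - t')| := fun p _ => by
    rw [quadCoef, Finset.sum_comm]
    refine (Finset.abs_sum_le_sum_abs _ _).trans (le_of_eq ?_)
    refine Finset.sum_congr rfl fun t' _ => ?_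
    rw [← abs_mul, Finset.mul_sum]
    congr 1
    exact Finset.sum_congr rfl fun t _ => by ring
  refine (Finset.sum_le_sum h1).trans ?_
  have h2 := Real.sum_mul_le_sqrt_mul_sqrt (S ×ˢ V) (fun x => |coef F w J x.1 x.2|)
    fun x => |∑ t ∈ V, coef F w J x.1 t * π (t - x.2)|
  simp only [sq_abs, Finset.sum_product] at h2
  refine h2.trans (mul_le_mul_of_nonneg_left (Real.sqrt_le_sqrt ?_) (Real.sqrt_nonneg _))
  refine le_trans ?_ (sum_filtered_coef_sq_le hK hK0 hπ)
  exact Finset.sum_le_sum_of_subset_of_nonneg hS fun _ _ _ =>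
    Finset.sum_nonneg fun _ _ => sq_nonneg _

theorem sum_coef_sq_le
    (hK : ∀ y : ℤ → ℝ, ∑ p ∈ innov F J, (∑ t ∈ V, coef F w J p t * y t) ^ 2 ≤
      K * ∑ t ∈ V, y t ^ 2) : ∑ p ∈ innov F J, ∑ t ∈ V, coef F w J p t ^ 2 ≤ K * V.card := by
  rw [Finset.sum_comm, mul_comm, ← nsmul_eq_mul]
  refine Finset.sum_le_card_nsmul _ _ _ fun t ht => ?_
  have := hK fun t' => if t' = t then 1 else 0
  simpa [ht] using this

theorem sum_abs_quadCoef_innov_le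
    (hK : ∀ y : ℤ → ℝ, ∑ p ∈ innov F J, (∑ t ∈ V, coef F w J p t * y t) ^ 2 ≤
      K * ∑ t ∈ V, y t ^ 2) (hK0 : 0 ≤ K) (hπ : ∀ S : Finset ℤ, ∑ a ∈ S, π a ^ 2 ≤ 1) :
    ∑ p ∈ innov F J, |quadCoef F w π V J p p| ≤ K * V.card := by
  have h0 : 0 ≤ K * (V.card : ℝ) := by positivity
  refine (sum_abs_quadCoef_le hK hK0 hπ subset_rfl).trans ?_
  calc _ ≤ Real.sqrt (K * V.card) * Real.sqrt (K * V.card) :=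
        mul_le_mul_of_nonneg_right (Real.sqrt_le_sqrt (sum_coef_sq_le hK)) (Real.sqrt_nonneg _)
    _ = _ := Real.mul_self_sqrt h0

end Bound

namespace IsLSW

variable {Ω : Type*} [MeasurableSpace Ω] {P : Measure Ω}
  {F : QMFilter} {X : ℕ → ℕ → Ω → ℝ}
  {w : ℕ → ℕ → ℤ → ℝ} {ξ : ℕ → ℤ → Ω → ℝ} {W : ℕ → ℝ → ℝ} {L C : ℕ → ℝ} {z : ℝ}

theorem ae_forall_eq_sum (hX : IsLSW P F X w ξ W L C) {J : ℕ} {V : Finset ℤ} (hV : V ⊆ times J) :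
    ∀ᵐ ω ∂P, ∀ t ∈ V, X J t.toNat ω =
      ∑ p ∈ innov F J, coef F w J p t * ξ (p.1 + 1) p.2 ω :=
  (Filter.eventually_all_finset V).2 fun _ ht => hX.ae_eq_sum (hV ht)

/-- Linear statistics of the sample have second moment bounded by the covariance bound. -/
theorem integral_linear_sq_le (hX : IsLSW P F X w ξ W L C) {J : ℕ} {V : Finset ℤ} {K : ℝ}
    (hV : V ⊆ times J)
    (hK : ∀ y : ℤ → ℝ, ∑ p ∈ innov F J, (∑ t ∈ V, coef F w J p t * y t) ^ 2 ≤
      K * ∑ t ∈ V, y t ^ 2) (y : ℤ → ℝ) :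
    Integrable (fun ω => (∑ t ∈ V, y t * X J t.toNat ω) ^ 2) P ∧
      ∫ ω, (∑ t ∈ V, y t * X J t.toNat ω) ^ 2 ∂P ≤ K * ∑ t ∈ V, y t ^ 2 := by
  have hae : (fun ω => (∑ p ∈ innov F J, (∑ t ∈ V, coef F w J p t * y t) *
      ξ (p.1 + 1) p.2 ω) ^ 2) =ᵐ[P] fun ω => (∑ t ∈ V, y t * X J t.toNat ω) ^ 2 := by
    filter_upwards [hX.ae_forall_eq_sum hV] with ω hω
    congr 1
    simp only [Finset.sum_mul]
    rw [Finset.sum_comm]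
    refine Finset.sum_congr rfl fun t ht => ?_
    rw [hω t ht, Finset.mul_sum]
    exact Finset.sum_congr rfl fun p _ => by ring
  have hiid := hX.isStandardIID
  refine ⟨(hiid.memLp_sum (innov F J) _).integrable_sq.congr hae, ?_⟩
  rw [← integral_congr_ae hae, hiid.integral_sum_sq (innov F J)]
  exact hK y

theorem ae_quadratic_eq (hX : IsLSW P F X w ξ W L C) {J : ℕ} {V : Finset ℤ} (hV : V ⊆ times J)
    (π : ℤ → ℝ) :
    ∀ᵐ ω ∂P, ∑ t ∈ V, ∑ t' ∈ V, π (t - t') * (X J t.toNat ω * X J t'.toNat ω) =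
      ∑ p ∈ innov F J, ∑ q ∈ innov F J, quadCoef F w π V J p q *
        (ξ (p.1 + 1) p.2 ω * ξ (q.1 + 1) q.2 ω) := by
  filter_upwards [hX.ae_forall_eq_sum hV] with ω hω
  calc _ = ∑ t ∈ V, ∑ t' ∈ V, ∑ p ∈ innov F J, ∑ q ∈ innov F J,
        π (t - t') * (coef F w J p t * coef F w J q t') *
          (ξ (p.1 + 1) p.2 ω * ξ (q.1 + 1) q.2 ω) := by
        refine Finset.sum_congr rfl fun t ht => Finset.sum_congr rfl fun t' ht' => ?_
        rw [hω t ht, hω t' ht', Finset.sum_mul_sum, Finset.mul_sum]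
        refine Finset.sum_congr rfl fun p _ => ?_
        rw [Finset.mul_sum]
        exact Finset.sum_congr rfl fun q _ => by ring
    _ = ∑ p ∈ innov F J, ∑ t ∈ V, ∑ t' ∈ V, ∑ q ∈ innov F J,
        π (t - t') * (coef F w J p t * coef F w J q t') *
          (ξ (p.1 + 1) p.2 ω * ξ (q.1 + 1) q.2 ω) := by
        rw [Finset.sum_comm]
        rw [Finset.sum_congr rfl fun t _ => Finset.sum_comm, Finset.sum_comm]
        exact Finset.sum_congr rfl fun p _ => Finset.sum_comm
    _ = _ := by
        refine Finset.sum_congr rfl fun p _ => ?_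
        rw [Finset.sum_congr rfl fun t _ => Finset.sum_comm, Finset.sum_comm]
        refine Finset.sum_congr rfl fun q _ => ?_
        simp only [quadCoef, Finset.sum_mul]

end IsLSW

/-! ### From periodograms to a Toeplitz form: boundary terms -/

namespace QMFilter

variable (F : QMFilter)

/-- The locations at which the wavelets of support radius `r` meet the boundary of
`[m₀ - s, m₀ + s]`. -/
noncomputable def edge (m₀ s r : ℤ) : Finset ℤ :=
  Finset.Icc (m₀ - s - r) (m₀ - s + r) ∪ Finset.Icc (m₀ + s - r) (m₀ + s + r)

theorem card_edge_le (m₀ s : ℤ) (r : ℕ) (hr : 1 ≤ r) : ((edge m₀ s r).card : ℝ) ≤ 6 * r := by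
  have h : (edge m₀ s r).card ≤ 6 * r := by
    refine (Finset.card_union_le _ _).trans ?_
    rw [Int.card_Icc, Int.card_Icc]
    -- Two intervals of 2r + 1 points each, and 4r + 2 ≤ 6r since r ≥ 1.
    omega
  exact_mod_cast h

/-- Summed raw periodograms agree with a quadratic form in the autocorrelation wavelet, up to
boundary terms. -/
theorem abs_sum_sq_sub_form_le (l : ℕ) (m₀ : ℤ) (s : ℕ) {I : Finset ℤ}
    (hI : Finset.Icc (m₀ - s) (m₀ + s) ⊆ I) (x : ℤ → ℝ) :
    |∑ m ∈ Finset.Icc (m₀ - s) (m₀ + (s : ℤ)), (∑ t ∈ I, F.psi l (m - t) * x t) ^ 2 -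
        F.form l (Finset.Icc (m₀ - s) (m₀ + s)) x| ≤
      ∑ m ∈ edge m₀ s (F.radius * 2 ^ l : ℕ), ((∑ t ∈ I, F.psi l (m - t) * x t) ^ 2 +
        (∑ t ∈ Finset.Icc (m₀ - (s : ℤ)) (m₀ + s), F.psi l (m - t) * x t) ^ 2) := by
  set r : ℕ := F.radius * 2 ^ l with hr
  have hsupp : ∀ k, F.psi l k ≠ 0 → |k| ≤ r := fun k hk => by
    have := F.abs_le_of_psi_ne_zero hk
    rw [hr]; push_cast; exact this
  set V := Finset.Icc (m₀ - (s : ℤ)) (m₀ + s) with hV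
  set U := Finset.Icc (m₀ - s - (r : ℤ)) (m₀ + s + r) with hU
  set G := edge m₀ s r with hG
  set f : ℤ → ℝ := fun m => (∑ t ∈ I, F.psi l (m - t) * x t) ^ 2 with hf
  set g : ℤ → ℝ := fun m => (∑ t ∈ V, F.psi l (m - t) * x t) ^ 2 with hg
  have hVU : V ⊆ U := Finset.Icc_subset_Icc (by omega) (by omega)
  have hGU : G ⊆ U := Finset.union_subset (Finset.Icc_subset_Icc (by omega) (by omega))
    (Finset.Icc_subset_Icc (by omega) (by omega))
  have hform : F.form l V x = ∑ m ∈ U, g m := by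
    rw [form, ← F.sum_sq_eq_sum_Psi x fun t ht k hk => ?_]
    have h1 := abs_le.1 (hsupp _ hk)
    have h2 := Finset.mem_Icc.1 ht
    exact Finset.mem_Icc.2 ⟨by omega, by omega⟩
  have hfV : ∑ m ∈ V, f m = ∑ m ∈ U, if m ∈ V then f m else 0 := by
    rw [Finset.sum_ite_mem, Finset.inter_eq_right.2 hVU]
  have hGs : ∑ m ∈ G, (f m + g m) = ∑ m ∈ U, if m ∈ G then f m + g m else 0 := by
    rw [Finset.sum_ite_mem, Finset.inter_eq_right.2 hGU]
  show |∑ m ∈ V, f m - F.form l V x| ≤ ∑ m ∈ G, (f m + g m)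
  rw [hform, hfV, hGs, ← Finset.sum_sub_distrib]
  refine (Finset.abs_sum_le_sum_abs _ _).trans (Finset.sum_le_sum fun m hm => ?_)
  have hf0 : 0 ≤ f m := sq_nonneg _
  have hg0 : 0 ≤ g m := sq_nonneg _
  by_cases hmG : m ∈ G
  · rw [if_pos hmG, abs_le]
    split_ifs <;> constructor <;> linarith
  · rw [if_neg hmG]
    rw [hG, edge, Finset.mem_union, Finset.mem_Icc, Finset.mem_Icc] at hmG
    rw [hU, Finset.mem_Icc] at hm
    -- Off the edge, a location in the enlarged window is deep inside it and its wavelet lives on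
    -- the window, so filtering the whole sample or only the window is the same.
    have hmV : m ∈ V := Finset.mem_Icc.2 ⟨by omega, by omega⟩
    have hfg : f m = g m := by
      simp only [hf, hg]
      congr 1
      refine (Finset.sum_subset hI fun t _ ht => ?_).symm
      have : F.psi l (m - t) = 0 := by
        by_contra h
        have h1 := abs_le.1 (hsupp _ h)
        refine ht (Finset.mem_Icc.2 ⟨by omega, by omega⟩)
      rw [this, zero_mul]
    rw [if_pos hmV, hfg, sub_self, abs_zero]

theorem sum_weights_mul_form {n : ℕ} (x : Fin n → ℝ) (V : Finset ℤ) (y : ℤ → ℝ) :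
    ∑ l : Fin n, x l * F.form (l + 1) V y =
      ∑ t ∈ V, ∑ t' ∈ V, F.comb x (t - t') * (y t * y t') := by
  simp only [form, comb, Finset.mul_sum, Finset.sum_mul]
  rw [Finset.sum_comm]
  refine Finset.sum_congr rfl fun t _ => ?_
  rw [Finset.sum_comm]
  exact Finset.sum_congr rfl fun t' _ => Finset.sum_congr rfl fun l _ => by ring

end QMFilter

theorem sum_range_eq_sum_times (J : ℕ) (f : ℕ → ℝ) :
    ∑ t ∈ Finset.range (2 ^ J), f t = ∑ t ∈ times J, f t.toNat := by
  refine Finset.sum_bij' (fun t _ => (t : ℤ)) (fun t _ => t.toNat) ?_ ?_ ?_ ?_ ?_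
  · intro t ht
    rw [mem_times]
    exact ⟨by omega, by exact_mod_cast Finset.mem_range.1 ht⟩
  · intro t ht
    rw [mem_times] at ht
    rw [Finset.mem_range]
    have h := ht.2
    rw [← Int.toNat_of_nonneg ht.1] at h
    exact_mod_cast h
  · simp
  · intro t ht
    exact Int.toNat_of_nonneg (mem_times.1 ht).1
  · simp

theorem smoothPeriodogram_eq (F : QMFilter) (J s l : ℕ) (x : ℕ → ℝ) (u : ℝ) {m₀ : ℤ}
    (hm₀ : ⌊u * 2 ^ J⌋ = m₀) :
    smoothPeriodogram F (2 ^ J) s x l u = (2 * (s : ℝ) + 1)⁻¹ *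
      ∑ m ∈ Finset.Icc (m₀ - (s : ℤ)) (m₀ + s),
        (∑ t ∈ times J, F.psi l (m - t) * x t.toNat) ^ 2 := by
  rw [smoothPeriodogram]
  push_cast
  rw [hm₀]
  congr 1
  refine Finset.sum_congr rfl fun m _ => ?_
  rw [periodogram, sum_range_eq_sum_times J fun t => x t * F.wav l m t]
  congr 1
  refine Finset.sum_congr rfl fun t ht => ?_
  rw [QMFilter.wav, Int.toNat_of_nonneg (mem_times.1 ht).1, mul_comm]

namespace IsLSW

variable {Ω : Type*} [MeasurableSpace Ω] {P : Measure Ω}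
  {F : QMFilter} {X : ℕ → ℕ → Ω → ℝ}
  {w : ℕ → ℕ → ℤ → ℝ} {ξ : ℕ → ℤ → Ω → ℝ} {W : ℕ → ℝ → ℝ} {L C : ℕ → ℝ} {z : ℝ}

/-- In mean, the estimator is a Toeplitz quadratic form of the sample up to boundary terms. -/
theorem integral_abs_autocovHat_sub_le (hX : IsLSW P F X w ξ W L C) {J s n : ℕ} {K u : ℝ}
    {m₀ : ℤ} (hK0 : 0 ≤ K) (hm₀ : ⌊u * 2 ^ J⌋ = m₀)
    (hV : Finset.Icc (m₀ - (s : ℤ)) (m₀ + s) ⊆ times J)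
    (hK : ∀ y : ℤ → ℝ, ∑ p ∈ innov F J, (∑ t ∈ times J, coef F w J p t * y t) ^ 2 ≤
      K * ∑ t ∈ times J, y t ^ 2) (τ : ℤ) :
    Integrable (fun ω => autocovHat F (2 ^ J) s n (fun t => X J t ω) u τ) P ∧
    ∫ ω, |autocovHat F (2 ^ J) s n (fun t => X J t ω) u τ - (2 * (s : ℝ) + 1)⁻¹ *
        ∑ t ∈ Finset.Icc (m₀ - (s : ℤ)) (m₀ + s), ∑ t' ∈ Finset.Icc (m₀ - (s : ℤ)) (m₀ + s),
          F.comb (F.weights n τ) (t - t') * (X J t.toNat ω * X J t'.toNat ω)| ∂P ≤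
      24 * F.radius * K * (2 ^ n * Real.sqrt (F.normInvA n) / (2 * (s : ℝ) + 1)) := by
  set V := Finset.Icc (m₀ - (s : ℤ)) (m₀ + s) with hVdef
  set x := F.weights n τ with hx
  set N : ℝ := 2 * (s : ℝ) + 1 with hN
  have hN0 : 0 < N := by positivity
  have hlinI : ∀ l m, Integrable (fun ω =>
      (∑ t ∈ times J, F.psi l (m - t) * X J t.toNat ω) ^ 2) P ∧
      ∫ ω, (∑ t ∈ times J, F.psi l (m - t) * X J t.toNat ω) ^ 2 ∂P ≤ K := fun l m => by
    obtain ⟨h1, h2⟩ := hX.integral_linear_sq_le subset_rfl hK fun t => F.psi l (m - t)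
    exact ⟨h1, h2.trans (mul_le_of_le_one_right hK0 (F.sum_psi_reflect_sq_le l m _))⟩
  have hlinV : ∀ l m, Integrable (fun ω =>
      (∑ t ∈ V, F.psi l (m - t) * X J t.toNat ω) ^ 2) P ∧
      ∫ ω, (∑ t ∈ V, F.psi l (m - t) * X J t.toNat ω) ^ 2 ∂P ≤ K := fun l m => by
    obtain ⟨h1, h2⟩ := hX.integral_linear_sq_le hV (sum_coef_mul_sq_le hK hV)
      fun t => F.psi l (m - t)
    exact ⟨h1, h2.trans (mul_le_of_le_one_right hK0 (F.sum_psi_reflect_sq_le l m _))⟩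
  have hform : ∀ ω, autocovHat F (2 ^ J) s n (fun t => X J t ω) u τ = N⁻¹ *
      ∑ l : Fin n, x l * ∑ m ∈ V,
        (∑ t ∈ times J, F.psi (l + 1) (m - t) * X J t.toNat ω) ^ 2 := fun ω => by
    rw [F.autocovHat_eq, Finset.mul_sum]
    refine Finset.sum_congr rfl fun l _ => ?_
    rw [smoothPeriodogram_eq F J s (l + 1) _ u hm₀]
    ring
  have hint : Integrable (fun ω => autocovHat F (2 ^ J) s n (fun t => X J t ω) u τ) P := by
    simp only [hform]
    exact (integrable_finsetSum _ fun l _ =>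
      (integrable_finsetSum _ fun m _ => (hlinI _ m).1).const_mul _).const_mul _
  refine ⟨hint, ?_⟩
  set B : Fin n → Ω → ℝ := fun l ω =>
    ∑ m ∈ QMFilter.edge m₀ s (F.radius * 2 ^ (l + 1 : ℕ) : ℕ),
      ((∑ t ∈ times J, F.psi (l + 1) (m - t) * X J t.toNat ω) ^ 2 +
        (∑ t ∈ V, F.psi (l + 1) (m - t) * X J t.toNat ω) ^ 2) with hB
  have hBi : ∀ l, Integrable (B l) P := fun l =>
    integrable_finsetSum _ fun m _ => (hlinI _ m).1.add (hlinV _ m).1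
  -- There are at most 6 · radius · 2^(l+1) edge locations, each with two squares of mean at most K,
  -- because a wavelet has norm at most 1.
  have hBE : ∀ l, ∫ ω, B l ω ∂P ≤ 12 * F.radius * K * 2 ^ (l + 1 : ℕ) := fun l => by
    have h0 : ∀ m ∈ QMFilter.edge m₀ s (F.radius * 2 ^ (l + 1 : ℕ) : ℕ), Integrable (fun ω =>
        (∑ t ∈ times J, F.psi (l + 1) (m - t) * X J t.toNat ω) ^ 2 +
        (∑ t ∈ V, F.psi (l + 1) (m - t) * X J t.toNat ω) ^ 2) P :=
      fun m _ => (hlinI _ m).1.add (hlinV _ m).1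
    rw [integral_finsetSum _ h0]
    have h1 : ∀ m ∈ QMFilter.edge m₀ s (F.radius * 2 ^ (l + 1 : ℕ) : ℕ),
        ∫ ω, ((∑ t ∈ times J, F.psi (l + 1) (m - t) * X J t.toNat ω) ^ 2 +
        (∑ t ∈ V, F.psi (l + 1) (m - t) * X J t.toNat ω) ^ 2) ∂P ≤ 2 * K := fun m _ => by
      rw [integral_add (hlinI _ m).1 (hlinV _ m).1]
      linarith [(hlinI (l + 1) m).2, (hlinV (l + 1) m).2]
    refine (Finset.sum_le_card_nsmul _ _ _ h1).trans ?_
    rw [nsmul_eq_mul]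
    have h2 := QMFilter.card_edge_le m₀ s (F.radius * 2 ^ (l + 1 : ℕ))
      (Nat.mul_pos F.one_le_radius (by positivity))
    refine (mul_le_mul_of_nonneg_right h2 (by positivity)).trans (le_of_eq ?_)
    push_cast; ring
  have hpt : ∀ ω, |autocovHat F (2 ^ J) s n (fun t => X J t ω) u τ - N⁻¹ *
      ∑ t ∈ V, ∑ t' ∈ V, F.comb x (t - t') * (X J t.toNat ω * X J t'.toNat ω)| ≤
      N⁻¹ * ∑ l, |x l| * B l ω := fun ω => by
    rw [hform, ← F.sum_weights_mul_form x V fun t => X J t.toNat ω, ← mul_sub,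
      ← Finset.sum_sub_distrib, abs_mul, abs_of_pos (inv_pos.2 hN0)]
    refine mul_le_mul_of_nonneg_left ?_ (inv_pos.2 hN0).le
    refine (Finset.abs_sum_le_sum_abs _ _).trans (Finset.sum_le_sum fun l _ => ?_)
    rw [← mul_sub, abs_mul]
    exact mul_le_mul_of_nonneg_left (F.abs_sum_sq_sub_form_le (l + 1) m₀ s hV _) (abs_nonneg _)
  have hRi : Integrable (fun ω => N⁻¹ * ∑ l, |x l| * B l ω) P :=
    (integrable_finsetSum _ fun l _ => (hBi l).const_mul _).const_mul _
  refine (integral_mono_of_nonneg (ae_of_all _ fun _ => abs_nonneg _) hRi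
    (ae_of_all _ hpt)).trans ?_
  rw [integral_const_mul, integral_finsetSum _ fun l _ => (hBi l).const_mul _]
  simp only [integral_const_mul]
  have h1 : ∑ l, |x l| * ∫ ω, B l ω ∂P ≤
      12 * F.radius * K * ∑ l : Fin n, |x l| * 2 ^ (l + 1 : ℕ) := by
    rw [Finset.mul_sum]
    refine Finset.sum_le_sum fun l _ => ?_
    refine (mul_le_mul_of_nonneg_left (hBE l) (abs_nonneg _)).trans (le_of_eq ?_)
    ring
  have h2 := F.sum_abs_weights_mul_two_pow_le n τ
  rw [← hx] at h2
  have h3 : (0 : ℝ) ≤ 12 * F.radius * K := by positivity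
  have h4 := h1.trans (mul_le_mul_of_nonneg_left h2 h3)
  refine (mul_le_mul_of_nonneg_left h4 (inv_pos.2 hN0).le).trans (le_of_eq ?_)
  rw [div_eq_mul_inv]; ring

end IsLSW

/-! ### The expected form at a single scale -/

namespace QMFilter

variable (F : QMFilter)

/-- A row farther than the support radius of Ψ_j from both ends sees all of Ψ_j and sums to exactly
v. The number of remaining rows and their errors do not depend on the window length. -/
theorem abs_sum_toeplitz_sub_le {j : ℕ} {π : ℤ → ℝ} (hπ : ∀ a, |π a| ≤ 1) {v : ℝ} (hv : |v| ≤ 1)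
    (hπv : ∀ S : Finset ℤ, (∀ a, F.Psi j a ≠ 0 → a ∈ S) → ∑ a ∈ S, F.Psi j a * π a = v)
    (m₀ : ℤ) (s : ℕ) :
    |∑ t ∈ Finset.Icc (m₀ - (s : ℤ)) (m₀ + s), ∑ t' ∈ Finset.Icc (m₀ - (s : ℤ)) (m₀ + s),
        F.Psi j (t - t') * π (t - t') - (Finset.Icc (m₀ - (s : ℤ)) (m₀ + s)).card * v| ≤
      2 * (2 * (F.radius * 2 ^ j) + 1) * (4 * (F.radius * 2 ^ j) + 2) := by
  set V := Finset.Icc (m₀ - (s : ℤ)) (m₀ + s) with hV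
  set ρ : ℕ := 2 * (F.radius * 2 ^ j) with hρ
  have hsupp : ∀ a, F.Psi j a ≠ 0 → |a| ≤ ρ := fun a ha => by
    have := F.abs_le_of_Psi_ne_zero ha
    rw [hρ]; push_cast; exact this
  set G := Finset.Icc (m₀ - (s : ℤ)) (m₀ - s + ρ) ∪ Finset.Icc (m₀ + (s : ℤ) - ρ) (m₀ + s) with hG
  have hGcard : (G.card : ℝ) ≤ 2 * (2 * (F.radius * 2 ^ j) + 1) := by
    have : G.card ≤ 2 * (ρ + 1) := by
      refine (Finset.card_union_le _ _).trans ?_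
      rw [Int.card_Icc, Int.card_Icc]
      omega
    have h2 : (G.card : ℝ) ≤ ((2 * (ρ + 1) : ℕ) : ℝ) := by exact_mod_cast this
    refine h2.trans (le_of_eq ?_)
    rw [hρ]; push_cast; ring
  have hb0 : (0 : ℝ) ≤ 4 * (F.radius * 2 ^ j) + 2 := by positivity
  have hpt : ∀ t ∈ V, |∑ t' ∈ V, F.Psi j (t - t') * π (t - t') - v| ≤
      if t ∈ G then 4 * ((F.radius : ℝ) * 2 ^ j) + 2 else 0 := fun t ht => by
    split_ifs with htG
    · have h1 : |∑ t' ∈ V, F.Psi j (t - t') * π (t - t')| ≤ 4 * (F.radius * 2 ^ j) + 1 := by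
        refine (Finset.abs_sum_le_sum_abs _ _).trans (le_trans ?_ (F.sum_abs_Psi_le j t V))
        refine Finset.sum_le_sum fun t' _ => ?_
        rw [abs_mul]
        exact mul_le_of_le_one_right (abs_nonneg _) (hπ _)
      refine (abs_sub _ _).trans ?_
      linarith
    · have hmem : ∀ a, F.Psi j a ≠ 0 → a ∈ V.map (Equiv.subLeft t).toEmbedding := fun a ha => by
        have h1 := abs_le.1 (hsupp a ha)
        rw [hG, Finset.mem_union, Finset.mem_Icc, Finset.mem_Icc] at htG
        rw [hV, Finset.mem_Icc] at ht
        refine Finset.mem_map.2 ⟨t - a, Finset.mem_Icc.2 ⟨by omega, by omega⟩, ?_⟩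
        simp
      have h2 := hπv _ hmem
      rw [Finset.sum_map] at h2
      simp only [Equiv.coe_toEmbedding, Equiv.subLeft_apply] at h2
      rw [h2, sub_self, abs_zero]
  rw [← nsmul_eq_mul, ← Finset.sum_const, ← Finset.sum_sub_distrib]
  refine (Finset.abs_sum_le_sum_abs _ _).trans ((Finset.sum_le_sum hpt).trans ?_)
  rw [Finset.sum_ite_mem, Finset.sum_const, nsmul_eq_mul]
  refine mul_le_mul_of_nonneg_right (le_trans ?_ hGcard) hb0
  exact_mod_cast Finset.card_le_card Finset.inter_subset_right

end QMFilter

/-- Freezing the squared amplitudes at σ costs δ times the absolute sums of the wavelet, at most R²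
per observation. What remains is σ times the Toeplitz sum of Ψ_j π. -/
theorem abs_sum_quadCoef_scale_sub_le {F : QMFilter} {w : ℕ → ℕ → ℤ → ℝ} {J j : ℕ} (hj : j < J)
    {π : ℤ → ℝ} (hπ : ∀ a, |π a| ≤ 1) {v : ℝ} (hv : |v| ≤ 1)
    (hπv : ∀ S : Finset ℤ, (∀ a, F.Psi (j + 1) a ≠ 0 → a ∈ S) →
      ∑ a ∈ S, F.Psi (j + 1) a * π a = v) {m₀ : ℤ} {s : ℕ}
    (hV : Finset.Icc (m₀ - (s : ℤ)) (m₀ + s) ⊆ times J) {σ δ : ℝ} (hσ : 0 ≤ σ) (hδ0 : 0 ≤ δ)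
    (hδ : ∀ k, ∀ t ∈ Finset.Icc (m₀ - (s : ℤ)) (m₀ + s), F.psi (j + 1) (k - t) ≠ 0 →
      |w J (j + 1) k ^ 2 - σ| ≤ δ) :
    |∑ k ∈ locs F J, quadCoef F w π (Finset.Icc (m₀ - (s : ℤ)) (m₀ + s)) J (j, k) (j, k) -
        (2 * (s : ℝ) + 1) * (σ * v)| ≤
      (2 * (s : ℝ) + 1) * (δ * (2 * (F.radius * 2 ^ (j + 1)) + 1) ^ 2) +
        σ * (2 * (2 * (F.radius * 2 ^ (j + 1)) + 1) * (4 * (F.radius * 2 ^ (j + 1)) + 2)) := by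
  have hT := F.abs_sum_toeplitz_sub_le hπ hv hπv m₀ s
  have hcard : ((Finset.Icc (m₀ - (s : ℤ)) (m₀ + s)).card : ℝ) = 2 * (s : ℝ) + 1 := by
    have : (Finset.Icc (m₀ - (s : ℤ)) (m₀ + s)).card = 2 * s + 1 := by
      rw [Int.card_Icc]; omega
    rw [this]; push_cast; ring
  rw [hcard] at hT
  set V := Finset.Icc (m₀ - (s : ℤ)) (m₀ + s) with hVdef
  set R : ℝ := 2 * (F.radius * 2 ^ (j + 1)) + 1 with hR
  have hR0 : 0 ≤ R := by positivity
  set Q := ∑ t ∈ V, ∑ t' ∈ V, F.Psi (j + 1) (t - t') * π (t - t') with hQ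
  have hQ' : σ * Q = ∑ k ∈ locs F J, ∑ t ∈ V, ∑ t' ∈ V,
      π (t - t') * (σ * (F.psi (j + 1) (k - t) * F.psi (j + 1) (k - t'))) := by
    rw [Finset.sum_comm, hQ, Finset.mul_sum]
    refine Finset.sum_congr rfl fun t ht => ?_
    rw [Finset.sum_comm, Finset.mul_sum]
    refine Finset.sum_congr rfl fun t' _ => ?_
    rw [F.Psi_sub_eq_sum fun k hk => mem_locs_of_psi_ne_zero hj (hV ht) hk, Finset.sum_mul,
      Finset.mul_sum]
    exact Finset.sum_congr rfl fun k _ => by ring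
  have hmain : |∑ k ∈ locs F J, quadCoef F w π V J (j, k) (j, k) - σ * Q| ≤
      (2 * (s : ℝ) + 1) * (δ * R ^ 2) := by
    rw [hQ', ← Finset.sum_sub_distrib]
    calc _ ≤ ∑ k ∈ locs F J, ∑ t ∈ V, ∑ t' ∈ V,
          δ * (|F.psi (j + 1) (k - t)| * |F.psi (j + 1) (k - t')|) := by
          refine (Finset.abs_sum_le_sum_abs _ _).trans (Finset.sum_le_sum fun k _ => ?_)
          rw [quadCoef, ← Finset.sum_sub_distrib]
          refine (Finset.abs_sum_le_sum_abs _ _).trans (Finset.sum_le_sum fun t ht => ?_)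
          rw [← Finset.sum_sub_distrib]
          refine (Finset.abs_sum_le_sum_abs _ _).trans (Finset.sum_le_sum fun t' _ => ?_)
          have e : π (t - t') * (coef F w J (j, k) t * coef F w J (j, k) t') -
              π (t - t') * (σ * (F.psi (j + 1) (k - t) * F.psi (j + 1) (k - t'))) =
              π (t - t') * ((w J (j + 1) k ^ 2 - σ) *
                (F.psi (j + 1) (k - t) * F.psi (j + 1) (k - t'))) := by
            simp only [coef]; ring
          rw [e, abs_mul, abs_mul, abs_mul]
          refine (mul_le_of_le_one_left (by positivity) (hπ _)).trans ?_
          by_cases h0 : F.psi (j + 1) (k - t) = 0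
          · simp [h0]
          · exact mul_le_mul_of_nonneg_right (hδ k t ht h0) (by positivity)
      _ = ∑ t ∈ V, ∑ k ∈ locs F J,
          δ * |F.psi (j + 1) (k - t)| * ∑ t' ∈ V, |F.psi (j + 1) (k - t')| := by
          rw [Finset.sum_comm]
          refine Finset.sum_congr rfl fun t _ => Finset.sum_congr rfl fun k _ => ?_
          rw [Finset.mul_sum]
          exact Finset.sum_congr rfl fun t' _ => by ring
      _ ≤ ∑ t ∈ V, δ * R ^ 2 := by
          refine Finset.sum_le_sum fun t _ => ?_
          calc _ ≤ ∑ k ∈ locs F J, δ * |F.psi (j + 1) (k - t)| * R :=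
                Finset.sum_le_sum fun k _ => mul_le_mul_of_nonneg_left
                  (F.sum_abs_psi_reflect_le (j + 1) k V) (by positivity)
            _ = δ * R * ∑ k ∈ locs F J, |F.psi (j + 1) (k - t)| := by
                rw [Finset.mul_sum]
                exact Finset.sum_congr rfl fun k _ => by ring
            _ ≤ δ * R * R := mul_le_mul_of_nonneg_left
                (F.sum_abs_psi_shift_le (j + 1) t _) (by positivity)
            _ = _ := by ring
      _ = _ := by rw [Finset.sum_const, nsmul_eq_mul, hcard]
  have e : ∑ k ∈ locs F J, quadCoef F w π V J (j, k) (j, k) - (2 * (s : ℝ) + 1) * (σ * v) =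
      (∑ k ∈ locs F J, quadCoef F w π V J (j, k) (j, k) - σ * Q) +
        σ * (Q - (2 * (s : ℝ) + 1) * v) := by ring
  rw [e]
  refine (abs_add_le _ _).trans (add_le_add hmain ?_)
  rw [abs_mul, abs_of_nonneg hσ]
  exact mul_le_mul_of_nonneg_left hT hσ

/-! ### The smoothing window and convergence of the estimator in mean -/

section Window

variable {s : ℕ → ℕ} {u : ℕ → ℝ} {z K : ℝ}

/-- The smoothing window around `[uT]`, `T = 2^J`. -/
noncomputable def window (s : ℕ → ℕ) (u : ℕ → ℝ) (J : ℕ) : Finset ℤ :=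
  Finset.Icc (⌊u J * 2 ^ J⌋ - (s J : ℤ)) (⌊u J * 2 ^ J⌋ + s J)

theorem card_window (J : ℕ) : ((window s u J).card : ℝ) = 2 * (s J : ℝ) + 1 := by
  have : (window s u J).card = 2 * s J + 1 := by
    rw [window, Int.card_Icc]; omega
  rw [this]; push_cast; ring

theorem abs_div_sub_le_of_mem_window (hu : ∀ J, |u J - z| ≤ K / 2 ^ J) {J : ℕ} {t : ℤ}
    (ht : t ∈ window s u J) : |(t : ℝ) / 2 ^ J - z| ≤ s J / 2 ^ J + (1 + K) / 2 ^ J := by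
  have hT : (0 : ℝ) < 2 ^ J := by positivity
  have h1 := Int.floor_le (u J * 2 ^ J)
  have h2 := Int.lt_floor_add_one (u J * 2 ^ J)
  have ht' := Finset.mem_Icc.1 ht
  have h3 : ((⌊u J * 2 ^ J⌋ : ℤ) : ℝ) - s J ≤ t := by exact_mod_cast ht'.1
  have h4 : (t : ℝ) ≤ (⌊u J * 2 ^ J⌋ : ℤ) + s J := by exact_mod_cast ht'.2
  have e : (t : ℝ) / 2 ^ J - z = (t - u J * 2 ^ J) / 2 ^ J + (u J - z) := by
    field_simp; ring
  have h5 : |(t - u J * 2 ^ J) / 2 ^ J| ≤ (s J + 1) / 2 ^ J := by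
    rw [abs_div, abs_of_pos hT]
    refine div_le_div_of_nonneg_right ?_ hT.le
    rw [abs_le]; constructor <;> linarith
  rw [e]
  refine (abs_add_le _ _).trans ((add_le_add h5 (hu J)).trans (le_of_eq ?_))
  ring

theorem tendsto_const_div_two_pow (c : ℝ) : Tendsto (fun J : ℕ => c / 2 ^ J) atTop (𝓝 0) :=
  tendsto_const_nhds.div_atTop (tendsto_pow_atTop_atTop_of_one_lt (by norm_num))

theorem mem_times_of_abs_lt {J : ℕ} {t : ℤ} {η : ℝ} (hη : η ≤ min z (1 - z))
    (ht : |(t : ℝ) / 2 ^ J - z| < η) : t ∈ times J := by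
  have hT : (0 : ℝ) < 2 ^ J := by positivity
  have h1 := hη.trans (min_le_left _ _)
  have h2 := hη.trans (min_le_right _ _)
  rw [abs_lt] at ht
  have h3 : 0 < (t : ℝ) / 2 ^ J := by linarith
  have h4 : (t : ℝ) / 2 ^ J < 1 := by linarith
  rw [div_lt_one hT] at h4
  have h5 : 0 < (t : ℝ) := by
    have := mul_pos h3 hT
    rwa [div_mul_cancel₀ _ hT.ne'] at this
  rw [mem_times]
  exact ⟨by exact_mod_cast h5.le, by exact_mod_cast h4⟩

theorem eventually_window_subset (hz : z ∈ Set.Ioo (0 : ℝ) 1)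
    (hsT : Tendsto (fun J => (s J : ℝ) / 2 ^ J) atTop (𝓝 0))
    (hu : ∀ J, |u J - z| ≤ K / 2 ^ J) : ∀ᶠ J in atTop, window s u J ⊆ times J := by
  have hlim : Tendsto (fun J => (s J : ℝ) / 2 ^ J + (1 + K) / 2 ^ J) atTop (𝓝 0) := by
    simpa using hsT.add (tendsto_const_div_two_pow (1 + K))
  have hpos : 0 < min z (1 - z) := lt_min hz.1 (sub_pos.2 hz.2)
  filter_upwards [hlim.eventually (gt_mem_nhds hpos)] with J hJ t ht
  exact mem_times_of_abs_lt le_rfl ((abs_div_sub_le_of_mem_window hu ht).trans_lt hJ)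

end Window

namespace IsLSW

variable {Ω : Type*} [MeasurableSpace Ω] {P : Measure Ω}
  {F : QMFilter} {X : ℕ → ℕ → Ω → ℝ}
  {w : ℕ → ℕ → ℤ → ℝ} {ξ : ℕ → ℤ → Ω → ℝ} {W : ℕ → ℝ → ℝ} {L C : ℕ → ℝ} {z K : ℝ}
  {s n : ℕ → ℕ} {u : ℕ → ℝ}

/-- At a fixed scale, the squared amplitudes that are felt in the window approach the spectrum. -/
theorem eventually_abs_amplitude_sq_sub_le (hX : IsLSW P F X w ξ W L C)
    (hz : z ∈ Set.Ioo (0 : ℝ) 1)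
    (hsT : Tendsto (fun J => (s J : ℝ) / 2 ^ J) atTop (𝓝 0))
    (hu : ∀ J, |u J - z| ≤ K / 2 ^ J) (j : ℕ) {δ : ℝ} (hδ : 0 < δ) :
    ∀ᶠ J in atTop, ∀ k, ∀ t ∈ window s u J, F.psi (j + 1) (k - t) ≠ 0 →
      |w J (j + 1) k ^ 2 - spec W (j + 1) z| ≤ δ := by
  set c : ℝ := F.radius * 2 ^ (j + 1) with hc
  set r : ℕ → ℝ := fun J => (s J : ℝ) / 2 ^ J + (1 + K) / 2 ^ J + c / 2 ^ J with hr
  have hrlim : Tendsto r atTop (𝓝 0) := by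
    simpa using (hsT.add (tendsto_const_div_two_pow (1 + K))).add (tendsto_const_div_two_pow c)
  set d : ℕ → ℝ := fun J => L (j + 1) * r J + C (j + 1) / 2 ^ J with hd
  have hdlim : Tendsto d atTop (𝓝 0) := by
    simpa using (hrlim.const_mul (L (j + 1))).add (tendsto_const_div_two_pow (C (j + 1)))
  have hlim : Tendsto (fun J => d J * (2 * |W (j + 1) z| + d J)) atTop (𝓝 0) := by
    simpa using hdlim.mul (tendsto_const_nhds.add hdlim)
  have hpos : 0 < min z (1 - z) := lt_min hz.1 (sub_pos.2 hz.2)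
  filter_upwards [hrlim.eventually (gt_mem_nhds hpos), hlim.eventually (gt_mem_nhds hδ),
    eventually_gt_atTop j] with J hJ1 hJ2 hJ3 k t ht hk
  have hT : (0 : ℝ) < 2 ^ J := by positivity
  have h1 : |(k : ℝ) / 2 ^ J - z| ≤ r J := by
    have e : (k : ℝ) / 2 ^ J - z = (t / 2 ^ J - z) + (k - t) / 2 ^ J := by ring
    have h2 : |(k - t : ℝ)| ≤ F.radius * 2 ^ (j + 1) := by
      exact_mod_cast F.abs_le_of_psi_ne_zero hk
    rw [← hc] at h2
    rw [e]
    refine (abs_add_le _ _).trans (add_le_add (abs_div_sub_le_of_mem_window hu ht) ?_)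
    rw [abs_div, abs_of_pos hT]
    exact div_le_div_of_nonneg_right h2 hT.le
  -- Since z is interior, such a location eventually lies in {0, …, T-1}, which excludes the omitted
  -- locations.
  have hkT := mem_times_of_abs_lt le_rfl (h1.trans_lt hJ1)
  have h3 : |w J (j + 1) k - W (j + 1) (k / 2 ^ J)| ≤ C (j + 1) / 2 ^ J := by
    rcases hX.close J (j + 1) (by omega) hJ3 k with h | h
    · exact h
    · exact absurd (by simpa [mem_times] using hkT) h.1
  have h4 := (hX.lipschitz (j + 1) (by omega) (k / 2 ^ J) z).trans
    (mul_le_mul_of_nonneg_left h1 (hX.L_nonneg j))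
  have h5 : |w J (j + 1) k - W (j + 1) z| ≤ d J := by
    have e : w J (j + 1) k - W (j + 1) z = (W (j + 1) (k / 2 ^ J) - W (j + 1) z) +
      (w J (j + 1) k - W (j + 1) (k / 2 ^ J)) := by ring
    rw [e]
    exact (abs_add_le _ _).trans (add_le_add h4 h3)
  have h6 : |w J (j + 1) k + W (j + 1) z| ≤ 2 * |W (j + 1) z| + d J := by
    have e : w J (j + 1) k + W (j + 1) z = (w J (j + 1) k - W (j + 1) z) +
      2 * W (j + 1) z := by ring
    rw [e]
    refine (abs_add_le _ _).trans ?_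
    rw [abs_mul, abs_two]; linarith
  have e : w J (j + 1) k ^ 2 - spec W (j + 1) z =
      (w J (j + 1) k - W (j + 1) z) * (w J (j + 1) k + W (j + 1) z) := by
    rw [spec]; ring
  rw [e, abs_mul]
  exact (mul_le_mul h5 h6 (abs_nonneg _) ((abs_nonneg _).trans h5)).trans hJ2.le

/-- At a fixed scale, the expected quadratic form per observation converges. -/
theorem tendsto_scale (hX : IsLSW P F X w ξ W L C)
    (hz : z ∈ Set.Ioo (0 : ℝ) 1) (hs : Tendsto s atTop atTop)
    (hsT : Tendsto (fun J => (s J : ℝ) / 2 ^ J) atTop (𝓝 0)) (hn : Tendsto n atTop atTop)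
    (hu : ∀ J, |u J - z| ≤ K / 2 ^ J) (τ : ℤ) (j : ℕ) :
    Tendsto (fun J => (2 * (s J : ℝ) + 1)⁻¹ * ∑ k ∈ locs F J,
      quadCoef F w (F.comb (F.weights (n J) τ)) (window s u J) J (j, k) (j, k)) atTop
      (𝓝 (spec W (j + 1) z * F.Psi (j + 1) τ)) := by
  rw [Metric.tendsto_atTop']
  intro ε hε
  set R : ℝ := 2 * (F.radius * 2 ^ (j + 1)) + 1 with hR
  have hR0 : 0 < R := by positivity
  set E : ℝ := spec W (j + 1) z * (2 * R * (4 * (F.radius * 2 ^ (j + 1)) + 2)) with hE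
  have hNlim : Tendsto (fun J => 2 * (s J : ℝ) + 1) atTop atTop :=
    tendsto_atTop_add_const_right _ _
      ((tendsto_natCast_atTop_atTop.comp hs).const_mul_atTop (by norm_num))
  have hElim : Tendsto (fun J => E / (2 * (s J : ℝ) + 1)) atTop (𝓝 0) :=
    tendsto_const_nhds.div_atTop hNlim
  -- The amplitude error then costs ε/2 per observation; the boundary error `E` is fixed and is
  -- divided by the window length.
  have hδ : 0 < ε / (2 * R ^ 2) := by positivity
  have hev := ((hX.eventually_abs_amplitude_sq_sub_le hz hsT hu j hδ).and
    ((eventually_window_subset hz hsT hu).and ((hElim.eventually (gt_mem_nhds (half_pos hε))).and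
      ((hn.eventually (eventually_gt_atTop j)).and (eventually_gt_atTop j)))))
  obtain ⟨J₀, hJ₀⟩ := eventually_atTop.1 hev
  refine ⟨J₀, fun J hJ => ?_⟩
  obtain ⟨h1, h2, h3, h4, h5⟩ := hJ₀ J hJ.le
  have hN : 0 < 2 * (s J : ℝ) + 1 := by positivity
  have hb := abs_sum_quadCoef_scale_sub_le (F := F) (w := w) (J := J) h5
    (F.abs_comb_weights_le (n J) τ) (F.abs_Psi_le_one (j + 1) τ)
    (fun S hS => F.sum_Psi_mul_comb_weights h4 τ hS) h2 (spec_nonneg (W := W) (j + 1) z) hδ.le h1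
  rw [Real.dist_eq]
  set B := ∑ k ∈ locs F J,
      quadCoef F w (F.comb (F.weights (n J) τ)) (window s u J) J (j, k) (j, k) with hB
  set σ := spec W (j + 1) z * F.Psi (j + 1) τ
  set N := 2 * (s J : ℝ) + 1
  have e : N⁻¹ * B - σ = N⁻¹ * (B - N * σ) := by field_simp
  rw [e, abs_mul, abs_of_pos (inv_pos.2 hN)]
  have hb' : |B - N * σ| ≤ N * (ε / (2 * R ^ 2) * R ^ 2) + E := hb
  calc N⁻¹ * |B - N * σ| ≤ N⁻¹ * (N * (ε / (2 * R ^ 2) * R ^ 2) + E) :=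
        mul_le_mul_of_nonneg_left hb' (inv_pos.2 hN).le
    _ = ε / 2 + E / N := by field_simp
    _ < ε := by linarith

/-- The expected Toeplitz quadratic form per observation converges to the local autocovariance. -/
theorem tendsto_expectation [IsProbabilityMeasure P] (hX : IsLSW P F X w ξ W L C)
    (hc : ∑' τ : ℕ, ⨆ z ∈ Set.Ioo (0 : ℝ) 1, ‖autocov F W z τ‖ₑ < ⊤)
    (hz : z ∈ Set.Ioo (0 : ℝ) 1) (hs : Tendsto s atTop atTop)
    (hsT : Tendsto (fun J => (s J : ℝ) / 2 ^ J) atTop (𝓝 0)) (hn : Tendsto n atTop atTop)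
    (hu : ∀ J, |u J - z| ≤ K / 2 ^ J) (τ : ℤ) :
    Tendsto (fun J => (2 * (s J : ℝ) + 1)⁻¹ * ∑ p ∈ innov F J,
      quadCoef F w (F.comb (F.weights (n J) τ)) (window s u J) J p p) atTop
      (𝓝 (autocov F W z τ)) := by
  obtain ⟨K₀, hK0, hK⟩ := hX.exists_covariance_bound hz hc
  obtain ⟨e, he0, hetend, he⟩ := hX.exists_energy_tail hz
  rw [Metric.tendsto_atTop']
  intro ε hε
  have hsum := (summable_spec_mul_Psi (F := F) (hX.summable_sq hz) τ).hasSum.tendsto_sum_nat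
  have htail : Tendsto (fun m => Real.sqrt (e m) * Real.sqrt K₀) atTop (𝓝 0) := by
    have := (Real.continuous_sqrt.tendsto 0).comp hetend
    simpa using this.mul_const (Real.sqrt K₀)
  -- The cut-off `m` is fixed before `J`: it makes both the tail of c(z, τ) and the energy of the
  -- coarser scales small, so no rate uniform over scales is needed below it.
  obtain ⟨m, hm1, hm2⟩ := ((hsum.eventually
    (Metric.ball_mem_nhds _ (show 0 < ε / 3 by positivity))).and
      (htail.eventually (gt_mem_nhds (show 0 < ε / 3 by positivity)))).exists
  have hlow := tendsto_finsetSum (Finset.range m) fun j _ =>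
    hX.tendsto_scale (n := n) hz hs hsT hn hu τ j
  obtain ⟨J₀, hJ₀⟩ := eventually_atTop.1 ((hlow.eventually
    (Metric.ball_mem_nhds _ (show 0 < ε / 3 by positivity))).and
      ((eventually_window_subset hz hsT hu).and (eventually_ge_atTop m)))
  refine ⟨J₀, fun J hJ => ?_⟩
  obtain ⟨h1, h2, h3⟩ := hJ₀ J hJ.le
  set π := F.comb (F.weights (n J) τ) with hπdef
  set V := window s u J with hVdef
  set N := 2 * (s J : ℝ) + 1 with hN
  have hN0 : 0 < N := by positivity
  have hVN : (V.card : ℝ) = N := card_window J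
  have hπ := F.sum_comb_weights_sq_le (n J) τ
  have hKV := sum_coef_mul_sq_le (hK J) h2
  have hsplit := Finset.sum_filter_add_sum_filter_not (innov F J) (fun p => m ≤ p.1)
    fun p => quadCoef F w π V J p p
  have hhigh : |N⁻¹ * ∑ p ∈ (innov F J).filter (fun p => m ≤ p.1), quadCoef F w π V J p p| ≤
      Real.sqrt (e m) * Real.sqrt K₀ := by
    rw [abs_mul, abs_of_pos (inv_pos.2 hN0)]
    have h4 : |∑ p ∈ (innov F J).filter (fun p => m ≤ p.1), quadCoef F w π V J p p| ≤
        Real.sqrt (N * e m) * Real.sqrt (K₀ * N) := by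
      refine (Finset.abs_sum_le_sum_abs _ _).trans ?_
      refine (sum_abs_quadCoef_le hKV hK0 hπ (Finset.filter_subset _ _)).trans ?_
      rw [hVN]
      refine mul_le_mul_of_nonneg_right (Real.sqrt_le_sqrt ?_) (Real.sqrt_nonneg _)
      rw [← hVN]
      exact he J m V h2
    refine (mul_le_mul_of_nonneg_left h4 (inv_pos.2 hN0).le).trans (le_of_eq ?_)
    rw [Real.sqrt_mul hN0.le, Real.sqrt_mul hK0]
    have := Real.mul_self_sqrt hN0.le
    calc N⁻¹ * (Real.sqrt N * Real.sqrt (e m) * (Real.sqrt K₀ * Real.sqrt N)) =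
        N⁻¹ * (Real.sqrt N * Real.sqrt N) * (Real.sqrt (e m) * Real.sqrt K₀) := by ring
      _ = _ := by rw [this, inv_mul_cancel₀ hN0.ne', one_mul]
  have hlowset : (innov F J).filter (fun p => ¬ m ≤ p.1) = Finset.range m ×ˢ locs F J := by
    ext p
    simp only [innov, Finset.mem_filter, Finset.mem_product, Finset.mem_range]
    constructor
    · rintro ⟨⟨-, h⟩, h'⟩; exact ⟨by omega, h⟩
    · rintro ⟨h, h'⟩; exact ⟨⟨by omega, h'⟩, by omega⟩
  rw [hlowset, Finset.sum_product] at hsplit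
  rw [Real.dist_eq, ← hsplit, mul_add, Finset.mul_sum (Finset.range m)]
  rw [Real.dist_eq] at h1 hm1
  have hm1' : |∑ j ∈ Finset.range m, spec W (j + 1) z * F.Psi (j + 1) τ - autocov F W z τ| <
    ε / 3 := hm1
  rw [abs_lt] at h1 hm1'
  have h5 := abs_le.1 (hhigh.trans hm2.le)
  rw [abs_lt]
  constructor <;> linarith

/-- The local autocovariance estimator is consistent in mean. -/
theorem tendsto_integral_abs_autocovHat_sub [IsProbabilityMeasure P]
    (hX : IsLSW P F X w ξ W L C)
    (hc : ∑' τ : ℕ, ⨆ z ∈ Set.Ioo (0 : ℝ) 1, ‖autocov F W z τ‖ₑ < ⊤)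
    (hz : z ∈ Set.Ioo (0 : ℝ) 1) (hs : Tendsto s atTop atTop)
    (hsT : Tendsto (fun J => (s J : ℝ) / 2 ^ J) atTop (𝓝 0)) (hn : Tendsto n atTop atTop)
    (hns : Tendsto (fun J => 2 ^ n J * F.normInvA (n J) / (s J : ℝ)) atTop (𝓝 0))
    (hu : ∀ J, |u J - z| ≤ K / 2 ^ J) (τ : ℤ) :
    (∀ᶠ J in atTop, Integrable
      (fun ω => autocovHat F (2 ^ J) (s J) (n J) (fun t => X J t ω) (u J) τ) P) ∧
    Tendsto (fun J => ∫ ω, |autocovHat F (2 ^ J) (s J) (n J) (fun t => X J t ω) (u J) τ -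
      autocov F W z τ| ∂P) atTop (𝓝 0) := by
  obtain ⟨K₀, hK0, hK⟩ := hX.exists_covariance_bound hz hc
  have hwin := eventually_window_subset hz hsT hu
  have hE := fun J (hJ : window s u J ⊆ times J) =>
    hX.integral_abs_autocovHat_sub_le (n := n J) hK0 rfl hJ (hK J) τ
  refine ⟨hwin.mono fun J hJ => (hE J hJ).1, ?_⟩
  have hNlim : Tendsto (fun J => 2 * (s J : ℝ) + 1) atTop atTop :=
    tendsto_atTop_add_const_right _ _
      ((tendsto_natCast_atTop_atTop.comp hs).const_mul_atTop (by norm_num))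
  have hedge : Tendsto (fun J => 24 * F.radius * K₀ *
      (2 ^ n J * Real.sqrt (F.normInvA (n J)) / (2 * (s J : ℝ) + 1))) atTop (𝓝 0) := by
    obtain ⟨c, hc0, hcA⟩ := F.exists_le_normInvA
    rw [← mul_zero (24 * F.radius * K₀)]
    refine Tendsto.const_mul _ ?_
    have hlim := hns.const_mul (Real.sqrt c)⁻¹
    rw [mul_zero] at hlim
    refine squeeze_zero' (Eventually.of_forall fun J => by positivity) ?_ hlim
    filter_upwards [hn.eventually (eventually_ge_atTop 1), hs.eventually (eventually_ge_atTop 1)]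
      with J hJ1 hJ2
    have hs1 : (1 : ℝ) ≤ s J := by exact_mod_cast hJ2
    have hA := hcA _ hJ1
    have hsc : 0 < Real.sqrt c := Real.sqrt_pos.2 hc0
    -- Only ‖A⁻¹‖^{1/2} is needed, while the tuning assumption controls ‖A⁻¹‖, which is bounded
    -- below.
    have hsq : Real.sqrt (F.normInvA (n J)) ≤ (Real.sqrt c)⁻¹ * F.normInvA (n J) := by
      rw [inv_mul_eq_div, le_div_iff₀ hsc]
      calc _ ≤ Real.sqrt (F.normInvA (n J)) * Real.sqrt (F.normInvA (n J)) :=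
            mul_le_mul_of_nonneg_left (Real.sqrt_le_sqrt hA) (Real.sqrt_nonneg _)
        _ = _ := Real.mul_self_sqrt (F.normInvA_nonneg _)
    calc 2 ^ n J * Real.sqrt (F.normInvA (n J)) / (2 * (s J : ℝ) + 1)
        ≤ 2 ^ n J * ((Real.sqrt c)⁻¹ * F.normInvA (n J)) / (s J : ℝ) := by
          refine div_le_div₀ ?_ ?_ (by linarith) (by linarith)
          · exact mul_nonneg (by positivity) (mul_nonneg (by positivity) (F.normInvA_nonneg _))
          · exact mul_le_mul_of_nonneg_left hsq (by positivity)
      _ = _ := by ring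
  have hexp := hX.tendsto_expectation (n := n) hc hz hs hsT hn hu τ
  rw [Metric.tendsto_atTop']
  intro ε hε
  -- The truncation level is scaled so that its error, multiplied by the trace bound K₀N, is at most
  -- Nε/4.
  obtain ⟨C₀, hC0, hquad⟩ := hX.isStandardIID.quadraticForm
    (show 0 < ε / (4 * (K₀ + 1)) by positivity)
  have hvar : Tendsto (fun J => C₀ * K₀ / Real.sqrt (2 * (s J : ℝ) + 1)) atTop (𝓝 0) :=
    tendsto_const_nhds.div_atTop (Real.tendsto_sqrt_atTop.comp hNlim)
  have h4 : 0 < ε / 4 := by positivity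
  obtain ⟨J₀, hJ₀⟩ := eventually_atTop.1 (hwin.and ((hedge.eventually (gt_mem_nhds h4)).and
    ((hvar.eventually (gt_mem_nhds h4)).and (hexp.eventually (Metric.ball_mem_nhds _ h4)))))
  refine ⟨J₀, fun J hJ => ?_⟩
  obtain ⟨hJ1, hJ2, hJ3, hJ4⟩ := hJ₀ J hJ.le
  obtain ⟨hEi, hEb⟩ := hE J hJ1
  rw [Real.dist_eq, sub_zero, abs_of_nonneg (integral_nonneg fun _ => abs_nonneg _)]
  set π := F.comb (F.weights (n J) τ) with hπdef
  change ∫ ω, |_ - (2 * (s J : ℝ) + 1)⁻¹ * ∑ t ∈ window s u J, ∑ t' ∈ window s u J,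
    π (t - t') * (X J t.toNat ω * X J t'.toNat ω)| ∂P ≤ _ at hEb
  set V := window s u J with hVdef
  set N := 2 * (s J : ℝ) + 1 with hN
  have hN0 : 0 < N := by positivity
  have hVN : (V.card : ℝ) = N := card_window J
  have hπ := F.sum_comb_weights_sq_le (n J) τ
  have hKV := sum_coef_mul_sq_le (hK J) hJ1
  set A := ∑ p ∈ innov F J, quadCoef F w π V J p p with hA
  set M : Ω → ℝ := fun ω => ∑ t ∈ V, ∑ t' ∈ V, π (t - t') * (X J t.toNat ω * X J t'.toNat ω)
    with hM
  obtain ⟨hQi, hQb⟩ := hquad (innov F J) (quadCoef F w π V J)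
  have hae := hX.ae_quadratic_eq hJ1 π
  have hMi : Integrable M P := hQi.congr (hae.mono fun ω h => h.symm)
  have hMb : ∫ ω, |M ω - A| ∂P ≤ N * (ε / 4) + C₀ * K₀ * Real.sqrt N := by
    rw [integral_congr_ae (g := fun ω => |∑ p ∈ innov F J, ∑ q ∈ innov F J,
      quadCoef F w π V J p q * (ξ (p.1 + 1) p.2 ω * ξ (q.1 + 1) q.2 ω) - A|)
      (hae.mono fun ω h => by simp only [hM]; rw [h])]
    refine hQb.trans (add_le_add ?_ ?_)
    · have h5 := sum_abs_quadCoef_innov_le hKV hK0 hπ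
      rw [hVN] at h5
      refine (mul_le_mul_of_nonneg_left h5 (by positivity)).trans ?_
      have h6 : K₀ / (K₀ + 1) ≤ 1 := by rw [div_le_one (by positivity)]; linarith
      calc ε / (4 * (K₀ + 1)) * (K₀ * N) = N * (ε / 4) * (K₀ / (K₀ + 1)) := by field_simp
        _ ≤ N * (ε / 4) := mul_le_of_le_one_right (by positivity) h6
    · have h5 := sum_quadCoef_sq_le hKV hK0 hπ
      rw [hVN] at h5
      rw [mul_assoc]
      refine mul_le_mul_of_nonneg_left ((Real.sqrt_le_sqrt h5).trans (le_of_eq ?_)) hC0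
      rw [Real.sqrt_mul (sq_nonneg _), Real.sqrt_sq hK0]
  have hsq := Real.mul_self_sqrt hN0.le
  have hsN : 0 < Real.sqrt N := Real.sqrt_pos.2 hN0
  have hMb' : N⁻¹ * ∫ ω, |M ω - A| ∂P ≤ ε / 4 + C₀ * K₀ / Real.sqrt N := by
    refine (mul_le_mul_of_nonneg_left hMb (inv_pos.2 hN0).le).trans (le_of_eq ?_)
    rw [mul_add]
    congr 1
    · field_simp
    · nth_rewrite 1 [← hsq]
      field_simp
  rw [Real.dist_eq] at hJ4
  set H : Ω → ℝ := fun ω => autocovHat F (2 ^ J) (s J) (n J) (fun t => X J t ω) (u J) τ with hH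
  have hi1 : Integrable (fun ω => |H ω - N⁻¹ * M ω|) P := (hEi.sub (hMi.const_mul _)).abs
  have hi2 : Integrable (fun ω => N⁻¹ * |M ω - A|) P :=
    ((hMi.sub (integrable_const _)).abs).const_mul _
  have hi12 : Integrable (fun ω => |H ω - N⁻¹ * M ω| + N⁻¹ * |M ω - A|) P := hi1.add hi2
  have hi0 : Integrable (fun ω => |H ω - autocov F W z τ|) P :=
    (hEi.sub (integrable_const _)).abs
  calc ∫ ω, |H ω - autocov F W z τ| ∂P
      ≤ ∫ ω, ((|H ω - N⁻¹ * M ω| + N⁻¹ * |M ω - A|) + |N⁻¹ * A - autocov F W z τ|) ∂P := by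
        refine integral_mono hi0 (hi12.add (integrable_const _)) fun ω => ?_
        have e : H ω - autocov F W z τ = (H ω - N⁻¹ * M ω) + N⁻¹ * (M ω - A) +
          (N⁻¹ * A - autocov F W z τ) := by ring
        show |H ω - autocov F W z τ| ≤ _
        rw [e]
        refine (abs_add_three _ _ _).trans (le_of_eq ?_)
        rw [abs_mul, abs_of_pos (inv_pos.2 hN0)]
    _ = ∫ ω, |H ω - N⁻¹ * M ω| ∂P + N⁻¹ * ∫ ω, |M ω - A| ∂P +
          |N⁻¹ * A - autocov F W z τ| := by
        rw [integral_add hi12 (integrable_const _), integral_add hi1 hi2, integral_const_mul]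
        simp
    _ < ε := by linarith

end IsLSW

/-! ### The local partial autocorrelation as a continuous function of finitely many covariances -/

/-- Only entries at offsets 0, …, τ from the base time are read. The base time ⌊zT⌋, which moves
with T, can thus be moved to 0 and a single function serves for all T. -/
theorem lpacf_congr {B R B' R' : ℤ → ℤ → ℝ} {n n' : ℤ} {τ : ℕ}
    (hB : ∀ i ∈ Set.Icc (0 : ℤ) τ, ∀ j ∈ Set.Icc (0 : ℤ) τ, B (n + i) (n + j) = B' (n' + i) (n' + j))
    (hR : ∀ i ∈ Set.Icc (0 : ℤ) τ, ∀ j ∈ Set.Icc (0 : ℤ) τ,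
      R (n + i) (n + j) = R' (n' + i) (n' + j)) :
    lpacf B R n τ = lpacf B' R' n' τ := by
  cases τ with
  | zero => rfl
  | succ p =>
    have hB' : ∀ i j : ℤ, 0 ≤ i → i ≤ p + 1 → 0 ≤ j → j ≤ p + 1 → ∀ a b a' b' : ℤ,
        a = n + i → b = n + j → a' = n' + i → b' = n' + j → B a b = B' a' b' := by
      rintro i j hi0 hi hj0 hj _ _ _ _ rfl rfl rfl rfl
      exact hB i ⟨hi0, by push_cast; exact hi⟩ j ⟨hj0, by push_cast; exact hj⟩
    have hR' : ∀ i j : ℤ, 0 ≤ i → i ≤ p + 1 → 0 ≤ j → j ≤ p + 1 → ∀ a b a' b' : ℤ,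
        a = n + i → b = n + j → a' = n' + i → b' = n' + j → R a b = R' a' b' := by
      rintro i j hi0 hi hj0 hj _ _ _ _ rfl rfl rfl rfl
      exact hR i ⟨hi0, by push_cast; exact hi⟩ j ⟨hj0, by push_cast; exact hj⟩
    have hmid : (Matrix.of fun i j : Fin p => B (n + 1 + i) (n + 1 + j)) =
        Matrix.of fun i j : Fin p => B' (n' + 1 + i) (n' + 1 + j) := by
      ext i j
      exact hB' (1 + i) (1 + j) (by omega) (by omega) (by omega) (by omega) _ _ _ _
        (by ring) (by ring) (by ring) (by ring)
    have hpred : ∀ a : ℤ, 0 ≤ a → a ≤ p + 1 →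
        predCoef B n p (n + a) = predCoef B' n' p (n' + a) := fun a ha0 ha => by
      rw [predCoef, predCoef, hmid]
      congr 1
      ext i
      exact hB' (1 + i) a (by omega) (by omega) ha0 ha _ _ _ _
        (by ring) rfl (by ring) rfl
    have hback : bBack B n p = bBack B' n' p := by
      have := hpred 0 le_rfl (by omega)
      simp only [add_zero] at this
      rw [bBack, bBack, this]
    have hfor : bFor B n p = bFor B' n' p := by
      have := hpred (p + 1) (by omega) le_rfl
      simp only [← add_assoc] at this
      rw [bFor, bFor, this]
    have hcov0 : covMat B n (p + 1) = covMat B' n' (p + 1) := by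
      ext i j
      exact hB' i j (by omega) (by omega) (by omega) (by omega) _ _ _ _ rfl rfl rfl rfl
    have hcov1 : covMat B (n + 1) (p + 1) = covMat B' (n' + 1) (p + 1) := by
      ext i j
      exact hB' (1 + i) (1 + j) (by omega) (by omega) (by omega) (by omega) _ _ _ _
        (by ring) (by ring) (by ring) (by ring)
    have hyw : yuleWalker B R n (p + 1) = yuleWalker B' R' n' (p + 1) := by
      rw [yuleWalker, yuleWalker]
      congr 1
      · congr 1
        ext i j
        exact hB' (p - i) (p - j) (by omega) (by omega) (by omega) (by omega) _ _ _ _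
          (by push_cast; ring) (by push_cast; ring) (by push_cast; ring) (by push_cast; ring)
      · ext i
        exact hR' (p + 1) (p - i) (by omega) (by omega) (by omega) (by omega) _ _ _ _
          (by push_cast; ring) (by push_cast; ring) (by push_cast; ring) (by push_cast; ring)
    rw [lpacf, lpacf, hback, hfor, hcov0, hcov1, hyw]

section Continuity

variable {α : Type*} [TopologicalSpace α] {x : α}

theorem continuousAt_inv_matrix {p : ℕ} {M : α → Matrix (Fin p) (Fin p) ℝ}
    (hM : ContinuousAt M x) (hdet : (M x).det ≠ 0) : ContinuousAt (fun a => (M a)⁻¹) x := by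
  refine ContinuousAt.comp (g := fun A : Matrix (Fin p) (Fin p) ℝ => A⁻¹) ?_ hM
  refine continuousAt_matrix_inv _ ?_
  have := NormedRing.inverse_continuousAt (Units.mk0 _ hdet)
  simpa using this

theorem continuousAt_matrix_of {p q : ℕ} {M : α → Fin p → Fin q → ℝ}
    (hM : ∀ i j, ContinuousAt (fun a => M a i j) x) :
    ContinuousAt (fun a => (Matrix.of (M a) : Matrix (Fin p) (Fin q) ℝ)) x :=
  continuousAt_pi.2 fun i => continuousAt_pi.2 fun j => hM i j

theorem continuousAt_mulVec {p q : ℕ} {M : α → Matrix (Fin p) (Fin q) ℝ} {v : α → Fin q → ℝ}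
    (hM : ContinuousAt M x) (hv : ContinuousAt v x) :
    ContinuousAt (fun a => (M a).mulVec (v a)) x := by
  refine continuousAt_pi.2 fun i => ?_
  simp only [Matrix.mulVec, dotProduct]
  refine tendsto_finsetSum _ fun j _ => ?_
  exact (((continuousAt_pi.1 (continuousAt_pi.1 hM i)) j).mul (continuousAt_pi.1 hv j))

theorem continuousAt_dotProduct {p : ℕ} {v v' : α → Fin p → ℝ}
    (hv : ContinuousAt v x) (hv' : ContinuousAt v' x) :
    ContinuousAt (fun a => v a ⬝ᵥ v' a) x :=
  tendsto_finsetSum _ fun j _ => (continuousAt_pi.1 hv j).mul (continuousAt_pi.1 hv' j)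

/-- The local partial autocorrelation depends continuously on the covariances, at nonsingular
covariances. -/
theorem continuousAt_lpacf {B R : α → ℤ → ℤ → ℝ} (hB : ∀ i j, ContinuousAt (fun a => B a i j) x)
    (hR : ∀ i j, ContinuousAt (fun a => R a i j) x) {n : ℤ} {p : ℕ}
    (hmid : (Matrix.of fun i j : Fin p => B x (n + 1 + i) (n + 1 + j)).det ≠ 0)
    (hyw : (Matrix.of fun i j : Fin (p + 1) =>
      B x (n + (p + 1 : ℕ) - 1 - i) (n + (p + 1 : ℕ) - 1 - j)).det ≠ 0)
    (hfor : bFor (B x) n p ⬝ᵥ (covMat (B x) (n + 1) (p + 1)).mulVec (bFor (B x) n p) ≠ 0) :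
    ContinuousAt (fun a => lpacf (B a) (R a) n (p + 1)) x := by
  have hpred : ∀ t, ContinuousAt (fun a => predCoef (B a) n p t) x := fun t =>
    continuousAt_mulVec (continuousAt_inv_matrix (continuousAt_matrix_of fun i j => hB _ _) hmid)
      (continuousAt_pi.2 fun i => hB _ _)
  have hb : ContinuousAt (fun a => bBack (B a) n p) x := by
    refine continuousAt_pi.2 fun i => ?_
    refine Fin.cases ?_ (fun i => ?_) i
    · simpa [bBack] using continuousAt_const
    · simpa [bBack] using continuousAt_pi.1 (hpred n) i
  have hf : ContinuousAt (fun a => bFor (B a) n p) x := by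
    refine continuousAt_pi.2 fun i => ?_
    refine Fin.lastCases ?_ (fun i => ?_) i
    · simpa [bFor] using continuousAt_const
    · simpa [bFor] using continuousAt_pi.1 (hpred (n + p + 1)) i
  have hcov : ∀ m, ContinuousAt (fun a => covMat (B a) m (p + 1)) x := fun m =>
    continuousAt_matrix_of fun i j => hB _ _
  have hφ : ContinuousAt (fun a => yuleWalker (B a) (R a) n (p + 1)) x :=
    continuousAt_mulVec (continuousAt_inv_matrix (continuousAt_matrix_of fun i j => hB _ _) hyw)
      (continuousAt_pi.2 fun i => hR _ _)
  refine (continuousAt_pi.1 hφ _).mul (Real.continuous_sqrt.continuousAt.comp ?_)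
  exact (continuousAt_dotProduct hb (continuousAt_mulVec (hcov n) hb)).div
    (continuousAt_dotProduct hf (continuousAt_mulVec (hcov (n + 1)) hf)) hfor

end Continuity

/-! ### Positive definiteness, nonvanishing spectrum and continuity in rescaled time -/

section PositiveDefinite

variable {F : QMFilter} {W : ℕ → ℝ → ℝ} {z : ℝ}

/-- The local autocovariance is positive definite as soon as the spectrum does not vanish. -/
theorem sum_autocov_mul_pos (hW : Summable fun j : ℕ => W (j + 1) z ^ 2)
    (hne : ∃ j : ℕ, W (j + 1) z ≠ 0) {p : ℕ} {y : Fin p → ℝ} (hy : y ≠ 0) :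
    0 < ∑ i : Fin p, ∑ j : Fin p, autocov F W z ((i : ℤ) - j) * (y i * y j) := by
  obtain ⟨j, hj⟩ := hne
  -- The quadratic form is a sum of nonnegative terms over scales, so one nonzero square at one
  -- active scale and one location bounds it below.
  obtain ⟨k, hk⟩ := F.exists_sum_psi_ne_zero j hy
  set V : Finset ℤ := Finset.univ.map
    ⟨fun i : Fin p => (i : ℤ), fun a b h => Fin.ext (Int.ofNat.inj h)⟩ with hV
  set y' : ℤ → ℝ := fun t => if h : t.toNat < p then y ⟨t.toNat, h⟩ else 0 with hy'
  have hyy : ∀ i : Fin p, y' i = y i := fun i => by simp [hy']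
  have h1 := hasSum_spec_mul_form (F := F) hW V y'
  have h2 : ∑ t ∈ V, ∑ t' ∈ V, autocov F W z (t - t') * (y' t * y' t') =
      ∑ i : Fin p, ∑ j : Fin p, autocov F W z ((i : ℤ) - j) * (y i * y j) := by
    simp only [hV, Finset.sum_map, ← hyy]
    rfl
  rw [h2] at h1
  refine lt_of_lt_of_le ?_ (le_hasSum h1 j fun i _ =>
    mul_nonneg (spec_nonneg _ _) (F.form_nonneg _ _ _))
  refine mul_pos (by rw [spec]; positivity) ?_
  have h3 := F.sum_sq_le_form (j + 1) V {k} y'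
  rw [Finset.sum_singleton] at h3
  refine lt_of_lt_of_le ?_ h3
  have h4 : ∑ t ∈ V, F.psi (j + 1) (k - t) * y' t = ∑ i : Fin p, F.psi (j + 1) (k - i) * y i := by
    simp only [hV, Finset.sum_map, ← hyy]
    rfl
  rw [h4]
  positivity

/-- The Toeplitz matrix of the local autocovariance. -/
noncomputable def toeplitz (F : QMFilter) (W : ℕ → ℝ → ℝ) (z : ℝ) (p : ℕ) :
    Matrix (Fin p) (Fin p) ℝ :=
  Matrix.of fun i j => autocov F W z ((i : ℤ) - j)

theorem dotProduct_toeplitz_pos (hW : Summable fun j : ℕ => W (j + 1) z ^ 2)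
    (hne : ∃ j : ℕ, W (j + 1) z ≠ 0) {p : ℕ} {y : Fin p → ℝ} (hy : y ≠ 0) :
    0 < y ⬝ᵥ (toeplitz F W z p).mulVec y := by
  refine lt_of_lt_of_eq (sum_autocov_mul_pos (F := F) hW hne hy) ?_
  simp only [dotProduct, Matrix.mulVec, toeplitz, Matrix.of_apply, Finset.mul_sum]
  exact Finset.sum_congr rfl fun i _ => Finset.sum_congr rfl fun j _ => by ring

theorem det_toeplitz_ne_zero (hW : Summable fun j : ℕ => W (j + 1) z ^ 2)
    (hne : ∃ j : ℕ, W (j + 1) z ≠ 0) (p : ℕ) : (toeplitz F W z p).det ≠ 0 := by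
  intro h
  obtain ⟨y, hy, h0⟩ := Matrix.exists_mulVec_eq_zero_iff.2 h
  have := dotProduct_toeplitz_pos (F := F) hW hne hy
  rw [h0, dotProduct_zero] at this
  exact this.false

end PositiveDefinite

/-- A crude ℓ¹ bound, of order 2^j uniformly in frequency, which the summability of (2^j L_j)² can
absorb. -/
theorem QMFilter.norm_psiHat_le (F : QMFilter) (j : ℕ) (ω : ℝ) :
    ‖F.psiHat j ω‖ ≤ 3 * F.radius * 2 ^ j := by
  have hfin : (Function.support fun s : ℤ =>
      (F.wav j 0 s : ℂ) * Complex.exp (Complex.I * ω * s)).Finite := by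
    refine ((F.psi_support_finite j).image (fun n => 0 - n)).subset fun s hs => ?_
    have : F.psi j (0 - s) ≠ 0 := by
      intro h
      rw [zero_sub] at h
      exact hs (by simp [wav, h])
    exact ⟨0 - s, this, by simp⟩
  rw [psiHat, finsum_eq_sum _ hfin]
  refine (norm_sum_le _ _).trans ?_
  have h1 : ∀ s : ℤ, ‖(F.wav j 0 s : ℂ) * Complex.exp (Complex.I * ω * s)‖ =
      |F.psi j (0 - s)| := fun s => by
    rw [norm_mul, Complex.norm_exp]
    simp [wav]
  simp only [h1]
  refine (F.sum_abs_psi_reflect_le j 0 _).trans ?_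
  have h2 : (1 : ℝ) ≤ F.radius := by exact_mod_cast F.one_le_radius
  have h3 : (1 : ℝ) ≤ 2 ^ j := one_le_pow₀ (by norm_num)
  nlinarith

namespace IsLSW

variable {Ω : Type*} [MeasurableSpace Ω] {P : Measure Ω}
  {F : QMFilter} {X : ℕ → ℕ → Ω → ℝ}
  {w : ℕ → ℕ → ℤ → ℝ} {ξ : ℕ → ℤ → Ω → ℝ} {W : ℕ → ℝ → ℝ} {L C : ℕ → ℝ} {z K : ℝ}
  {s n : ℕ → ℕ} {u : ℕ → ℝ}

theorem summable_two_pow_mul_L_sq (hX : IsLSW P F X w ξ W L C) :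
    Summable fun j : ℕ => ((2 : ℝ) ^ (j + 1) * L (j + 1)) ^ 2 :=
  summable_sq_of_summable ((summable_nat_add_iff 1).2 hX.lipschitz_summable)
    fun j => mul_nonneg (by positivity) (hX.L_nonneg j)

theorem L_sq_le (hX : IsLSW P F X w ξ W L C) (j : ℕ) :
    L (j + 1) ^ 2 ≤ ((2 : ℝ) ^ (j + 1) * L (j + 1)) ^ 2 :=
  pow_le_pow_left₀ (hX.L_nonneg j)
    (le_mul_of_one_le_left (hX.L_nonneg j) (one_le_pow₀ (by norm_num))) 2

/-- The local autocovariance is continuous in rescaled time. -/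
theorem tendsto_autocov (hX : IsLSW P F X w ξ W L C) (hz : z ∈ Set.Ioo (0 : ℝ) 1)
    (hu : ∀ J, |u J - z| ≤ K / 2 ^ J) (τ : ℤ) :
    Tendsto (fun J => autocov F W (u J) τ) atTop (𝓝 (autocov F W z τ)) := by
  have hlim : Tendsto (fun J => |u J - z|) atTop (𝓝 0) :=
    squeeze_zero (fun _ => abs_nonneg _) hu (tendsto_const_div_two_pow K)
  -- Once |u_T - z| < 1, the Lipschitz bound and x² ≤ 2y² + 2(x - y)² dominate the spectrum at u_T.
  have hbound : Summable fun j : ℕ =>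
      2 * W (j + 1) z ^ 2 + 2 * ((2 : ℝ) ^ (j + 1) * L (j + 1)) ^ 2 :=
    ((hX.summable_sq hz).mul_left 2).add (hX.summable_two_pow_mul_L_sq.mul_left 2)
  refine tendsto_tsum_of_dominated_convergence hbound (fun j => ?_) ?_
  · have h1 : Tendsto (fun J => W (j + 1) (u J)) atTop (𝓝 (W (j + 1) z)) := by
      rw [tendsto_iff_dist_tendsto_zero]
      refine squeeze_zero (fun _ => dist_nonneg)
        (fun J => hX.lipschitz (j + 1) (by omega) (u J) z) ?_
      simpa using hlim.const_mul (L (j + 1))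
    exact (h1.pow 2).mul_const _
  · filter_upwards [hlim.eventually (gt_mem_nhds one_pos)] with J hJ j
    rw [norm_mul, Real.norm_eq_abs, Real.norm_eq_abs, abs_of_nonneg (spec_nonneg _ _)]
    refine (mul_le_of_le_one_right (spec_nonneg _ _) (F.abs_Psi_le_one _ _)).trans ?_
    have h1 := (hX.lipschitz (j + 1) (by omega) (u J) z).trans
      (mul_le_of_le_one_right (hX.L_nonneg j) hJ.le)
    have h2 : (W (j + 1) (u J) - W (j + 1) z) ^ 2 ≤ L (j + 1) ^ 2 := by
      rw [← sq_abs]; exact pow_le_pow_left₀ (abs_nonneg _) h1 2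
    have h3 := hX.L_sq_le j
    rw [spec]
    nlinarith [sq_nonneg (W (j + 1) (u J) - 2 * W (j + 1) z)]

/-- A spectral density bounded away from zero almost everywhere does not vanish at any time. -/
theorem exists_amplitude_ne_zero (hX : IsLSW P F X w ξ W L C)
    (hS : 0 < essInf
      (fun p : ℝ × ℝ => ∑' j : ℕ,
        ENNReal.ofReal (spec W (j + 1) p.1 * ‖F.psiHat (j + 1) p.2‖ ^ 2))
      (volume.restrict (Set.Ioo (0 : ℝ) 1 ×ˢ Set.Icc (-Real.pi) Real.pi)))
    (hz : z ∈ Set.Ioo (0 : ℝ) 1) : ∃ j : ℕ, W (j + 1) z ≠ 0 := by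
  by_contra! h0
  set f : ℝ × ℝ → ENNReal := fun p => ∑' j : ℕ,
    ENNReal.ofReal (spec W (j + 1) p.1 * ‖F.psiHat (j + 1) p.2‖ ^ 2) with hf
  set A := Set.Ioo (0 : ℝ) 1 ×ˢ Set.Icc (-Real.pi) Real.pi with hA
  have hsum := hX.summable_two_pow_mul_L_sq
  set M : ℝ := (3 * F.radius) ^ 2 * ∑' j : ℕ, ((2 : ℝ) ^ (j + 1) * L (j + 1)) ^ 2 with hM
  -- If all amplitudes vanish at z, then S_j(x) ≤ L_j²(x - z)², and the factors 4^j from the Fourier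
  -- transforms remain summable against L_j².
  have hfle : ∀ p : ℝ × ℝ, f p ≤ ENNReal.ofReal ((p.1 - z) ^ 2 * M) := fun p => by
    have hs2 := (hsum.mul_left ((p.1 - z) ^ 2 * (3 * F.radius) ^ 2))
    have e : (p.1 - z) ^ 2 * M = ∑' j : ℕ, (p.1 - z) ^ 2 * (3 * F.radius : ℝ) ^ 2 *
        ((2 : ℝ) ^ (j + 1) * L (j + 1)) ^ 2 := by
      rw [tsum_mul_left, hM]; ring
    rw [e, ENNReal.ofReal_tsum_of_nonneg (fun j => by positivity) hs2]
    refine ENNReal.tsum_le_tsum fun j => ENNReal.ofReal_le_ofReal ?_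
    have h1 : spec W (j + 1) p.1 ≤ L (j + 1) ^ 2 * (p.1 - z) ^ 2 := by
      have := hX.lipschitz (j + 1) (by omega) p.1 z
      rw [h0 j, sub_zero] at this
      rw [spec, ← sq_abs, ← sq_abs (p.1 - z), ← mul_pow]
      exact pow_le_pow_left₀ (abs_nonneg _) this 2
    have h2 : ‖F.psiHat (j + 1) p.2‖ ^ 2 ≤ (3 * F.radius * 2 ^ (j + 1)) ^ 2 :=
      pow_le_pow_left₀ (norm_nonneg _) (F.norm_psiHat_le _ _) 2
    refine (mul_le_mul h1 h2 (by positivity) (by positivity)).trans (le_of_eq ?_)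
    ring
  have hcont : Tendsto (fun x : ℝ => ENNReal.ofReal ((x - z) ^ 2 * M)) (𝓝 z) (𝓝 0) := by
    have : Continuous fun x : ℝ => ENNReal.ofReal ((x - z) ^ 2 * M) :=
      ENNReal.continuous_ofReal.comp (by fun_prop)
    simpa using this.tendsto z
  obtain ⟨U, hU, hUo, hzU⟩ := eventually_nhds_iff.1 (hcont.eventually (gt_mem_nhds hS))
  have hae : ∀ᵐ p ∂(volume.restrict A), essInf f (volume.restrict A) ≤ f p := ae_essInf_le
  rw [ae_restrict_iff' (measurableSet_Ioo.prod measurableSet_Icc)] at hae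
  -- The density lies below its essential infimum on a nonempty open box, which has positive
  -- measure.
  have hBo : IsOpen ((U ∩ Set.Ioo (0 : ℝ) 1) ×ˢ Set.Ioo (-Real.pi) Real.pi) :=
    (hUo.inter isOpen_Ioo).prod isOpen_Ioo
  have hBne : ((U ∩ Set.Ioo (0 : ℝ) 1) ×ˢ Set.Ioo (-Real.pi) Real.pi).Nonempty :=
    ⟨(z, 0), ⟨hzU, hz⟩, by constructor <;> simp [Real.pi_pos]⟩
  have hpos := hBo.measure_pos (volume : Measure (ℝ × ℝ)) hBne
  refine hpos.ne' (measure_mono_null (fun p hp => ?_) (ae_iff.1 hae))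
  intro hcon
  have h1 := hcon ⟨hp.1.2, Set.Ioo_subset_Icc_self hp.2⟩
  exact absurd (h1.trans (hfle p)) (not_le.2 (hU p.1 hp.1.1))

/-- The local autocovariance estimator is consistent. -/
theorem tendsto_measure_autocovHat [IsProbabilityMeasure P] (hX : IsLSW P F X w ξ W L C)
    (hc : ∑' τ : ℕ, ⨆ z ∈ Set.Ioo (0 : ℝ) 1, ‖autocov F W z τ‖ₑ < ⊤)
    (hz : z ∈ Set.Ioo (0 : ℝ) 1) (hs : Tendsto s atTop atTop)
    (hsT : Tendsto (fun J => (s J : ℝ) / 2 ^ J) atTop (𝓝 0)) (hn : Tendsto n atTop atTop)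
    (hns : Tendsto (fun J => 2 ^ n J * F.normInvA (n J) / (s J : ℝ)) atTop (𝓝 0))
    (hu : ∀ J, |u J - z| ≤ K / 2 ^ J) (τ : ℤ) {δ : ℝ} (hδ : 0 < δ) :
    Tendsto (fun J => P {ω | δ ≤ |autocovHat F (2 ^ J) (s J) (n J) (fun t => X J t ω) (u J) τ -
      autocov F W z τ|}) atTop (𝓝 0) := by
  obtain ⟨hint, hlim⟩ := hX.tendsto_integral_abs_autocovHat_sub hc hz hs hsT hn hns hu τ
  have h1 : Tendsto (fun J => ENNReal.ofReal (δ⁻¹ * ∫ ω, |autocovHat F (2 ^ J) (s J) (n J)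
      (fun t => X J t ω) (u J) τ - autocov F W z τ| ∂P)) atTop (𝓝 0) := by
    have := ENNReal.tendsto_ofReal (hlim.const_mul δ⁻¹)
    simpa using this
  refine tendsto_of_tendsto_of_tendsto_of_le_of_le' tendsto_const_nhds h1
    (Eventually.of_forall fun _ => zero_le) ?_
  filter_upwards [hint] with J hJ
  have h2 := mul_meas_ge_le_integral_of_nonneg
    (f := fun ω => |autocovHat F (2 ^ J) (s J) (n J) (fun t => X J t ω) (u J) τ -
      autocov F W z τ|) (ae_of_all P fun _ => abs_nonneg _)
    (hJ.sub (integrable_const _)).abs δ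
  refine (ENNReal.le_ofReal_iff_toReal_le (measure_ne_top _ _)
    (mul_nonneg (inv_pos.2 hδ).le (integral_nonneg fun _ => abs_nonneg _))).2 ?_
  rw [inv_mul_eq_div, le_div_iff₀' hδ]
  exact h2

end IsLSW

/-! ### Continuous mapping and conclusion -/

/-- Extension by zero of a finite array of covariances. -/
noncomputable def extendArray (τ : ℕ) (Y : Fin (τ + 1) → Fin (τ + 1) → ℝ) (a b : ℤ) : ℝ :=
  if h : a.toNat < τ + 1 ∧ b.toNat < τ + 1 then Y ⟨a.toNat, h.1⟩ ⟨b.toNat, h.2⟩ else 0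

theorem extendArray_eq {τ : ℕ} (B : ℤ → ℤ → ℝ) {i j : ℤ} (hi : i ∈ Set.Icc (0 : ℤ) τ)
    (hj : j ∈ Set.Icc (0 : ℤ) τ) :
    extendArray τ (fun i j => B i j) i j = B i j := by
  have hi0 := hi.1
  have hi1 := hi.2
  have hj0 := hj.1
  have hj1 := hj.2
  rw [extendArray, dif_pos ⟨by omega, by omega⟩]
  simp only [Int.toNat_of_nonneg hi0, Int.toNat_of_nonneg hj0]

theorem lpacf_eq_extendArray (B R : ℤ → ℤ → ℝ) (n : ℤ) (τ : ℕ) :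
    lpacf B R n τ = lpacf (extendArray τ fun i j => B (n + i) (n + j))
      (extendArray τ fun i j => R (n + i) (n + j)) 0 τ := by
  refine lpacf_congr (fun i hi j hj => ?_) fun i hi j hj => ?_
  · rw [zero_add, zero_add, extendArray_eq (fun i j => B (n + i) (n + j)) hi hj]
  · rw [zero_add, zero_add, extendArray_eq (fun i j => R (n + i) (n + j)) hi hj]

theorem continuous_extendArray (τ : ℕ) (a b : ℤ) :
    Continuous fun Y : Fin (τ + 1) → Fin (τ + 1) → ℝ => extendArray τ Y a b := by
  unfold extendArray
  split_ifs
  · fun_prop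
  · exact continuous_const

/-- At the limiting point all covariances are localised at z itself, so every matrix to be inverted
is a Toeplitz matrix of c(z, ·), hence nonsingular. -/
theorem continuousAt_lpacf_extendArray {F : QMFilter} {W : ℕ → ℝ → ℝ} {z : ℝ}
    (hW : Summable fun j : ℕ => W (j + 1) z ^ 2) (hne : ∃ j : ℕ, W (j + 1) z ≠ 0) (p : ℕ) :
    ContinuousAt (fun Y : (Fin (p + 1 + 1) → Fin (p + 1 + 1) → ℝ) ×
        (Fin (p + 1 + 1) → Fin (p + 1 + 1) → ℝ) =>
      lpacf (extendArray (p + 1) Y.1) (extendArray (p + 1) Y.2) 0 (p + 1))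
      (fun i j => autocov F W z ((i : ℤ) - j), fun i j => autocov F W z ((i : ℤ) - j)) := by
  set B₀ : ℤ → ℤ → ℝ := extendArray (p + 1) fun i j => autocov F W z ((i : ℤ) - j) with hB₀
  have hB : ∀ i j : ℤ, 0 ≤ i → i ≤ p + 1 → 0 ≤ j → j ≤ p + 1 → B₀ i j = autocov F W z (i - j) :=
    fun i j hi0 hi hj0 hj => by
      have := extendArray_eq (τ := p + 1) (fun i j => autocov F W z (i - j))
        (i := i) (j := j) ⟨hi0, by push_cast; exact hi⟩ ⟨hj0, by push_cast; exact hj⟩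
      exact this
  have hcov : covMat B₀ (0 + 1) (p + 1) = toeplitz F W z (p + 1) := by
    ext i j
    simp only [covMat, toeplitz, Matrix.of_apply]
    rw [hB _ _ (by omega) (by omega) (by omega) (by omega)]
    congr 1; ring
  refine continuousAt_lpacf
    (fun i j => ((continuous_extendArray (p + 1) i j).comp continuous_fst).continuousAt)
    (fun i j => ((continuous_extendArray (p + 1) i j).comp continuous_snd).continuousAt) ?_ ?_ ?_
  · have : (Matrix.of fun i j : Fin p => B₀ (0 + 1 + i) (0 + 1 + j)) = toeplitz F W z p := by
      ext i j
      simp only [toeplitz, Matrix.of_apply]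
      rw [hB _ _ (by omega) (by omega) (by omega) (by omega)]
      congr 1; ring
    exact this ▸ det_toeplitz_ne_zero hW hne p
  · have : (Matrix.of fun i j : Fin (p + 1) =>
        B₀ (0 + (p + 1 : ℕ) - 1 - i) (0 + (p + 1 : ℕ) - 1 - j)) = toeplitz F W z (p + 1) := by
      ext i j
      simp only [toeplitz, Matrix.of_apply]
      rw [hB _ _ (by omega) (by omega) (by omega) (by omega), ← autocov_neg]
      congr 1; ring
    exact this ▸ det_toeplitz_ne_zero hW hne (p + 1)
  · show bFor B₀ 0 p ⬝ᵥ (covMat B₀ (0 + 1) (p + 1)).mulVec (bFor B₀ 0 p) ≠ 0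
    rw [hcov]
    -- The forecasting vector is nonzero because its last entry is -1; the denominator is therefore
    -- positive.
    refine (dotProduct_toeplitz_pos hW hne fun h => ?_).ne'
    have := congrFun h (Fin.last p)
    simp [bFor] at this

end LSW

open LSW in
theorem proposition3 {Ω : Type*} [MeasurableSpace Ω] (P : MeasureTheory.Measure Ω)
    [MeasureTheory.IsProbabilityMeasure P]
    (F : LSW.QMFilter) (X : ℕ → ℕ → Ω → ℝ) (w : ℕ → ℕ → ℤ → ℝ) (ξ : ℕ → ℤ → Ω → ℝ)
    (W : ℕ → ℝ → ℝ) (L C : ℕ → ℝ) (hX : LSW.IsLSW P F X w ξ W L C)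
    -- `∑_{τ ≥ 0} sup_z |c(z, τ)| < ∞`
    (hc : ∑' τ : ℕ, ⨆ z ∈ Set.Ioo (0 : ℝ) 1, ‖LSW.autocov F W z τ‖ₑ < ⊤)
    -- `ess inf_{z, ω} ∑_{j ≥ 1} S_j(z) |ψ̂_j(ω)|² > 0`
    (hS : 0 < essInf
      (fun p : ℝ × ℝ => ∑' j : ℕ,
        ENNReal.ofReal (LSW.spec W (j + 1) p.1 * ‖F.psiHat (j + 1) p.2‖ ^ 2))
      (MeasureTheory.volume.restrict (Set.Ioo (0 : ℝ) 1 ×ˢ Set.Icc (-Real.pi) Real.pi)))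
    -- tuning of the estimator: smoothing half-width `s` and number of scales `n`, with `T = 2^J`
    (s n : ℕ → ℕ) (hs : Tendsto s atTop atTop)
    (hsT : Tendsto (fun J => (s J : ℝ) / 2 ^ J) atTop (𝓝 0))
    (hn : Tendsto n atTop atTop)
    (hns : Tendsto (fun J => 2 ^ n J * F.normInvA (n J) / (s J : ℝ)) atTop (𝓝 0))
    (z : ℝ) (hz : z ∈ Set.Ioo (0 : ℝ) 1) (τ : ℕ) (hτ : 1 ≤ τ)
    (ζ ρ : ℕ → ℤ → ℤ → ℝ) (hζ : LSW.IsLocalisation z τ ζ) (hρ : LSW.IsLocalisation z τ ρ) :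
    MeasureTheory.TendstoInMeasure P
      (fun J ω => LSW.qTilde F (s J) (n J) (fun t => X J t ω) ζ ρ J z τ - LSW.q F W ζ ρ J z τ)
      atTop (fun _ => 0) := by
  obtain ⟨p, rfl⟩ : ∃ p, τ = p + 1 := ⟨τ - 1, by omega⟩
  have hne := hX.exists_amplitude_ne_zero hS hz
  have hcont := continuousAt_lpacf_extendArray (F := F) (hX.summable_sq hz) hne p
  set I := Fin (p + 1 + 1)
  set y₀ : I → I → ℝ := fun i j => autocov F W z ((i : ℤ) - j) with hy₀
  set G : (I → I → ℝ) × (I → I → ℝ) → ℝ := fun Y =>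
    lpacf (extendArray (p + 1) Y.1) (extendArray (p + 1) Y.2) 0 (p + 1) with hG
  set N : ℕ → ℤ := fun J => ⌊z * 2 ^ J⌋ with hN
  set est : (ℕ → ℤ → ℤ → ℝ) → ℕ → Ω → I → I → ℝ := fun ζ J ω i j =>
    autocovHat F (2 ^ J) (s J) (n J) (fun t => X J t ω) (ζ J (N J + i) (N J + j)) ((i : ℤ) - j)
    with hest
  set tar : (ℕ → ℤ → ℤ → ℝ) → ℕ → I → I → ℝ := fun ζ J i j =>
    autocov F W (ζ J (N J + i) (N J + j)) ((i : ℤ) - j) with htar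
  have hqT : ∀ J ω, qTilde F (s J) (n J) (fun t => X J t ω) ζ ρ J z (p + 1) =
      G (est ζ J ω, est ρ J ω) := fun J ω => by
    rw [qTilde, lpacf_eq_extendArray]
    simp only [add_sub_add_left_eq_sub]
    rfl
  have hq : ∀ J, q F W ζ ρ J z (p + 1) = G (tar ζ J, tar ρ J) := fun J => by
    rw [q, lpacf_eq_extendArray]
    simp only [add_sub_add_left_eq_sub]
    rfl
  have hmem : ∀ (J : ℕ) (i : I), N J + (i : ℤ) ∈ Set.Icc ⌊z * 2 ^ J⌋ (⌊z * 2 ^ J⌋ + (p + 1 : ℕ)) :=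
    fun J i => ⟨by simp [hN], by have := i.2; simp only [hN]; omega⟩
  have htarlim : ∀ ζ, IsLocalisation z (p + 1) ζ → Tendsto (tar ζ) atTop (𝓝 y₀) := by
    rintro ζ ⟨K, hK⟩
    exact tendsto_pi_nhds.2 fun i => tendsto_pi_nhds.2 fun j =>
      hX.tendsto_autocov hz (fun J => hK J _ (hmem J i) _ (hmem J j)) _
  have hestlim : ∀ ζ, IsLocalisation z (p + 1) ζ → ∀ δ > 0, Tendsto
      (fun J => ∑ i, ∑ j, P {ω | δ ≤ |est ζ J ω i j - y₀ i j|}) atTop (𝓝 0) := by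
    rintro ζ ⟨K, hK⟩ δ hδ
    have := tendsto_finsetSum Finset.univ fun (i : I) _ =>
      tendsto_finsetSum Finset.univ fun (j : I) _ =>
        hX.tendsto_measure_autocovHat hc hz hs hsT hn hns
          (fun J => hK J _ (hmem J i) _ (hmem J j)) ((i : ℤ) - j) hδ
    simpa using this
  -- The target itself moves with T through the localisation rules; it is compared with the
  -- estimator through the common limit `G (y₀, y₀)`.
  have hqlim : Tendsto (fun J => G (tar ζ J, tar ρ J)) atTop (𝓝 (G (y₀, y₀))) :=
    hcont.tendsto.comp ((htarlim ζ hζ).prodMk_nhds (htarlim ρ hρ))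
  rw [tendstoInMeasure_iff_norm]
  intro ε hε
  obtain ⟨δ, hδ, hδG⟩ := Metric.continuousAt_iff.1 hcont (ε / 2) (half_pos hε)
  have hsum := (hestlim ζ hζ δ hδ).add (hestlim ρ hρ δ hδ)
  rw [add_zero] at hsum
  refine tendsto_of_tendsto_of_tendsto_of_le_of_le' tendsto_const_nhds hsum
    (Eventually.of_forall fun _ => zero_le) ?_
  filter_upwards [hqlim.eventually (Metric.ball_mem_nhds _ (half_pos hε))] with J hJ
  -- A deviation of ε forces one of the finitely many estimated covariances to miss its limit by δ;
  -- a union bound finishes.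
  have hsub : {ω | ε ≤ ‖qTilde F (s J) (n J) (fun t => X J t ω) ζ ρ J z (p + 1) -
      q F W ζ ρ J z (p + 1) - 0‖} ⊆
      (⋃ i, ⋃ j, {ω | δ ≤ |est ζ J ω i j - y₀ i j|}) ∪
        ⋃ i, ⋃ j, {ω | δ ≤ |est ρ J ω i j - y₀ i j|} := by
    intro ω hω
    by_contra hcon
    simp only [Set.mem_union, Set.mem_iUnion, Set.mem_ofPred_eq, not_or, not_exists, not_le] at hcon
    have hdist : dist (est ζ J ω, est ρ J ω) (y₀, y₀) < δ := by
      rw [Prod.dist_eq]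
      refine max_lt ?_ ?_
      · exact (dist_pi_lt_iff hδ).2 fun i => (dist_pi_lt_iff hδ).2 fun j => hcon.1 i j
      · exact (dist_pi_lt_iff hδ).2 fun i => (dist_pi_lt_iff hδ).2 fun j => hcon.2 i j
    have h1 := hδG hdist
    rw [Set.mem_ofPred_eq, hqT, hq, sub_zero, Real.norm_eq_abs, ← Real.dist_eq] at hω
    have h2 := dist_triangle_right (G (est ζ J ω, est ρ J ω)) (G (tar ζ J, tar ρ J)) (G (y₀, y₀))
    have h3 : dist (G (tar ζ J, tar ρ J)) (G (y₀, y₀)) < ε / 2 := hJ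
    linarith
  refine (measure_mono hsub).trans ((measure_union_le _ _).trans (add_le_add ?_ ?_))
  · exact (measure_iUnion_fintype_le _ _).trans
      (Finset.sum_le_sum fun i _ => measure_iUnion_fintype_le _ _)
  · exact (measure_iUnion_fintype_le _ _).trans
      (Finset.sum_le_sum fun i _ => measure_iUnion_fintype_le _ _)
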